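/- Let $l>-\tfrac12$, let $q$ be a real-valued function on $(0,1)$ with $x\,q(x)\in L^1(0,1)$, and put $\tau=-\frac{d^2}{dx^2}+\frac{l(l+1)}{x^2}+q(x)$ and $n_l=\lfloor l+\tfrac12\rfloor$. Let $\phi(z,x)$ and $\theta(z,x)$ ($z\in\mathbb C$, $x\in(0,1)$) be solutions of $\tau u=zu$ on $(0,1)$ which are entire in $z$ and of the form $$\phi(z,x)=x^{l+1}\widetilde\phi(z,x),\qquad \theta(z,x)=\frac{x^{-l}}{2l+1}\widetilde\theta(z,x),\qquad \widetilde\phi(z,0)=\widetilde\theta(z,0)=1,$$ with $\widetilde\phi(z,\cdot),\widetilde\theta(z,\cdot)\in W^{1,1}(0,1)$ and $\widetilde\phi,\widetilde\theta\in C(\mathbb C\times[0,1])$. Write $\theta^{(k)}=\partial_z^k\theta$, $W_x(f,g)=f(x)g'(x)-f'(x)g(x)$ and $(x)_k=x(x+1)\cdots(x+k-1)$. A *Frobenius type representation* of $\theta$ with entire part $F$ consists of an entire function $F$ and, for every $z_0\in\mathbb C$, of functions $\widetilde\theta_k(z_0,\cdot)$, $k\ge0$, such that for all $z\in\mathbb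 C$, $x\in(0,1)$ $$\theta(z,x)=\frac{x^{-l}}{2l+1}\sum_{k=0}^\infty\frac{x^{2k}\,\widetilde\theta_k(z_0,x)}{k!}(z-z_0)^k+F(z)\phi(z,x),$$ where, if $l+\frac12\notin\mathbb N$ or $k<n_l$, $\widetilde\theta_k(z_0,\cdot)\in W^{1,1}(0,1)$ and $\widetilde\theta_k(z_0,0)=\frac{(-1)^k}{4^k(-l+\frac12)_k}$, and, if $l+\frac12=n_l\in\mathbb N$ and $k\ge n_l$, $\widetilde\theta_k(z_0,x)=\hat C_{l,k}\log(x)(1+o(1))$ as $x\to0$, with $$\hat C_{l,k}=-\binom{k}{n_l}\frac{C^\phi_{l,k-n_l}}{4^l\,\Gamma(l+\frac12)},\qquad C^\phi_{l,j}=\frac{(-1)^j}{4^j(l+\frac32)_j}.$$ The solution $\theta$ is called of *Frobenius type* if it has such a representation in which $F$ is a polynomial of degree at most $n_l$. Then: 1. A Frobenius type representation of $\theta$ exists, and $F$ can be chosen real (i.e. $F(\bar z)=\overline{F(z)}$) if $\theta$ is real (i.e. $\theta(\bar z,x)=\overline{\theta(z,x)}$). 2. For every such representation $\lim_{x\to0}x^{-(l+1)}\theta^{(n_l+1)}(z,x)=F^{(n_l+1)}(z)$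 for all $z\in\mathbb C$, and $\theta$ is of Frobenius type if and only if this $F$ is a polynomial of degree at most $n_l$. 3. $\theta$ is of Frobenius type if and only if $\lim_{x\to0}x^{-(l+1)}\theta^{(n_l+1)}(z,x)=0$ for all $z\in\mathbb C$. 4. $\theta$ is of Frobenius type if and only if $$\lim_{x\to0}W_x\big(\theta^{(n_l+1)}(z),\theta(\zeta)\big)=0\qquad\text{for all }z,\zeta\in\mathbb C.$$ -/

import Mathlib

open Filter Topology Set MeasureTheory

/-- The integer `n_l = ⌊l + 1/2⌋` (used for `l > -1/2`, where `l + 1/2 > 0`). -/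
noncomputable def nl (l : ℝ) : ℕ := ⌊l + 1 / 2⌋₊

/-- `u` solves `τ u = z u` on `(0,1)`, where `τ = -d²/dx² + l(l+1)/x² + q(x)`:
`u` is differentiable and `u'` is a locally absolutely continuous function with
`u'' = (l(l+1)/x² + q - z) u` almost everywhere, written in the integrated form.
(Whenever `q` is locally integrable on `(0,1)` the integrand below is locally integrable, `u` being
continuous, so this is the same as `u, u' ∈ AC_loc(0,1)` together with the a.e. equation.) -/
def IsSolution (l : ℝ) (q : ℝ → ℝ) (z : ℂ) (u : ℝ → ℂ) : Prop :=
  (∀ x ∈ Ioo (0 : ℝ) 1, DifferentiableAt ℝ u x) ∧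
  ∀ a ∈ Ioo (0 : ℝ) 1, ∀ b ∈ Ioo (0 : ℝ) 1,
    deriv u b - deriv u a = ∫ x in a..b, (((l * (l + 1) / x ^ 2 + q x : ℝ) : ℂ) - z) * u x

/-- The Sobolev space `W^{1,1}(0,1)`, as functions on `[0,1]`: the absolutely continuous functions,
that is, the indefinite integrals of integrable functions. -/
def MemW11 (f : ℝ → ℂ) : Prop :=
  ∃ g : ℝ → ℂ, IntegrableOn g (Ioo 0 1) ∧
    ∀ x ∈ Icc (0 : ℝ) 1, f x = f 0 + ∫ t in (0 : ℝ)..x, g t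

/-- `φ(z,x)`, `θ(z,x)` are solutions of `τ u = z u`, entire in `z`, of the form
`φ = x^{l+1} φ̃` and `θ = x^{-l} θ̃ / (2l+1)` on `(0,1)`, where
`φ̃(z,·), θ̃(z,·) ∈ W^{1,1}(0,1)`, `φ̃(z,0) = θ̃(z,0) = 1` and `φ̃, θ̃ ∈ C(ℂ × [0,1])`. -/
structure IsEntireSystem (l : ℝ) (q : ℝ → ℝ) (φ θ : ℂ → ℝ → ℂ) : Prop where
  phi_sol : ∀ z, IsSolution l q z (φ z)
  theta_sol : ∀ z, IsSolution l q z (θ z)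
  phi_entire : ∀ x ∈ Ioo (0 : ℝ) 1, Differentiable ℂ fun z => φ z x
  theta_entire : ∀ x ∈ Ioo (0 : ℝ) 1, Differentiable ℂ fun z => θ z x
  phi_form : ∃ φt : ℂ → ℝ → ℂ,
    (∀ z, ∀ x ∈ Ioo (0 : ℝ) 1, φ z x = ((x ^ (l + 1) : ℝ) : ℂ) * φt z x) ∧
    (∀ z, φt z 0 = 1) ∧ (∀ z, MemW11 (φt z)) ∧
    ContinuousOn (fun p : ℂ × ℝ => φt p.1 p.2) (univ ×ˢ Icc (0 : ℝ) 1)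
  theta_form : ∃ θt : ℂ → ℝ → ℂ,
    (∀ z, ∀ x ∈ Ioo (0 : ℝ) 1, θ z x = ((x ^ (-l) / (2 * l + 1) : ℝ) : ℂ) * θt z x) ∧
    (∀ z, θt z 0 = 1) ∧ (∀ z, MemW11 (θt z)) ∧
    ContinuousOn (fun p : ℂ × ℝ => θt p.1 p.2) (univ ×ˢ Icc (0 : ℝ) 1)

/-- `C^φ_{l,k} = (-1)^k / (4^k (l + 3/2)_k)`, with the Pochhammer symbol `(x)_k`. -/
noncomputable def coeffPhi (l : ℝ) (k : ℕ) : ℝ :=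
  (-1) ^ k / (4 ^ k * (ascPochhammer ℝ k).eval (l + 3 / 2))

/-- `C^θ_{l,k} = (-1)^k / (4^k (-l + 1/2)_k) = 1 / (4^k (l - k + 1/2)_k)`.
It is used when `l + 1/2` is not a positive integer, or when `k < l + 1/2`, and then the
denominator does not vanish. -/
noncomputable def coeffTheta (l : ℝ) (k : ℕ) : ℝ :=
  (-1) ^ k / (4 ^ k * (ascPochhammer ℝ k).eval (-l + 1 / 2))

/-- The coefficient of the logarithm for `l + 1/2 = n_l` a positive integer and `k ≥ n_l`:
`Ĉ^θ_{l,k} = - binom(k, n_l) C^φ_{l,k-n_l} / (4^l Γ(l + 1/2))`. -/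
noncomputable def coeffLog (l : ℝ) (k : ℕ) : ℝ :=
  -((k.choose (nl l) : ℝ) * coeffPhi l (k - nl l)) / ((4 : ℝ) ^ l * Real.Gamma (l + 1 / 2))

/-- The Frobenius type representation of `θ` with entire part `F`: for every `z₀`,
`θ(z,x) = x^{-l}/(2l+1) ∑_k x^{2k} θ̃_k(z₀,x) (z - z₀)^k / k! + F(z) φ(z,x)`.
Here `c k` is `θ̃_k(z₀,·)`. If `l + 1/2` is not an integer, all of these are in `W^{1,1}(0,1)`, with
value `C^θ_{l,k}` at `0`. If `l + 1/2` is an integer, then this holds for `k < n_l`, whereas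
`θ̃_k(z₀,x) = Ĉ^θ_{l,k} log(x) (1 + o(1))` as `x → 0` for `k ≥ n_l`. -/
structure IsFrobeniusRepresentation (l : ℝ) (φ θ : ℂ → ℝ → ℂ) (F : ℂ → ℂ) : Prop where
  entire : Differentiable ℂ F
  series : ∀ z₀ : ℂ, ∃ c : ℕ → ℝ → ℂ,
    (∀ z, ∀ x ∈ Ioo (0 : ℝ) 1,
      HasSum (fun k : ℕ => ((x ^ (-l) / (2 * l + 1) : ℝ) : ℂ) *
          ((x : ℂ) ^ (2 * k) * c k x / (k.factorial : ℂ) * (z - z₀) ^ k))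
        (θ z x - F z * φ z x)) ∧
    (∀ k : ℕ, ((∀ n : ℕ, l + 1 / 2 ≠ n) ∨ k < nl l) →
      MemW11 (c k) ∧ c k 0 = (coeffTheta l k : ℂ)) ∧
    (∀ k : ℕ, l + 1 / 2 = (nl l : ℝ) → nl l ≤ k →
      Asymptotics.IsEquivalent (𝓝[>] (0 : ℝ)) (c k)
        (fun x => ((coeffLog l k * Real.log x : ℝ) : ℂ)))

/-- `F` is a polynomial of degree at most `n`. -/
def IsPolynomialOfDegreeLE (n : ℕ) (F : ℂ → ℂ) : Prop :=
  ∃ P : Polynomial ℂ, P.natDegree ≤ n ∧ ∀ z, F z = P.eval z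

/-- `θ` is of Frobenius type: the entire function in its representation is a polynomial of degree
at most `n_l`. -/
def IsFrobeniusType (l : ℝ) (φ θ : ℂ → ℝ → ℂ) : Prop :=
  ∃ F : ℂ → ℂ, IsFrobeniusRepresentation l φ θ F ∧ IsPolynomialOfDegreeLE (nl l) F

/-- The `k`-th derivative with respect to the spectral parameter, `θ^{(k)}(z,x) = ∂_z^k θ(z,x)`. -/
noncomputable def zDeriv (k : ℕ) (θ : ℂ → ℝ → ℂ) (z : ℂ) (x : ℝ) : ℂ :=
  iteratedDeriv k (fun w => θ w x) z

/-- The Wronskian `W_x(f,g) = f(x) g'(x) - f'(x) g(x)`. -/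
noncomputable def wronskian (f g : ℝ → ℂ) (x : ℝ) : ℂ :=
  f x * deriv g x - deriv f x * g x

/-- Reality: `u(z̄, x)` is the complex conjugate of `u(z, x)`. -/
def IsRealSystem (u : ℂ → ℝ → ℂ) : Prop :=
  ∀ z, ∀ x ∈ Ioo (0 : ℝ) 1, u (starRingEnd ℂ z) x = starRingEnd ℂ (u z x)

/-! ### Absolutely continuous complex functions -/

/-! Wronskians of solutions change from a to b by (w - z)∫ₐᵇ u(w)v(z), and W(θ(z),φ(z)) = 1. Hence
θ(w) = θ(z)(1 + (w - z)∫₀ˣ θ(w)φ(z)) - φ(z) W_x(θ(w),θ(z)) (`theta_expansion`). Expanded in powers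
of w - z this is a recursion: each order gains a factor x², up to the constants of integration of
the Wronskian, which multiply φ ~ x^{l+1}. At order n_l + 1 these constants take over, because there
the integral defining the Wronskian starts to converge at 0.

Accordingly the Taylor remainder of θ at 0 after n_l + 1 terms, divided by x^{l+1}, converges
locally uniformly in w (`exists_limit_taylorRemainder`). Its limit F is entire by Weierstrass, and
real if θ is. Since Fφ is x^{-l} times O(x^{2l+1}), θ - Fφ is again a solution of the required form
(`IsEntireSystem.sub_mul`). Its derivatives of order k > n_l are o(x^{l+1}), as they do not see the
Taylor polynomial (`IsEntireSystem.exists_entirePart`).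

For such a solution the coefficients (2l+1)x^{l-2k}θ^{(k)} satisfy a recursion made of Hardy means:
from x to 1 below the critical order 2k = 2l + 1, from 0 to x above it. These means preserve W^{1,1}
and multiply the value at 0 by the ratio of consecutive C^θ. At the critical order the kernel is 1/y
and creates a logarithm, whose coefficient then follows the same recursion.

Conversely, in any representation the coefficients grow more slowly than every negative power, so
the derivative of order n_l + 1 of θ - Fφ is o(x^{l+1}), and x^{-(l+1)}θ^{(n_l+1)} → F^{(n_l+1)}
(`IsFrobeniusRepresentation.tendsto`). This limit does not involve the representation, and an entire
F is a polynomial of degree at most n_l exactly if F^{(n_l+1)} = 0. The Wronskian with θ(ζ) tends to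
-F^{(n_l+1)}, because it extracts the coefficient of φ. -/

theorem AbsolutelyContinuousOnInterval.ofReal {f : ℝ → ℝ} {a b : ℝ}
    (hf : AbsolutelyContinuousOnInterval f a b) :
    AbsolutelyContinuousOnInterval (fun x => (f x : ℂ)) a b := by
  rw [absolutelyContinuousOnInterval_iff] at hf ⊢
  simpa [Complex.dist_eq, ← Complex.ofReal_sub, Real.dist_eq] using hf

theorem IntervalIntegrable.absolutelyContinuousOnInterval_complex {f : ℝ → ℂ} {a b : ℝ}
    (hf : IntervalIntegrable f volume a b) :
    AbsolutelyContinuousOnInterval (fun x => ∫ t in a..x, f t) a b := by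
  have hre : IntervalIntegrable (fun x => (f x).re) volume a b :=
    ⟨hf.1.re, hf.2.re⟩
  have him : IntervalIntegrable (fun x => (f x).im) volume a b :=
    ⟨hf.1.im, hf.2.im⟩
  have h1 := (hre.absolutelyContinuousOnInterval_intervalIntegral (c := a) (by simp)).ofReal
  have h2 := ((him.absolutelyContinuousOnInterval_intervalIntegral (c := a) (by simp)).ofReal).const_smul
    Complex.I
  have h3 := h1.add h2
  have key : ∀ x ∈ uIcc a b, (∫ t in a..x, f t) =
      ((fun x => ((∫ t in a..x, (f t).re : ℝ) : ℂ)) +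
        Complex.I • fun x => ((∫ t in a..x, (f t).im : ℝ) : ℂ)) x := by
    intro x hx
    have hs : uIcc a x ⊆ uIcc a b := uIcc_subset_uIcc_left hx
    have e1 := hre.mono_set hs
    have e2 := him.mono_set hs
    simp only [Pi.add_apply, Pi.smul_apply, smul_eq_mul]
    rw [← intervalIntegral.integral_ofReal, ← intervalIntegral.integral_ofReal,
      ← intervalIntegral.integral_const_mul, ← intervalIntegral.integral_add
        (show IntervalIntegrable (fun t => ((f t).re : ℂ)) volume a x from ⟨e1.1.ofReal, e1.2.ofReal⟩)
        (IntervalIntegrable.const_mul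
          (show IntervalIntegrable (fun t => ((f t).im : ℂ)) volume a x from
            ⟨e2.1.ofReal, e2.2.ofReal⟩) _)]
    refine intervalIntegral.integral_congr fun t _ => ?_
    rw [mul_comm]
    exact (Complex.re_add_im _).symm
  -- Absolute continuity only involves values on `uIcc a b`, where `key` identifies the two
  -- functions.
  rw [absolutelyContinuousOnInterval_iff] at h3 ⊢
  intro ε hε
  obtain ⟨δ, hδ, H⟩ := h3 ε hε
  refine ⟨δ, hδ, fun E hE hE' => ?_⟩
  convert! H E hE hE' using 1
  refine Finset.sum_congr rfl fun i hi => ?_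
  have := hE.1 i hi
  rw [key _ this.1, key _ this.2]
  rfl

/-- The product rule for indefinite integrals. -/
theorem mul_sub_mul_eq_integral {F G f g : ℝ → ℂ} {a b : ℝ}
    (hf : IntervalIntegrable f volume a b) (hg : IntervalIntegrable g volume a b)
    (hF : ∀ x ∈ uIcc a b, F x = F a + ∫ t in a..x, f t)
    (hG : ∀ x ∈ uIcc a b, G x = G a + ∫ t in a..x, g t) :
    F b * G b - F a * G a = ∫ t in a..b, (f t * G t + F t * g t) := by
  set F1 : ℝ → ℂ := fun x => F a + ∫ t in a..x, f t with hF1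
  set G1 : ℝ → ℂ := fun x => G a + ∫ t in a..x, g t with hG1
  have cst : ∀ c : ℂ, AbsolutelyContinuousOnInterval (fun _ : ℝ => c) a b := fun c =>
    (LipschitzWith.const c).lipschitzOnWith.absolutelyContinuousOnInterval
  have acF : AbsolutelyContinuousOnInterval F1 a b :=
    (cst _).add hf.absolutelyContinuousOnInterval_complex
  have acG : AbsolutelyContinuousOnInterval G1 a b :=
    (cst _).add hg.absolutelyContinuousOnInterval_complex
  have cF := acF.continuousOn
  have cG := acG.continuousOn
  set h : ℝ → ℂ := fun t => f t * G1 t + F1 t * g t with hh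
  have hint : IntervalIntegrable h volume a b :=
    (hf.mul_continuousOn cG).add (hg.continuousOn_mul cF)
  have acP : AbsolutelyContinuousOnInterval
      (fun x => F1 x * G1 x - ∫ t in a..x, h t) a b :=
    (acF.smul acG).sub hint.absolutelyContinuousOnInterval_complex
  -- The factors are differentiable only almost everywhere. The product minus the candidate integral
  -- is absolutely continuous with derivative zero a.e., hence constant.
  obtain ⟨C, hC⟩ := acP.const_of_ae_hasDerivAt_zero (by
    filter_upwards [hf.ae_hasDerivAt_integral, hg.ae_hasDerivAt_integral,
      hint.ae_hasDerivAt_integral] with x h1 h2 h3 hx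
    have e1 : HasDerivAt F1 (f x) x := (h1 hx a (by simp)).const_add (F a)
    have e2 : HasDerivAt G1 (g x) x := (h2 hx a (by simp)).const_add (G a)
    have e3 := (e1.mul e2).sub (h3 hx a (by simp))
    simpa [hh] using! e3)
  have hA := hC a (by simp)
  have hB := hC b (by simp)
  have e : ∫ t in a..b, (f t * G t + F t * g t) = ∫ t in a..b, h t := by
    refine intervalIntegral.integral_congr fun t ht => ?_
    simp only [hh, hF1, hG1, ← hF t ht, ← hG t ht]
  have eF : F b = F1 b := hF b (by simp)
  have eG : G b = G1 b := hG b (by simp)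
  have eF' : F a = F1 a := by simp [hF1]
  have eG' : G a = G1 a := by simp [hG1]
  rw [e, eF, eG, eF', eG']
  simp only [intervalIntegral.integral_same, sub_zero] at hA
  linear_combination hB - hA

/-! ### L'Hôpital's rule for complex-valued numerators -/

/-- Replaces Cauchy's mean value theorem, which fails for complex values. In both forms of
L'Hôpital's rule it is applied to f - L g, with a multiple of g or -g as majorant. -/
theorem norm_sub_le_of_norm_deriv_le {f f' : ℝ → ℂ} {B B' : ℝ → ℝ} {a b : ℝ} (hab : a ≤ b)
    (hf : ∀ x ∈ Icc a b, HasDerivAt f (f' x) x) (hB : ∀ x ∈ Icc a b, HasDerivAt B (B' x) x)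
    (h : ∀ x ∈ Icc a b, ‖f' x‖ ≤ B' x) : ‖f b - f a‖ ≤ B b - B a := by
  have := image_norm_le_of_norm_deriv_right_le_deriv_boundary' (f := fun x => f x - f a)
    (f' := f') (B := fun x => B x - B a) (B' := B') (a := a) (b := b)
    (fun x hx => ((hf x hx).sub_const _).continuousAt.continuousWithinAt)
    (fun x hx => ((hf x (Ico_subset_Icc_self hx)).sub_const _).hasDerivWithinAt) (by simp)
    (fun x hx => ((hB x hx).sub_const _).continuousAt.continuousWithinAt)
    (fun x hx => ((hB x (Ico_subset_Icc_self hx)).sub_const _).hasDerivWithinAt)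
    (fun x hx => h x (Ico_subset_Icc_self hx))
  exact this ⟨hab, le_rfl⟩

theorem eventually_nhdsGT_zero_iff {p : ℝ → Prop} :
    (∀ᶠ x in 𝓝[>] (0 : ℝ), p x) ↔ ∃ d > 0, ∀ x, 0 < x → x ≤ d → p x := by
  rw [Filter.Eventually, mem_nhdsGT_iff_exists_Ioc_subset]
  constructor
  · rintro ⟨d, hd, h⟩
    exact ⟨d, hd, fun x h0 h1 => h ⟨h0, h1⟩⟩
  · rintro ⟨d, hd, h⟩
    exact ⟨d, hd, fun x hx => h x hx.1 hx.2⟩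

theorem eventually_norm_sub_mul_le {f' : ℝ → ℂ} {g' : ℝ → ℝ} {L : ℂ}
    (hg' : ∀ᶠ x in 𝓝[>] (0 : ℝ), g' x ≠ 0)
    (h : Tendsto (fun x => f' x / g' x) (𝓝[>] 0) (𝓝 L)) {ε : ℝ} (hε : 0 < ε) :
    ∀ᶠ x in 𝓝[>] (0 : ℝ), ‖f' x - L * g' x‖ ≤ ε * |g' x| := by
  filter_upwards [hg', (tendsto_iff_norm_sub_tendsto_zero.1 h).eventually (ge_mem_nhds hε)]
    with x h1 h2
  have h3 : (g' x : ℂ) ≠ 0 := by exact_mod_cast h1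
  have : f' x - L * g' x = (f' x / g' x - L) * g' x := by field_simp
  rw [this, norm_mul, Complex.norm_real, Real.norm_eq_abs]
  gcongr

/-- On [x, d] the function f - L g varies by at most (ε/2)(g(x) - g(d)). The remaining constant, its
norm at d, is absorbed because g(x) → ∞, so no limit of f is required. -/
theorem tendsto_div_of_deriv_atTop {f f' : ℝ → ℂ} {g g' : ℝ → ℝ} {L : ℂ}
    (hf : ∀ᶠ x in 𝓝[>] (0 : ℝ), HasDerivAt f (f' x) x)
    (hg : ∀ᶠ x in 𝓝[>] (0 : ℝ), HasDerivAt g (g' x) x)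
    (hg' : ∀ᶠ x in 𝓝[>] (0 : ℝ), g' x < 0) (hgt : Tendsto g (𝓝[>] 0) atTop)
    (h : Tendsto (fun x => f' x / g' x) (𝓝[>] 0) (𝓝 L)) :
    Tendsto (fun x => f x / g x) (𝓝[>] 0) (𝓝 L) := by
  rw [tendsto_iff_norm_sub_tendsto_zero, Metric.tendsto_nhds]
  intro ε hε
  have hall := hf.and (hg.and (hg'.and ((hgt.eventually_gt_atTop 0).and
    (eventually_norm_sub_mul_le (hg'.mono fun _ hx => hx.ne) h (half_pos hε)))))
  obtain ⟨d, hd, H⟩ := eventually_nhdsGT_zero_iff.1 hall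
  have hb := hgt.eventually_gt_atTop (2 * ‖f d - L * g d‖ / ε)
  filter_upwards [hb, Ioc_mem_nhdsGT hd] with x hx1 hx
  have gx := (H x hx.1 hx.2).2.2.2.1
  have gd := (H d hd le_rfl).2.2.2.1
  have key := norm_sub_le_of_norm_deriv_le (f := fun y => f y - L * g y)
    (f' := fun y => f' y - L * g' y)
    (B := fun y => (ε / 2) * (- g y)) (B' := fun y => (ε / 2) * (- g' y)) hx.2
    (fun y hy => by
      have := H y (hx.1.trans_le hy.1) hy.2
      exact this.1.sub ((this.2.1.ofReal_comp).const_mul L))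
    (fun y hy => (H y (hx.1.trans_le hy.1) hy.2).2.1.neg.const_mul _)
    (fun y hy => by
      have := H y (hx.1.trans_le hy.1) hy.2
      rw [← abs_of_neg this.2.2.1]
      exact this.2.2.2.2)
  have gx' : (g x : ℂ) ≠ 0 := by exact_mod_cast gx.ne'
  have e : f x / g x - L = (f x - L * g x) / g x := by field_simp
  rw [dist_zero_right, norm_norm, e, norm_div, Complex.norm_real, Real.norm_eq_abs, abs_of_pos gx,
    div_lt_iff₀ gx]
  have t : ‖f x - L * g x‖ ≤ ‖f d - L * g d‖ + ‖(f d - L * g d) - (f x - L * g x)‖ := by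
    have := norm_sub_le (f d - L * g d) ((f d - L * g d) - (f x - L * g x))
    simpa using this
  rw [div_lt_iff₀ hε] at hx1
  have : 0 < ε / 2 * g d := by positivity
  nlinarith

/-- The estimate of f - L g on [y, x] has a boundary term at y, which disappears as y → 0. -/
theorem tendsto_div_of_deriv_zero {f f' : ℝ → ℂ} {g g' : ℝ → ℝ} {L : ℂ}
    (hf : ∀ᶠ x in 𝓝[>] (0 : ℝ), HasDerivAt f (f' x) x)
    (hg : ∀ᶠ x in 𝓝[>] (0 : ℝ), HasDerivAt g (g' x) x)
    (hg' : ∀ᶠ x in 𝓝[>] (0 : ℝ), 0 < g' x) (hf0 : Tendsto f (𝓝[>] 0) (𝓝 0))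
    (hg0 : Tendsto g (𝓝[>] 0) (𝓝 0))
    (hgp : ∀ᶠ x in 𝓝[>] (0 : ℝ), 0 < g x)
    (h : Tendsto (fun x => f' x / g' x) (𝓝[>] 0) (𝓝 L)) :
    Tendsto (fun x => f x / g x) (𝓝[>] 0) (𝓝 L) := by
  rw [tendsto_iff_norm_sub_tendsto_zero, Metric.tendsto_nhds]
  intro ε hε
  have hall := hf.and (hg.and (hg'.and (hgp.and
    (eventually_norm_sub_mul_le (hg'.mono fun _ hx => hx.ne') h (half_pos hε)))))
  obtain ⟨d, hd, H⟩ := eventually_nhdsGT_zero_iff.1 hall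
  filter_upwards [Ioc_mem_nhdsGT hd] with x hx
  have gx := (H x hx.1 hx.2).2.2.2.1
  have key : ∀ y, 0 < y → y ≤ x → ‖(f x - L * g x) - (f y - L * g y)‖ ≤
      ε / 2 * g x - ε / 2 * g y := fun y hy hyx =>
    norm_sub_le_of_norm_deriv_le (f := fun y => f y - L * g y)
      (f' := fun y => f' y - L * g' y)
      (B := fun y => (ε / 2) * g y) (B' := fun y => (ε / 2) * g' y) hyx
      (fun t ht => by
        have := H t (hy.trans_le ht.1) (ht.2.trans hx.2)
        exact this.1.sub ((this.2.1.ofReal_comp).const_mul L))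
      (fun t ht => (H t (hy.trans_le ht.1) (ht.2.trans hx.2)).2.1.const_mul _)
      (fun t ht => by
        have := H t (hy.trans_le ht.1) (ht.2.trans hx.2)
        simpa only [abs_of_pos this.2.2.1] using this.2.2.2.2)
  have hlim : ‖f x - L * g x‖ ≤ ε / 2 * g x := by
    have hg0' : Tendsto (fun y => (g y : ℂ)) (𝓝[>] 0) (𝓝 0) := by
      simpa using! (Complex.continuous_ofReal.tendsto 0).comp hg0
    have l1 : Tendsto (fun y => ‖(f x - L * g x) - (f y - L * g y)‖) (𝓝[>] 0)
        (𝓝 ‖f x - L * g x‖) := by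
      have := ((tendsto_const_nhds (x := f x - L * g x)).sub (hf0.sub (hg0'.const_mul L))).norm
      simpa using this
    have l2 : Tendsto (fun y => ε / 2 * g x - ε / 2 * g y) (𝓝[>] 0) (𝓝 (ε / 2 * g x)) := by
      have := (tendsto_const_nhds (x := ε / 2 * g x)).sub (hg0.const_mul (ε / 2))
      simpa using this
    refine le_of_tendsto_of_tendsto l1 l2 ?_
    filter_upwards [Ioc_mem_nhdsGT hx.1] with y hy using key y hy.1 hy.2
  have gx' : (g x : ℂ) ≠ 0 := by exact_mod_cast gx.ne'
  have e : f x / g x - L = (f x - L * g x) / g x := by field_simp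
  rw [dist_zero_right, norm_norm, e, norm_div, Complex.norm_real, Real.norm_eq_abs, abs_of_pos gx,
    div_lt_iff₀ gx]
  nlinarith

/-! ### Families of entire functions -/

/-- A family `f(z,x)`, `x ∈ S`, of entire functions which is jointly continuous. -/
structure EntireFamily (S : Set ℝ) (f : ℂ → ℝ → ℂ) : Prop where
  cont : ContinuousOn (fun p : ℂ × ℝ => f p.1 p.2) (univ ×ˢ S)
  entire : ∀ x ∈ S, Differentiable ℂ fun z => f z x

theorem zDeriv_zero (f : ℂ → ℝ → ℂ) : zDeriv 0 f = f := by
  ext z x; simp [zDeriv]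

theorem zDeriv_succ (k : ℕ) (f : ℂ → ℝ → ℂ) :
    zDeriv (k + 1) f = fun z x => deriv (fun w => zDeriv k f w x) z := by
  ext z x; simp only [zDeriv, iteratedDeriv_succ]

namespace EntireFamily

variable {S : Set ℝ} {f g : ℂ → ℝ → ℂ}

theorem mono (hf : EntireFamily S f) {T : Set ℝ} (h : T ⊆ S) : EntireFamily T f :=
  ⟨hf.cont.mono (prod_mono_right h), fun x hx => hf.entire x (h hx)⟩

/-- Joint continuity says that x ↦ f(·,x) is continuous for locally uniform convergence, and by
Weierstrass differentiation of entire functions is continuous for that convergence. -/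
theorem deriv (hf : EntireFamily S f) : EntireFamily S fun z x => deriv (fun w => f w x) z := by
  refine ⟨?_, fun x hx => ?_⟩
  · let F : C(S × ℂ, ℂ) := ⟨fun p => f p.2 p.1, by
      exact hf.cont.comp_continuous (f := fun p : S × ℂ => ((p.2, p.1) : ℂ × ℝ)) (by fun_prop)
        fun p => ⟨mem_univ _, p.1.2⟩⟩
    have hF : ∀ x : S, Differentiable ℂ (F.curry x) := fun x => hf.entire x x.2
    let G : S → C(ℂ, ℂ) := fun x => ⟨_root_.deriv (F.curry x), (hF x).deriv.continuous⟩
    have hG : Continuous G := by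
      rw [continuous_iff_continuousAt]
      intro x
      have h1 := F.curry.continuous.tendsto x
      rw [ContinuousMap.tendsto_iff_tendstoLocallyUniformly,
        ← tendstoLocallyUniformlyOn_univ] at h1
      have h2 := h1.deriv (Eventually.of_forall fun y => (hF y).differentiableOn) isOpen_univ
      rw [ContinuousAt, ContinuousMap.tendsto_iff_tendstoLocallyUniformly,
        ← tendstoLocallyUniformlyOn_univ]
      exact h2
    have h3 : Continuous fun p : S × ℂ => G p.1 p.2 :=
      ContinuousMap.continuous_uncurry_of_continuous ⟨G, hG⟩
    rw [continuousOn_iff_continuous_domRestrict]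
    exact h3.comp (f := fun p : (univ ×ˢ S : Set (ℂ × ℝ)) => ((⟨p.1.2, p.2.2⟩, p.1.1) : S × ℂ))
      (by fun_prop)
  · exact (hf.entire x hx).deriv

theorem zDeriv (hf : EntireFamily S f) (k : ℕ) : EntireFamily S (zDeriv k f) := by
  induction k with
  | zero => rwa [zDeriv_zero]
  | succ k ih => rw [zDeriv_succ]; exact ih.deriv

theorem continuousOn_right (hf : EntireFamily S f) (z : ℂ) : ContinuousOn (f z) S :=
  hf.cont.comp (f := fun x : ℝ => (z, x)) (by fun_prop) fun _ hx => ⟨mem_univ _, hx⟩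

theorem exists_bound (hf : EntireFamily S f) {K : Set ℂ} {T : Set ℝ} (hK : IsCompact K)
    (hT : IsCompact T) (hTS : T ⊆ S) : ∃ M, ∀ z ∈ K, ∀ x ∈ T, ‖f z x‖ ≤ M := by
  obtain ⟨M, hM⟩ := (hK.prod hT).exists_bound_of_continuousOn
    (hf.cont.mono (prod_mono (subset_univ K) hTS))
  exact ⟨M, fun z hz x hx => hM (z, x) ⟨hz, hx⟩⟩

theorem tendstoLocallyUniformlyOn (hf : EntireFamily S f) {x₀ : ℝ} (hx₀ : x₀ ∈ S) :
    TendstoLocallyUniformlyOn (fun x z => f z x) (fun z => f z x₀) (𝓝[S] x₀) univ := by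
  rw [tendstoLocallyUniformlyOn_iff_forall_tendsto]
  intro z _
  have h1 : ContinuousWithinAt (fun p : ℂ × ℝ => f p.1 p.2) (univ ×ˢ S) (z, x₀) :=
    hf.cont _ ⟨mem_univ _, hx₀⟩
  have h2 : ContinuousAt (fun w => f w x₀) z := (hf.entire x₀ hx₀ z).continuousAt
  rw [nhdsWithin_univ]
  have h3 : Tendsto (fun p : ℝ × ℂ => (p.2, p.1)) (𝓝[S] x₀ ×ˢ 𝓝 z) (𝓝[univ ×ˢ S] (z, x₀)) := by
    rw [nhdsWithin_prod_eq, nhdsWithin_univ]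
    exact tendsto_snd.prodMk tendsto_fst
  have h4 := (h2.tendsto.comp (tendsto_snd (f := 𝓝[S] x₀))).prodMk_nhds (h1.tendsto.comp h3)
  exact h4.mono_right (nhds_le_uniformity _)

variable {a b : ℝ} {m : ℝ → ℂ}

theorem intervalIntegrable (hf : EntireFamily S f) (hS : uIcc a b ⊆ S)
    (hm : IntervalIntegrable m volume a b) (z : ℂ) :
    IntervalIntegrable (fun y => f z y * m y) volume a b :=
  hm.continuousOn_mul ((hf.continuousOn_right z).mono hS)

theorem hasDerivAt_integral (hf : EntireFamily S f) (hS : uIcc a b ⊆ S)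
    (hm : IntervalIntegrable m volume a b) (z : ℂ) :
    HasDerivAt (fun w => ∫ y in a..b, f w y * m y)
      (∫ y in a..b, _root_.deriv (fun w => f w y) z * m y) z := by
  obtain ⟨M, hM⟩ := hf.deriv.exists_bound (isCompact_closedBall z 1) isCompact_uIcc hS
  refine (intervalIntegral.hasDerivAt_integral_of_dominated_loc_of_deriv_le
    (s := Metric.closedBall z 1) (bound := fun y => M * ‖m y‖)
    (F := fun w y => f w y * m y) (F' := fun w y => _root_.deriv (fun w => f w y) w * m y)
    (Metric.closedBall_mem_nhds z one_pos)
    (Eventually.of_forall fun w => ?_) (hf.intervalIntegrable hS hm z) ?_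
    (Eventually.of_forall fun y hy w hw => ?_) (hm.norm.const_mul M)
    (Eventually.of_forall fun y hy w hw => ?_)).2
  · exact (hf.intervalIntegrable hS hm w).aestronglyMeasurable_restrict_uIoc
  · exact (hf.deriv.intervalIntegrable hS hm z).aestronglyMeasurable_restrict_uIoc
  · rw [norm_mul]
    exact mul_le_mul_of_nonneg_right (hM w hw y (uIoc_subset_uIcc hy)) (norm_nonneg _)
  · exact ((hf.entire y (hS (uIoc_subset_uIcc hy)) w).hasDerivAt).mul_const _

theorem differentiable_integral (hf : EntireFamily S f) (hS : uIcc a b ⊆ S)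
    (hm : IntervalIntegrable m volume a b) :
    Differentiable ℂ fun w => ∫ y in a..b, f w y * m y :=
  fun z => (hf.hasDerivAt_integral hS hm z).differentiableAt

theorem iteratedDeriv_integral (hf : EntireFamily S f) (hS : uIcc a b ⊆ S)
    (hm : IntervalIntegrable m volume a b) (k : ℕ) :
    iteratedDeriv k (fun w => ∫ y in a..b, f w y * m y) =
      fun z => ∫ y in a..b, _root_.zDeriv k f z y * m y := by
  induction k with
  | zero => simp [zDeriv_zero]
  | succ k ih =>
    rw [iteratedDeriv_succ, ih, zDeriv_succ]
    ext z
    exact ((hf.zDeriv k).hasDerivAt_integral hS hm z).deriv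

end EntireFamily

/-! ### Iterated derivatives of entire functions -/

theorem TendstoLocallyUniformlyOn.iteratedDeriv {ι : Type*} {p : Filter ι} {F : ι → ℂ → ℂ}
    {f : ℂ → ℂ} (h : TendstoLocallyUniformlyOn F f p univ)
    (hF : ∀ᶠ i in p, Differentiable ℂ (F i)) (k : ℕ) :
    TendstoLocallyUniformlyOn (fun i => iteratedDeriv k (F i)) (iteratedDeriv k f) p univ := by
  induction k with
  | zero => simpa using h
  | succ k ih =>
    simp only [iteratedDeriv_succ]
    refine ih.deriv ?_ isOpen_univ
    filter_upwards [hF] with i hi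
    exact (hi.contDiff.differentiable_iteratedDeriv k (WithTop.coe_lt_top _)).differentiableOn

theorem Differentiable.iteratedDeriv {f : ℂ → ℂ} (hf : Differentiable ℂ f) (k : ℕ) :
    Differentiable ℂ (iteratedDeriv k f) :=
  hf.contDiff.differentiable_iteratedDeriv k (WithTop.coe_lt_top _)

/-- Leibniz rule for a linear factor. For k = 0 the truncated k - 1 is harmless, as its coefficient
is 0. The rule is used at w = z, where only k f^{(k-1)} survives. -/
theorem iteratedDeriv_sub_mul {f : ℂ → ℂ} (hf : Differentiable ℂ f) (z : ℂ) (k : ℕ) (w : ℂ) :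
    iteratedDeriv k (fun w => (w - z) * f w) w =
      (w - z) * iteratedDeriv k f w + k * iteratedDeriv (k - 1) f w := by
  induction k generalizing w with
  | zero => simp
  | succ k ih =>
    rw [iteratedDeriv_succ, funext ih]
    have h1 : HasDerivAt (fun w => (w - z) * iteratedDeriv k f w)
        (1 * iteratedDeriv k f w + (w - z) * iteratedDeriv (k + 1) f w) w := by
      rw [iteratedDeriv_succ]
      exact ((hasDerivAt_id w).sub_const z).mul (hf.iteratedDeriv k w).hasDerivAt
    have h2 : HasDerivAt (fun w => (k : ℂ) * iteratedDeriv (k - 1) f w)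
        (k * iteratedDeriv k f w) w := by
      rcases k with _ | k
      · simpa using hasDerivAt_const w (0 : ℂ)
      · have := ((hf.iteratedDeriv k w).hasDerivAt).const_mul ((k + 1 : ℕ) : ℂ)
        rwa [← iteratedDeriv_succ] at this
    refine ((h1.add h2).deriv).trans ?_
    push_cast
    ring

theorem iteratedDeriv_eq_of_hasSum {f : ℂ → ℂ} {z₀ : ℂ} {a : ℕ → ℂ}
    (h : ∀ z, HasSum (fun k => a k * (z - z₀) ^ k) (f z)) (k : ℕ) :
    iteratedDeriv k f z₀ = k.factorial * a k := by
  have hp : HasFPowerSeriesAt f (FormalMultilinearSeries.ofScalars ℂ a) z₀ := by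
    rw [hasFPowerSeriesAt_iff]
    refine Eventually.of_forall fun z => ?_
    simpa [FormalMultilinearSeries.coeff_ofScalars, mul_comm] using h (z₀ + z)
  have := hp.eq_formalMultilinearSeries hp.analyticAt.hasFPowerSeriesAt
  have h2 := congrArg (fun p => p.coeff k) this
  simp only [FormalMultilinearSeries.coeff_ofScalars] at h2
  rw [h2, mul_div_cancel₀ _ (by exact_mod_cast k.factorial_ne_zero)]

theorem isPolynomialOfDegreeLE_iff {F : ℂ → ℂ} (hF : Differentiable ℂ F) (n : ℕ) :
    IsPolynomialOfDegreeLE n F ↔ ∀ z, iteratedDeriv (n + 1) F z = 0 := by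
  constructor
  · rintro ⟨P, hP, h⟩ z
    have hF' : F = fun z => P.eval z := funext h
    have : ∀ k, iteratedDeriv k (fun z => P.eval z) = fun z => (Polynomial.derivative^[k] P).eval z := by
      intro k
      induction k with
      | zero => simp
      | succ k ih =>
        rw [iteratedDeriv_succ, ih, Function.iterate_succ_apply']
        ext z
        exact Polynomial.deriv _
    rw [hF', this, Polynomial.iterate_derivative_eq_zero (by omega)]
    simp
  · intro h
    have hz : ∀ k, n < k → iteratedDeriv k F = 0 := by
      intro k hk
      obtain ⟨j, rfl⟩ := Nat.exists_eq_add_of_le hk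
      induction j with
      | zero => exact funext h
      | succ j ih =>
        rw [← add_assoc, iteratedDeriv_succ, ih (by omega)]
        ext z
        exact deriv_const z 0
    refine ⟨∑ k ∈ Finset.range (n + 1),
      Polynomial.C ((k.factorial : ℂ)⁻¹ * iteratedDeriv k F 0) * Polynomial.X ^ k, ?_, fun z => ?_⟩
    · refine Polynomial.natDegree_sum_le_of_forall_le _ _ fun k hk => ?_
      exact (Polynomial.natDegree_C_mul_X_pow_le _ _).trans (by simpa [Nat.lt_succ_iff] using hk)
    · have h1 := Complex.hasSum_taylorSeries_of_entire hF 0 z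
      have h2 := hasSum_sum_of_ne_finset_zero (L := .unconditional ℕ) (s := Finset.range (n + 1))
        (f := fun k => (k.factorial : ℂ)⁻¹ • (z - 0) ^ k • iteratedDeriv k F 0) (fun k hk => by
          rw [hz k (by simpa [Nat.lt_succ_iff] using hk)]; simp)
      rw [h1.unique h2, Polynomial.eval_finsetSum]
      refine Finset.sum_congr rfl fun k _ => ?_
      simp
      ring

/-! ### The Sobolev space `W^{1,1}(0,1)` -/

theorem continuousOn_Icc_of_tendsto {E : Type*} [TopologicalSpace E] {f : ℝ → E}
    (h : ContinuousOn f (Ioc 0 1)) (h0 : Tendsto f (𝓝[>] 0) (𝓝 (f 0))) :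
    ContinuousOn f (Icc 0 1) := by
  intro x hx
  rcases hx.1.eq_or_lt with rfl | hpos
  · have : ContinuousWithinAt f (Ioi 0) 0 := h0
    exact (continuousWithinAt_insert_self.2 this).mono fun y hy => by
      rcases hy.1.eq_or_lt with h | h
      · exact Or.inl h.symm
      · exact Or.inr h
  · refine (h x ⟨hpos, hx.2⟩).mono_of_mem_nhdsWithin ?_
    filter_upwards [mem_nhdsWithin_of_mem_nhds (Ioi_mem_nhds hpos), self_mem_nhdsWithin]
      with y hy hy2 using ⟨hy, hy2.2⟩

theorem hasDerivAt_integral_of_continuousOn {k : ℝ → ℂ} (hk : ContinuousOn k (Ioo 0 1)) {a x : ℝ}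
    (hx : x ∈ Ioo (0 : ℝ) 1) (hi : IntervalIntegrable k volume a x) :
    HasDerivAt (fun y => ∫ t in a..y, k t) (k x) x :=
  intervalIntegral.integral_hasDerivAt_right hi (hk.stronglyMeasurableAtFilter isOpen_Ioo x hx)
    (hk.continuousAt (Ioo_mem_nhds hx.1 hx.2))

theorem hasDerivAt_integral_left_of_continuousOn {k : ℝ → ℂ} (hk : ContinuousOn k (Ioo 0 1))
    {b x : ℝ} (hx : x ∈ Ioo (0 : ℝ) 1) (hi : IntervalIntegrable k volume x b) :
    HasDerivAt (fun y => ∫ t in y..b, k t) (-k x) x :=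
  intervalIntegral.integral_hasDerivAt_left hi (hk.stronglyMeasurableAtFilter isOpen_Ioo x hx)
    (hk.continuousAt (Ioo_mem_nhds hx.1 hx.2))

theorem intervalIntegrable_ofReal_rpow {r : ℝ} (hr : -1 < r) (a b : ℝ) :
    IntervalIntegrable (fun y => ((y ^ r : ℝ) : ℂ)) volume a b :=
  let h := intervalIntegral.intervalIntegrable_rpow' (a := a) (b := b) hr
  ⟨h.1.ofReal, h.2.ofReal⟩

theorem continuousOn_ofReal_rpow (r : ℝ) :
    ContinuousOn (fun y : ℝ => ((y ^ r : ℝ) : ℂ)) (Ioi 0) :=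
  Complex.continuous_ofReal.comp_continuousOn
    (continuousOn_id.rpow_const fun _ hx => Or.inl (ne_of_gt hx))

theorem hasDerivAt_ofReal_rpow (r : ℝ) {x : ℝ} (hx : 0 < x) :
    HasDerivAt (fun y : ℝ => ((y ^ r : ℝ) : ℂ)) ((r * x ^ (r - 1) : ℝ) : ℂ) x :=
  (Real.hasDerivAt_rpow_const (Or.inl hx.ne')).ofReal_comp

namespace MemW11

variable {f g : ℝ → ℂ}

theorem intervalIntegrable_of_integrableOn (hf : IntegrableOn f (Ioo 0 1)) {a b : ℝ}
    (ha : a ∈ Icc (0 : ℝ) 1) (hb : b ∈ Icc (0 : ℝ) 1) : IntervalIntegrable f volume a b := by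
  have : IntervalIntegrable f volume 0 1 := by
    rw [intervalIntegrable_iff_integrableOn_Ioc_of_le zero_le_one]
    rwa [integrableOn_Ioc_iff_integrableOn_Ioo]
  refine this.mono_set ?_
  rw [uIcc_of_le zero_le_one]
  exact uIcc_subset_Icc ha hb

theorem continuousOn (hf : MemW11 f) : ContinuousOn f (Icc 0 1) := by
  obtain ⟨f', hf', H⟩ := hf
  have h1 : ContinuousOn (fun x => ∫ t in (0 : ℝ)..x, f' t) (Icc 0 1) := by
    have := intervalIntegral.continuousOn_primitive_interval (f := f') (μ := volume) (a := 0) (b := 1)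
    rw [uIcc_of_le zero_le_one] at this
    exact this (by rwa [integrableOn_Icc_iff_integrableOn_Ioo])
  exact (h1.const_add (f 0)).congr H

theorem const (c : ℂ) : MemW11 fun _ => c := ⟨0, integrableOn_zero, fun x _ => by simp⟩

theorem add (hf : MemW11 f) (hg : MemW11 g) : MemW11 fun x => f x + g x := by
  obtain ⟨f', hf', H⟩ := hf
  obtain ⟨g', hg', H'⟩ := hg
  refine ⟨fun x => f' x + g' x, hf'.add hg', fun x hx => ?_⟩
  rw [intervalIntegral.integral_add (intervalIntegrable_of_integrableOn hf' (by simp) hx)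
    (intervalIntegrable_of_integrableOn hg' (by simp) hx)]
  simp only [H x hx, H' x hx]
  ring

theorem mul (hf : MemW11 f) (hg : MemW11 g) : MemW11 fun x => f x * g x := by
  have cf := hf.continuousOn
  have cg := hg.continuousOn
  obtain ⟨f', hf', H⟩ := hf
  obtain ⟨g', hg', H'⟩ := hg
  refine ⟨fun x => f' x * g x + f x * g' x, ?_, fun x hx => ?_⟩
  · rw [← integrableOn_Icc_iff_integrableOn_Ioo] at hf' hg' ⊢
    exact (hf'.mul_continuousOn cg isCompact_Icc).add (hg'.continuousOn_mul cf isCompact_Icc)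
  · have hsub : uIcc 0 x ⊆ Icc (0 : ℝ) 1 := uIcc_subset_Icc (by simp) hx
    rw [← mul_sub_mul_eq_integral (intervalIntegrable_of_integrableOn hf' (by simp) hx)
      (intervalIntegrable_of_integrableOn hg' (by simp) hx) (fun y hy => H y (hsub hy))
      (fun y hy => H' y (hsub hy))]
    ring

theorem const_mul (hf : MemW11 f) (c : ℂ) : MemW11 fun x => c * f x := (const c).mul hf

/-- A nonnegative derivative of a function that is continuous up to the endpoints is automatically
integrable. So m' is an integrable bound for f', without any estimate near 0. -/
theorem of_norm_deriv_le {f' : ℝ → ℂ} {m m' : ℝ → ℝ} (hf : ContinuousOn f (Icc 0 1))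
    (hf' : ∀ x ∈ Ioo (0 : ℝ) 1, HasDerivAt f (f' x) x) (hm : ContinuousOn m (Icc 0 1))
    (hm' : ∀ x ∈ Ioo (0 : ℝ) 1, HasDerivAt m (m' x) x)
    (h : ∀ x ∈ Ioo (0 : ℝ) 1, ‖f' x‖ ≤ m' x) : MemW11 f := by
  have i1 : IntegrableOn m' (Ioo 0 1) :=
    (intervalIntegral.integrableOn_deriv_of_nonneg hm hm'
      fun x hx => (norm_nonneg _).trans (h x hx)).mono_set Ioo_subset_Ioc_self
  have i2 : IntegrableOn f' (Ioo 0 1) := by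
    refine Integrable.mono' i1 ?_ ?_
    · refine (aestronglyMeasurable_deriv f _).congr ?_
      filter_upwards [ae_restrict_mem measurableSet_Ioo] with x hx using (hf' x hx).deriv
    · filter_upwards [ae_restrict_mem measurableSet_Ioo] with x hx using h x hx
  refine ⟨f', i2, fun x hx => ?_⟩
  rw [intervalIntegral.integral_eq_sub_of_hasDerivAt_of_le hx.1
    (hf.mono (Icc_subset_Icc_right hx.2)) (fun y hy => hf' y ⟨hy.1, hy.2.trans_le hx.2⟩)
    (intervalIntegrable_of_integrableOn i2 (by simp) hx)]
  ring

theorem rpow {s : ℝ} (hs : 0 < s) : MemW11 fun x => ((x ^ s : ℝ) : ℂ) := by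
  have c : ContinuousOn (fun x : ℝ => x ^ s) (Icc 0 1) :=
    (Real.continuous_rpow_const hs.le).continuousOn
  refine of_norm_deriv_le (Complex.continuous_ofReal.comp_continuousOn c)
    (fun x hx => hasDerivAt_ofReal_rpow s hx.1) c
    (fun x hx => Real.hasDerivAt_rpow_const (Or.inl hx.1.ne')) fun x hx => ?_
  rw [Complex.norm_real, Real.norm_eq_abs, abs_of_nonneg]
  exact mul_nonneg hs.le (Real.rpow_nonneg hx.1.le _)

/-- The modulus of continuity of a function in `W^{1,1}` is that of a monotone function. -/
theorem exists_majorant (hf : MemW11 f) : ∃ N : ℝ → ℝ, ContinuousOn N (Icc 0 1) ∧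
    ∀ x ∈ Icc (0 : ℝ) 1, ∀ y ∈ Icc (0 : ℝ) 1, x ≤ y → ‖f y - f x‖ ≤ N y - N x := by
  obtain ⟨f', hf', H⟩ := hf
  refine ⟨fun x => ∫ t in (0 : ℝ)..x, ‖f' t‖, ?_, fun x hx y hy hxy => ?_⟩
  · have := intervalIntegral.continuousOn_primitive_interval (f := fun t => ‖f' t‖)
      (μ := volume) (a := 0) (b := 1)
    rw [uIcc_of_le zero_le_one] at this
    exact this (by rw [integrableOn_Icc_iff_integrableOn_Ioo]; exact hf'.norm)
  · have i0x := intervalIntegrable_of_integrableOn hf' (a := 0) (by simp) hx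
    have i0y := intervalIntegrable_of_integrableOn hf' (a := 0) (by simp) hy
    rw [H x hx, H y hy, add_sub_add_left_eq_sub,
      intervalIntegral.integral_interval_sub_left i0y i0x,
      intervalIntegral.integral_interval_sub_left i0y.norm i0x.norm]
    exact intervalIntegral.norm_integral_le_integral_norm hxy

end MemW11

/-- The Hardy type mean `x^{-p} ∫₀ˣ y^{p-1} h(y) dy`. -/
noncomputable def lowerMean (p : ℝ) (h : ℝ → ℂ) (x : ℝ) : ℂ :=
  if x = 0 then h 0 / p else ((x ^ (-p) : ℝ) : ℂ) * ∫ y in (0 : ℝ)..x, ((y ^ (p - 1) : ℝ) : ℂ) * h y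

/-- The Hardy type mean `x^s ∫ₓ¹ y^{-s-1} h(y) dy`. -/
noncomputable def upperMean (s : ℝ) (h : ℝ → ℂ) (x : ℝ) : ℂ :=
  if x = 0 then h 0 / s else ((x ^ s : ℝ) : ℂ) * ∫ y in x..1, ((y ^ (-s - 1) : ℝ) : ℂ) * h y

/-! ### Regularity of the Hardy means at 0. -/

section Means

variable {p : ℝ} {h : ℝ → ℂ}

theorem intervalIntegrable_rpow_mul (hp : 0 < p) (hh : ContinuousOn h (Icc 0 1)) {a b : ℝ}
    (ha : a ∈ Icc (0 : ℝ) 1) (hb : b ∈ Icc (0 : ℝ) 1) :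
    IntervalIntegrable (fun y => ((y ^ (p - 1) : ℝ) : ℂ) * h y) volume a b :=
  (intervalIntegrable_ofReal_rpow (by linarith) a b).mul_continuousOn
    (hh.mono (uIcc_subset_Icc ha hb))

theorem continuousOn_rpow_mul (r : ℝ) {S : Set ℝ} (hS : S ⊆ Ioi 0) (hh : ContinuousOn h S) :
    ContinuousOn (fun y => ((y ^ r : ℝ) : ℂ) * h y) S :=
  ((continuousOn_ofReal_rpow r).mono hS).mul hh

theorem tendsto_nhdsGT_of_continuousOn {E : Type*} [TopologicalSpace E] {f : ℝ → E}
    (hf : ContinuousOn f (Icc 0 1)) : Tendsto f (𝓝[>] 0) (𝓝 (f 0)) :=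
  (hf 0 (by simp)).tendsto.mono_left (nhdsWithin_le_of_mem
    (mem_of_superset (Ioc_mem_nhdsGT one_pos) Ioc_subset_Icc_self))

theorem tendsto_rpow_nhdsGT {r : ℝ} (hr : 0 < r) :
    Tendsto (fun x : ℝ => x ^ r) (𝓝[>] 0) (𝓝 0) := by
  have := (Real.continuous_rpow_const hr.le).tendsto 0
  rw [Real.zero_rpow hr.ne'] at this
  exact this.mono_left nhdsWithin_le_nhds

theorem tendsto_rpow_neg_nhdsGT {r : ℝ} (hr : r < 0) :
    Tendsto (fun x : ℝ => x ^ r) (𝓝[>] 0) atTop := by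
  have h1 : Tendsto (fun x : ℝ => x ^ (-r)) (𝓝[>] 0) (𝓝[>] 0) := by
    refine tendsto_nhdsWithin_iff.2 ⟨tendsto_rpow_nhdsGT (by linarith), ?_⟩
    filter_upwards [self_mem_nhdsWithin] with x hx using Real.rpow_pos_of_pos hx _
  refine h1.inv_tendsto_nhdsGT_zero.congr' ?_
  filter_upwards [self_mem_nhdsWithin] with x hx
  simp [Real.rpow_neg (le_of_lt hx)]

/-- l'Hôpital for primitives vanishing at `0`, compared with a power. -/
theorem tendsto_rpow_mul_integral (hp : 0 < p) {k : ℝ → ℂ} {b : ℝ} (hb : b ∈ Ioc (0 : ℝ) 1)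
    (hk : IntervalIntegrable k volume 0 b) (hkc : ContinuousOn k (Ioo 0 1)) {L : ℂ}
    (hL : Tendsto (fun x => ((x ^ (1 - p) : ℝ) : ℂ) * k x) (𝓝[>] 0) (𝓝 L)) :
    Tendsto (fun x => ((x ^ (-p) : ℝ) : ℂ) * ∫ y in (0 : ℝ)..x, k y) (𝓝[>] 0) (𝓝 (L / p)) := by
  have hc : ContinuousOn (fun x => ∫ y in (0 : ℝ)..x, k y) (Icc 0 b) := by
    have := intervalIntegral.continuousOn_primitive_interval (f := k)
      (μ := volume) (a := 0) (b := b)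
    rw [uIcc_of_le hb.1.le] at this
    exact this (by rw [integrableOn_Icc_iff_integrableOn_Ioc,
      ← intervalIntegrable_iff_integrableOn_Ioc_of_le hb.1.le]; exact hk)
  have hc0 : Tendsto (fun x => ∫ y in (0 : ℝ)..x, k y) (𝓝[>] 0) (𝓝 0) := by
    have := (hc 0 ⟨le_rfl, hb.1.le⟩).tendsto.mono_left (nhdsWithin_le_of_mem
      (mem_of_superset (Ioc_mem_nhdsGT hb.1) Ioc_subset_Icc_self))
    simpa using this
  have main := tendsto_div_of_deriv_zero (f := fun x => ∫ y in (0 : ℝ)..x, k y) (f' := k)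
    (g := fun x => x ^ p) (g' := fun x => p * x ^ (p - 1)) (L := L / p)
    (by
      filter_upwards [Ioo_mem_nhdsGT hb.1] with x hx
      refine hasDerivAt_integral_of_continuousOn hkc ⟨hx.1, hx.2.trans_le hb.2⟩
        (hk.mono_set (uIcc_subset_uIcc_left ?_))
      rw [uIcc_of_le hb.1.le]; exact ⟨hx.1.le, hx.2.le⟩)
    (by
      filter_upwards [self_mem_nhdsWithin] with x hx
      exact Real.hasDerivAt_rpow_const (Or.inl (ne_of_gt hx)))
    (by
      filter_upwards [self_mem_nhdsWithin] with x hx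
      exact mul_pos hp (Real.rpow_pos_of_pos hx _))
    hc0 (tendsto_rpow_nhdsGT hp)
    (by filter_upwards [self_mem_nhdsWithin] with x hx using Real.rpow_pos_of_pos hx _)
    (by
      refine (hL.div_const (p : ℂ)).congr' ?_
      filter_upwards [self_mem_nhdsWithin] with x hx
      have hx' : (0 : ℝ) < x := hx
      rw [show (1 - p) = -(p - 1) by ring, Real.rpow_neg hx'.le]
      push_cast
      have : ((x ^ (p - 1) : ℝ) : ℂ) ≠ 0 := by exact_mod_cast (Real.rpow_pos_of_pos hx' _).ne'
      field_simp)
  refine main.congr' ?_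
  filter_upwards [self_mem_nhdsWithin] with x hx
  rw [Real.rpow_neg (le_of_lt hx)]
  push_cast
  rw [div_eq_mul_inv, mul_comm]

theorem continuousOn_lowerMean (hp : 0 < p) (hh : ContinuousOn h (Icc 0 1)) :
    ContinuousOn (lowerMean p h) (Icc 0 1) := by
  have hi := intervalIntegrable_rpow_mul hp hh (a := 0) (b := 1) (by simp) (by simp)
  refine continuousOn_Icc_of_tendsto ?_ ?_
  · have h1 : ContinuousOn (fun x => ∫ y in (0 : ℝ)..x, ((y ^ (p - 1) : ℝ) : ℂ) * h y) (Icc 0 1) := by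
      have := intervalIntegral.continuousOn_primitive_interval (μ := volume) (a := 0) (b := 1)
        (f := fun y => ((y ^ (p - 1) : ℝ) : ℂ) * h y)
      rw [uIcc_of_le zero_le_one] at this
      exact this (by rw [integrableOn_Icc_iff_integrableOn_Ioc,
        ← intervalIntegrable_iff_integrableOn_Ioc_of_le zero_le_one]; exact hi)
    refine (continuousOn_rpow_mul (-p) (fun x hx => hx.1) (h1.mono Ioc_subset_Icc_self)).congr
      fun x hx => ?_
    rw [lowerMean, if_neg hx.1.ne']
  · have := tendsto_rpow_mul_integral hp (b := 1) (by simp) hi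
      (continuousOn_rpow_mul _ (fun x hx => hx.1) (hh.mono Ioo_subset_Icc_self))
      (L := h 0) ((tendsto_nhdsGT_of_continuousOn hh).congr' (by
        filter_upwards [self_mem_nhdsWithin] with x hx
        rw [← mul_assoc, ← Complex.ofReal_mul, ← Real.rpow_add hx]
        simp))
    rw [show lowerMean p h 0 = h 0 / p from if_pos rfl]
    refine this.congr' ?_
    filter_upwards [self_mem_nhdsWithin] with x hx
    rw [lowerMean, if_neg (ne_of_gt hx)]

theorem hasDerivAt_lowerMean (hp : 0 < p) (hh : ContinuousOn h (Icc 0 1)) {x : ℝ}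
    (hx : x ∈ Ioo (0 : ℝ) 1) :
    HasDerivAt (lowerMean p h) ((h x - p * lowerMean p h x) / x) x := by
  have h1 := hasDerivAt_integral_of_continuousOn
    (continuousOn_rpow_mul (p - 1) (fun x hx => hx.1) (hh.mono Ioo_subset_Icc_self)) hx
    (intervalIntegrable_rpow_mul hp hh (a := 0) (b := x) (by simp) ⟨hx.1.le, hx.2.le⟩)
  have h2 := (hasDerivAt_ofReal_rpow (-p) hx.1).mul h1
  have h3 : HasDerivAt (lowerMean p h) _ x := h2.congr_of_eventuallyEq (by
    filter_upwards [Ioi_mem_nhds hx.1] with y hy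
    rw [lowerMean, if_neg (ne_of_gt hy)]
    rfl)
  convert h3 using 1
  rw [lowerMean, if_neg hx.1.ne', ← mul_assoc ((x ^ (-p) : ℝ) : ℂ), ← Complex.ofReal_mul,
    ← Real.rpow_add hx.1, show -p + (p - 1) = -1 by ring, Real.rpow_neg_one,
    Real.rpow_sub_one hx.1.ne']
  have : (x : ℂ) ≠ 0 := by exact_mod_cast hx.1.ne'
  push_cast
  field_simp
  ring

/-- The derivative is p x^{-p-1} ∫₀ˣ y^{p-1}(h(x) - h(y)) dy. With the majorant N of
`exists_majorant` it is bounded by the same expression for N, the derivative of the mean of N, and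
that mean is continuous on [0,1]. -/
theorem memW11_lowerMean (hp : 0 < p) (hh : MemW11 h) : MemW11 (lowerMean p h) := by
  obtain ⟨N, hN, hNh⟩ := hh.exists_majorant
  have hNc : ContinuousOn (fun x => (N x : ℂ)) (Icc 0 1) :=
    Complex.continuous_ofReal.comp_continuousOn hN
  set M := lowerMean p fun x => (N x : ℂ) with hM
  refine MemW11.of_norm_deriv_le (m := fun x => (M x).re)
    (m' := fun x => (((N x : ℂ) - p * M x) / x).re) (continuousOn_lowerMean hp hh.continuousOn)
    (fun x hx => hasDerivAt_lowerMean hp hh.continuousOn hx)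
    (Complex.continuous_re.comp_continuousOn (continuousOn_lowerMean hp hNc))
    (fun x hx => Complex.reCLM.hasFDerivAt.comp_hasDerivAt x (hasDerivAt_lowerMean hp hNc hx))
    fun x hx => ?_
  have hxI : x ∈ Icc (0 : ℝ) 1 := ⟨hx.1.le, hx.2.le⟩
  -- Because p x^{-p} ∫₀ˣ y^{p-1} dy = 1, the value k(x) can be moved under the integral.
  have key : ∀ k : ℝ → ℂ, ContinuousOn k (Icc 0 1) → k x - p * lowerMean p k x =
      ((p * x ^ (-p) : ℝ) : ℂ) * ∫ y in (0 : ℝ)..x, ((y ^ (p - 1) : ℝ) : ℂ) * (k x - k y) := by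
    intro k hk
    have e : ∀ y, ((y ^ (p - 1) : ℝ) : ℂ) * (k x - k y) =
      ((y ^ (p - 1) : ℝ) : ℂ) * k x - ((y ^ (p - 1) : ℝ) : ℂ) * k y := fun y => mul_sub _ _ _
    simp_rw [e]
    rw [intervalIntegral.integral_sub
      ((intervalIntegrable_ofReal_rpow (by linarith) 0 x).mul_const _)
      (intervalIntegrable_rpow_mul hp hk (by simp) hxI), intervalIntegral.integral_mul_const,
      intervalIntegral.integral_ofReal, integral_rpow (Or.inl (by linarith)), lowerMean,
      if_neg hx.1.ne', sub_add_cancel, Real.zero_rpow hp.ne', Real.rpow_neg hx.1.le]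
    have h1 : ((x ^ p : ℝ) : ℂ) ≠ 0 := by exact_mod_cast (Real.rpow_pos_of_pos hx.1 _).ne'
    have h2 : (p : ℂ) ≠ 0 := by exact_mod_cast hp.ne'
    push_cast
    field_simp
    ring
  rw [hM, key h hh.continuousOn, key _ hNc]
  have e2 : ∀ y, ((y ^ (p - 1) : ℝ) : ℂ) * ((N x : ℂ) - N y) = ((y ^ (p - 1) * (N x - N y) : ℝ) : ℂ) :=
    fun y => by push_cast; ring
  simp_rw [e2]
  rw [intervalIntegral.integral_ofReal, ← Complex.ofReal_mul, ← Complex.ofReal_div,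
    Complex.ofReal_re, norm_div, norm_mul, Complex.norm_real, Complex.norm_real, Real.norm_eq_abs,
    Real.norm_eq_abs, abs_of_pos hx.1,
    abs_of_nonneg (mul_nonneg hp.le (Real.rpow_nonneg hx.1.le _))]
  refine div_le_div_of_nonneg_right (mul_le_mul_of_nonneg_left ?_
    (mul_nonneg hp.le (Real.rpow_nonneg hx.1.le _))) hx.1.le
  refine intervalIntegral.norm_integral_le_of_norm_le hx.1.le ?_ ?_
  · refine Eventually.of_forall fun y hy => ?_
    rw [norm_mul, Complex.norm_real, Real.norm_eq_abs, abs_of_nonneg (Real.rpow_nonneg hy.1.le _)]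
    exact mul_le_mul_of_nonneg_left (hNh y ⟨hy.1.le, hy.2.trans hx.2.le⟩ x hxI hy.2)
      (Real.rpow_nonneg hy.1.le _)
  · refine (intervalIntegral.intervalIntegrable_rpow' (by linarith)).mul_continuousOn
      (continuousOn_const.sub (hN.mono (uIcc_subset_Icc (by simp) hxI)))

theorem intervalIntegrable_rpow_mul_of_pos (r : ℝ) (hh : ContinuousOn h (Icc 0 1)) {a b : ℝ}
    (ha : a ∈ Ioc (0 : ℝ) 1) (hb : b ∈ Ioc (0 : ℝ) 1) :
    IntervalIntegrable (fun y => ((y ^ r : ℝ) : ℂ) * h y) volume a b :=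
  have hs : uIcc a b ⊆ Ioc 0 1 := ordConnected_Ioc.uIcc_subset ha hb
  (continuousOn_rpow_mul r (fun _ hx => (hs hx).1)
    (hh.mono (hs.trans Ioc_subset_Icc_self))).intervalIntegrable

variable {s : ℝ}

theorem hasDerivAt_integral_rpow_mul (r : ℝ) (hh : ContinuousOn h (Icc 0 1)) {x : ℝ}
    (hx : x ∈ Ioo (0 : ℝ) 1) :
    HasDerivAt (fun y => ∫ t in y..1, ((t ^ r : ℝ) : ℂ) * h t) (-(((x ^ r : ℝ) : ℂ) * h x)) x :=
  hasDerivAt_integral_left_of_continuousOn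
    (continuousOn_rpow_mul r (fun x hx => hx.1) (hh.mono Ioo_subset_Icc_self)) hx
    (intervalIntegrable_rpow_mul_of_pos r hh ⟨hx.1, hx.2.le⟩ (by simp))

theorem continuousOn_integral_rpow_mul (r : ℝ) (hh : ContinuousOn h (Icc 0 1)) :
    ContinuousOn (fun y => ∫ t in y..1, ((t ^ r : ℝ) : ℂ) * h t) (Ioc 0 1) := by
  intro x hx
  have hx2 : x / 2 ∈ Ioc (0 : ℝ) 1 := ⟨half_pos hx.1, by linarith [hx.1, hx.2]⟩
  have hle : x / 2 ≤ 1 := hx2.2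
  have h1 := intervalIntegral.continuousOn_primitive_interval_left (μ := volume) (a := x / 2)
    (b := 1) (f := fun y => ((y ^ r : ℝ) : ℂ) * h y)
  rw [uIcc_of_le hle] at h1
  have h2 := h1 (by
    rw [integrableOn_Icc_iff_integrableOn_Ioc,
      ← intervalIntegrable_iff_integrableOn_Ioc_of_le hle]
    exact intervalIntegrable_rpow_mul_of_pos r hh hx2 (by simp))
  refine (h2 x ⟨by linarith [hx.1], hx.2⟩).mono_of_mem_nhdsWithin ?_
  filter_upwards [mem_nhdsWithin_of_mem_nhds (Ioi_mem_nhds (show x / 2 < x by linarith [hx.1])),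
    self_mem_nhdsWithin] with y hy hy2 using ⟨le_of_lt hy, hy2.2⟩

theorem continuousOn_upperMean (hs : 0 < s) (hh : ContinuousOn h (Icc 0 1)) :
    ContinuousOn (upperMean s h) (Icc 0 1) := by
  refine continuousOn_Icc_of_tendsto ?_ ?_
  · refine (continuousOn_rpow_mul s (fun x hx => hx.1)
      (continuousOn_integral_rpow_mul (-s - 1) hh)).congr fun x hx => ?_
    rw [upperMean, if_neg hx.1.ne']
  · have := tendsto_div_of_deriv_atTop (L := h 0 / s)
      (f := fun x => ∫ y in x..1, ((y ^ (-s - 1) : ℝ) : ℂ) * h y)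
      (f' := fun x => -(((x ^ (-s - 1) : ℝ) : ℂ) * h x))
      (g := fun x => x ^ (-s)) (g' := fun x => -s * x ^ (-s - 1))
      (by filter_upwards [Ioo_mem_nhdsGT one_pos] with x hx using
        hasDerivAt_integral_rpow_mul _ hh hx)
      (by filter_upwards [self_mem_nhdsWithin] with x hx using
        Real.hasDerivAt_rpow_const (Or.inl (ne_of_gt hx)))
      (by
        filter_upwards [self_mem_nhdsWithin] with x hx
        exact mul_neg_of_neg_of_pos (by linarith) (Real.rpow_pos_of_pos hx _))
      (tendsto_rpow_neg_nhdsGT (by linarith))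
      (by
        refine ((tendsto_nhdsGT_of_continuousOn hh).div_const (s : ℂ)).congr' ?_
        filter_upwards [self_mem_nhdsWithin] with x hx
        have h1 : ((x ^ (-s - 1) : ℝ) : ℂ) ≠ 0 := by
          exact_mod_cast (Real.rpow_pos_of_pos hx _).ne'
        have h2 : (s : ℂ) ≠ 0 := by exact_mod_cast hs.ne'
        push_cast
        field_simp)
    rw [show upperMean s h 0 = h 0 / s from if_pos rfl]
    refine this.congr' ?_
    filter_upwards [self_mem_nhdsWithin] with x hx
    rw [upperMean, if_neg (ne_of_gt hx), Real.rpow_neg (le_of_lt hx)]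
    push_cast
    rw [div_inv_eq_mul, mul_comm]

theorem hasDerivAt_upperMean (hh : ContinuousOn h (Icc 0 1)) {x : ℝ}
    (hx : x ∈ Ioo (0 : ℝ) 1) :
    HasDerivAt (upperMean s h) ((s * upperMean s h x - h x) / x) x := by
  have h2 := (hasDerivAt_ofReal_rpow s hx.1).mul (hasDerivAt_integral_rpow_mul (-s - 1) hh hx)
  have h3 : HasDerivAt (upperMean s h) _ x := h2.congr_of_eventuallyEq (by
    filter_upwards [Ioi_mem_nhds hx.1] with y hy
    rw [upperMean, if_neg (ne_of_gt hy)]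
    rfl)
  convert h3 using 1
  rw [upperMean, if_neg hx.1.ne', mul_neg, ← mul_assoc ((x ^ s : ℝ) : ℂ) ((x ^ (-s - 1) : ℝ) : ℂ),
    ← Complex.ofReal_mul, ← Real.rpow_add hx.1, show s + (-s - 1) = -1 by ring,
    Real.rpow_neg_one, Real.rpow_sub_one hx.1.ne']
  have : (x : ℂ) ≠ 0 := by exact_mod_cast hx.1.ne'
  push_cast
  field_simp
  ring

/-- The comparison of `memW11_lowerMean`, except that s x^s ∫ₓ¹ y^{-s-1} dy = 1 - x^s: the endpoint
1 leaves an extra term x^s h(x), and likewise for N. Both are absorbed by adding (C/s) x^s to the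
majorant. -/
theorem memW11_upperMean (hs : 0 < s) (hh : MemW11 h) : MemW11 (upperMean s h) := by
  obtain ⟨N, hN, hNh⟩ := hh.exists_majorant
  have hNc : ContinuousOn (fun x => (N x : ℂ)) (Icc 0 1) :=
    Complex.continuous_ofReal.comp_continuousOn hN
  obtain ⟨A, hA⟩ := isCompact_Icc.exists_bound_of_continuousOn hh.continuousOn
  obtain ⟨A', hA'⟩ := isCompact_Icc.exists_bound_of_continuousOn hN
  -- `A` pays for the endpoint term of `h`, `A'` for that of `N`.
  set C := A + A' with hC
  set M := upperMean s fun x => (N x : ℂ) with hM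
  refine MemW11.of_norm_deriv_le (m := fun x => (M x).re + C / s * x ^ s)
    (m' := fun x => ((s * M x - (N x : ℂ)) / x).re + C / s * (s * x ^ (s - 1)))
    (continuousOn_upperMean hs hh.continuousOn)
    (fun x hx => hasDerivAt_upperMean hh.continuousOn hx)
    ((Complex.continuous_re.comp_continuousOn (continuousOn_upperMean hs hNc)).add
      (continuousOn_const.mul (Real.continuous_rpow_const hs.le).continuousOn))
    (fun x hx => (Complex.reCLM.hasFDerivAt.comp_hasDerivAt x (hasDerivAt_upperMean hNc hx)).add
      ((Real.hasDerivAt_rpow_const (Or.inl hx.1.ne')).const_mul _))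
    fun x hx => ?_
  have hxI : x ∈ Icc (0 : ℝ) 1 := ⟨hx.1.le, hx.2.le⟩
  have hxI' : x ∈ Ioc (0 : ℝ) 1 := ⟨hx.1, hx.2.le⟩
  have hxs : 0 < x ^ s := Real.rpow_pos_of_pos hx.1 s
  have key : ∀ k : ℝ → ℂ, ContinuousOn k (Icc 0 1) → s * upperMean s k x - k x =
      ((s * x ^ s : ℝ) : ℂ) * (∫ y in x..1, ((y ^ (-s - 1) : ℝ) : ℂ) * (k y - k x)) -
        ((x ^ s : ℝ) : ℂ) * k x := by
    intro k hk
    have e : ∀ y, ((y ^ (-s - 1) : ℝ) : ℂ) * (k y - k x) =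
      ((y ^ (-s - 1) : ℝ) : ℂ) * k y - ((y ^ (-s - 1) : ℝ) : ℂ) * k x := fun y => mul_sub _ _ _
    simp_rw [e]
    have hx0 : (0 : ℝ) ∉ uIcc x 1 := by
      rw [uIcc_of_le hx.2.le]; exact fun h => absurd h.1 (not_le.2 hx.1)
    rw [intervalIntegral.integral_sub
      (intervalIntegrable_rpow_mul_of_pos _ hk hxI' (by simp))
      (intervalIntegrable_rpow_mul_of_pos _ continuousOn_const hxI' (by simp)),
      intervalIntegral.integral_mul_const,
      intervalIntegral.integral_ofReal, integral_rpow (Or.inr ⟨by linarith, hx0⟩), upperMean,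
      if_neg hx.1.ne', sub_add_cancel, Real.one_rpow, Real.rpow_neg hx.1.le]
    have h1 : ((x ^ s : ℝ) : ℂ) ≠ 0 := by exact_mod_cast hxs.ne'
    have h2 : (s : ℂ) ≠ 0 := by exact_mod_cast hs.ne'
    push_cast
    field_simp
    ring
  rw [hM, key h hh.continuousOn, key _ hNc]
  have e2 : ∀ y, ((y ^ (-s - 1) : ℝ) : ℂ) * ((N y : ℂ) - N x) =
    ((y ^ (-s - 1) * (N y - N x) : ℝ) : ℂ) := fun y => by push_cast; ring
  simp_rw [e2]
  rw [intervalIntegral.integral_ofReal, ← Complex.ofReal_mul, ← Complex.ofReal_mul,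
    ← Complex.ofReal_sub, ← Complex.ofReal_div, Complex.ofReal_re, norm_div, Complex.norm_real,
    Real.norm_eq_abs, abs_of_pos hx.1, Real.rpow_sub_one hx.1.ne']
  have e3 : C / s * (s * (x ^ s / x)) = C * x ^ s / x := by field_simp
  rw [e3, ← add_div]
  refine div_le_div_of_nonneg_right ?_ hx.1.le
  have hI : ‖∫ y in x..1, ((y ^ (-s - 1) : ℝ) : ℂ) * (h y - h x)‖ ≤
      ∫ y in x..1, y ^ (-s - 1) * (N y - N x) := by
    refine intervalIntegral.norm_integral_le_of_norm_le hx.2.le ?_ ?_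
    · refine Eventually.of_forall fun y hy => ?_
      have hy0 : 0 ≤ y := hx.1.le.trans hy.1.le
      rw [norm_mul, Complex.norm_real, Real.norm_eq_abs, abs_of_nonneg (Real.rpow_nonneg hy0 _)]
      exact mul_le_mul_of_nonneg_left (hNh x hxI y ⟨hy0, hy.2⟩ hy.1.le) (Real.rpow_nonneg hy0 _)
    · have hs' : uIcc x 1 ⊆ Ioc 0 1 := ordConnected_Ioc.uIcc_subset hxI' (by simp)
      exact ((continuousOn_id.rpow_const fun y hy => Or.inl (hs' hy).1.ne').mul
        ((hN.mono (hs'.trans Ioc_subset_Icc_self)).sub continuousOn_const)).intervalIntegrable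
  have h1 := hA x hxI
  have h2 : N x ≤ A' := (le_abs_self _).trans (hA' x hxI)
  have hsx : 0 ≤ s * x ^ s := mul_nonneg hs.le hxs.le
  refine (norm_sub_le _ _).trans ?_
  rw [norm_mul, norm_mul, Complex.norm_real, Complex.norm_real, Real.norm_eq_abs, Real.norm_eq_abs,
    abs_of_nonneg hsx, abs_of_pos hxs]
  have h3 := mul_le_mul_of_nonneg_left hI hsx
  have h4 := mul_le_mul_of_nonneg_left h1 hxs.le
  have h5 := mul_le_mul_of_nonneg_left h2 hxs.le
  rw [hC]
  linarith

end Means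

/-! ### Solutions and their Wronskians -/

theorem intervalIntegrable_potential (l : ℝ) {q : ℝ → ℝ}
    (hq : IntegrableOn (fun x => x * q x) (Ioo 0 1)) (z : ℂ) {a b : ℝ} (ha : a ∈ Ioo (0 : ℝ) 1)
    (hb : b ∈ Ioo (0 : ℝ) 1) :
    IntervalIntegrable (fun x => ((l * (l + 1) / x ^ 2 + q x : ℝ) : ℂ) - z) volume a b := by
  have hs : uIcc a b ⊆ Ioo 0 1 := ordConnected_Ioo.uIcc_subset ha hb
  have h0 : ∀ x ∈ uIcc a b, x ≠ 0 := fun x hx => (hs hx).1.ne'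
  have h1 : IntervalIntegrable (fun x => x * q x) volume a b :=
    intervalIntegrable_iff.2 (hq.mono_set (uIoc_subset_uIcc.trans hs))
  have h2 : IntervalIntegrable q volume a b := by
    refine (h1.continuousOn_mul (g := fun x => x⁻¹) (continuousOn_id.inv₀ h0)).congr fun x hx => ?_
    field_simp [h0 x (uIoc_subset_uIcc hx)]
  have h3 : IntervalIntegrable (fun x => l * (l + 1) / x ^ 2 + q x) volume a b :=
    (ContinuousOn.intervalIntegrable (continuousOn_const.div (by fun_prop)
      fun x hx => pow_ne_zero 2 (h0 x hx))).add h2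
  exact (show IntervalIntegrable (fun x => ((l * (l + 1) / x ^ 2 + q x : ℝ) : ℂ)) volume a b from
    ⟨h3.1.ofReal, h3.2.ofReal⟩).sub intervalIntegrable_const

namespace IsSolution

variable {l : ℝ} {q : ℝ → ℝ} {z ζ : ℂ} {u v : ℝ → ℂ}

theorem continuousOn (hu : IsSolution l q z u) : ContinuousOn u (Ioo 0 1) :=
  fun x hx => (hu.1 x hx).continuousAt.continuousWithinAt

theorem intervalIntegrable (hu : IsSolution l q z u)
    (hq : IntegrableOn (fun x => x * q x) (Ioo 0 1)) {a b : ℝ} (ha : a ∈ Ioo (0 : ℝ) 1)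
    (hb : b ∈ Ioo (0 : ℝ) 1) :
    IntervalIntegrable (fun x => (((l * (l + 1) / x ^ 2 + q x : ℝ) : ℂ) - z) * u x) volume a b :=
  (intervalIntegrable_potential l hq z ha hb).mul_continuousOn
    (hu.continuousOn.mono (ordConnected_Ioo.uIcc_subset ha hb))

theorem continuousOn_deriv (hu : IsSolution l q z u)
    (hq : IntegrableOn (fun x => x * q x) (Ioo 0 1)) {a b : ℝ} (ha : a ∈ Ioo (0 : ℝ) 1)
    (hb : b ∈ Ioo (0 : ℝ) 1) : ContinuousOn (deriv u) (uIcc a b) := by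
  have hs : uIcc a b ⊆ Ioo 0 1 := ordConnected_Ioo.uIcc_subset ha hb
  have h1 := intervalIntegral.continuousOn_primitive_interval' (hu.intervalIntegrable hq ha hb)
    (left_mem_uIcc)
  refine (h1.const_add (deriv u a)).congr fun x hx => ?_
  have := hu.2 a ha x (hs hx)
  simp only
  rw [← this]
  ring

/-- In u v'' - u'' v the potential cancels and (z - ζ) u v remains. As the second derivatives exist
only in integrated form, the product rule `mul_sub_mul_eq_integral` is used. -/
theorem wronskian_sub (hu : IsSolution l q z u) (hv : IsSolution l q ζ v)
    (hq : IntegrableOn (fun x => x * q x) (Ioo 0 1)) {a b : ℝ} (ha : a ∈ Ioo (0 : ℝ) 1)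
    (hb : b ∈ Ioo (0 : ℝ) 1) :
    wronskian u v b - wronskian u v a = (z - ζ) * ∫ x in a..b, u x * v x := by
  have hs : uIcc a b ⊆ Ioo 0 1 := ordConnected_Ioo.uIcc_subset ha hb
  have F0 : ∀ {ζ : ℂ} {v : ℝ → ℂ}, IsSolution l q ζ v →
      ∀ x ∈ uIcc a b, v x = v a + ∫ t in a..x, deriv v t := by
    intro ζ v hv x hx
    have hsx : uIcc a x ⊆ uIcc a b := uIcc_subset_uIcc_left hx
    rw [intervalIntegral.integral_eq_sub_of_hasDerivAt
      (fun y hy => (hv.1 y (hs (hsx hy))).hasDerivAt)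
      (hv.continuousOn_deriv hq ha (hs hx)).intervalIntegrable]
    ring
  have F1 : ∀ {ζ : ℂ} {v : ℝ → ℂ}, IsSolution l q ζ v → ∀ x ∈ uIcc a b, deriv v x =
      deriv v a + ∫ t in a..x, (((l * (l + 1) / t ^ 2 + q t : ℝ) : ℂ) - ζ) * v t := by
    intro ζ v hv x hx
    rw [← hv.2 a ha x (hs hx)]
    ring
  have iu := (hu.continuousOn_deriv hq ha hb).intervalIntegrable (μ := volume)
  have iv := (hv.continuousOn_deriv hq ha hb).intervalIntegrable (μ := volume)
  have cu : ContinuousOn u (uIcc a b) := hu.continuousOn.mono hs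
  have cv : ContinuousOn v (uIcc a b) := hv.continuousOn.mono hs
  have e1 := mul_sub_mul_eq_integral iu (hv.intervalIntegrable hq ha hb) (F0 hu) (F1 hv)
  have e2 := mul_sub_mul_eq_integral (hu.intervalIntegrable hq ha hb) iv (F1 hu) (F0 hv)
  rw [show wronskian u v b - wronskian u v a = (u b * deriv v b - u a * deriv v a) -
    (deriv u b * v b - deriv u a * v a) by simp only [wronskian]; ring, e1, e2,
    ← intervalIntegral.integral_sub, ← intervalIntegral.integral_const_mul]
  · refine intervalIntegral.integral_congr fun x _ => ?_
    ring
  · exact (iu.mul_continuousOn (hv.continuousOn_deriv hq ha hb)).add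
      ((hv.intervalIntegrable hq ha hb).continuousOn_mul cu)
  · exact ((hu.intervalIntegrable hq ha hb).mul_continuousOn cv).add
      (iv.continuousOn_mul (hu.continuousOn_deriv hq ha hb))

theorem sub_const_mul (hu : IsSolution l q z u) (hv : IsSolution l q z v)
    (hq : IntegrableOn (fun x => x * q x) (Ioo 0 1)) (c : ℂ) :
    IsSolution l q z fun x => u x - c * v x := by
  refine ⟨fun x hx => (hu.1 x hx).sub ((hv.1 x hx).const_mul c), fun a ha b hb => ?_⟩
  have hd : ∀ x ∈ Ioo (0 : ℝ) 1, deriv (fun x => u x - c * v x) x = deriv u x - c * deriv v x :=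
    fun x hx => ((hu.1 x hx).hasDerivAt.sub ((hv.1 x hx).hasDerivAt.const_mul c)).deriv
  rw [hd a ha, hd b hb, show deriv u b - c * deriv v b - (deriv u a - c * deriv v a) =
    (deriv u b - deriv u a) - c * (deriv v b - deriv v a) by ring, hu.2 a ha b hb, hv.2 a ha b hb,
    ← intervalIntegral.integral_const_mul, ← intervalIntegral.integral_sub
      (hu.intervalIntegrable hq ha hb) ((hv.intervalIntegrable hq ha hb).const_mul c)]
  refine intervalIntegral.integral_congr fun x _ => ?_
  simp only
  ring

end IsSolution

/-- The limit of the Wronskian with a function `~ x^{l+1}` determines the leading coefficient. -/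
theorem wronskian_limit_eq {l : ℝ} (hl : -(1 / 2) < l) {u v vt : ℝ → ℂ} {w c : ℂ}
    (hu : ∀ x ∈ Ioo (0 : ℝ) 1, DifferentiableAt ℝ u x)
    (hv : ∀ x ∈ Ioo (0 : ℝ) 1, DifferentiableAt ℝ v x)
    (hvt : Tendsto vt (𝓝[>] 0) (𝓝 1))
    (hvv : ∀ x ∈ Ioo (0 : ℝ) 1, v x = ((x ^ (l + 1) : ℝ) : ℂ) * vt x)
    (hw : Tendsto (wronskian u v) (𝓝[>] 0) (𝓝 w))
    (hc : Tendsto (fun x : ℝ => ((x ^ l : ℝ) : ℂ) * u x) (𝓝[>] 0) (𝓝 c)) :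
    w = (2 * l + 1) * c := by
  have h2l : (0 : ℝ) < 2 * l + 1 := by linarith
  have h2l' : (2 * l + 1 : ℂ) ≠ 0 := by exact_mod_cast h2l.ne'
  have hne := hvt.eventually_ne one_ne_zero
  have hI : ∀ᶠ x in 𝓝[>] (0 : ℝ), x ∈ Ioo (0 : ℝ) 1 := Ioo_mem_nhdsGT one_pos
  have hvne : ∀ᶠ x in 𝓝[>] (0 : ℝ), v x ≠ 0 := by
    filter_upwards [hne, hI] with x h1 hx
    rw [hvv x hx]
    exact mul_ne_zero (by exact_mod_cast (Real.rpow_pos_of_pos hx.1 _).ne') h1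
  -- Nothing is known about u' and v' separately near 0. However (u/v)' = -W(u,v)/v², so L'Hôpital's
  -- rule compares u/v with x^{-(2l+1)}.
  have main := tendsto_div_of_deriv_atTop (f := fun x => u x / v x)
    (f' := fun x => (deriv u x * v x - u x * deriv v x) / v x ^ 2)
    (g := fun x => x ^ (-(2 * l + 1))) (g' := fun x => -(2 * l + 1) * x ^ (-(2 * l + 1) - 1))
    (L := w / (2 * l + 1))
    (by filter_upwards [hvne, hI] with x h1 hx using
      (hu x hx).hasDerivAt.div (hv x hx).hasDerivAt h1)
    (by filter_upwards [hI] with x hx using Real.hasDerivAt_rpow_const (Or.inl hx.1.ne'))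
    (by
      filter_upwards [hI] with x hx
      exact mul_neg_of_neg_of_pos (by linarith) (Real.rpow_pos_of_pos hx.1 _))
    (tendsto_rpow_neg_nhdsGT (by linarith))
    (by
      have := (hw.div (hvt.pow 2) (by simp)).div_const (2 * l + 1 : ℂ)
      simp only [one_pow, div_one] at this
      refine this.congr' ?_
      filter_upwards [hI, hne] with x hx h1
      have e1 : x ^ (-(2 * l + 1) - 1) = (x ^ (l + 1))⁻¹ ^ 2 := by
        rw [← Real.rpow_neg hx.1.le, ← Real.rpow_natCast, ← Real.rpow_mul hx.1.le]
        congr 1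
        push_cast
        ring
      have e2 : ((x ^ (l + 1) : ℝ) : ℂ) ≠ 0 := by exact_mod_cast (Real.rpow_pos_of_pos hx.1 _).ne'
      simp only [wronskian, Pi.div_apply]
      rw [hvv x hx, e1]
      push_cast
      field_simp
      ring)
  have main2 : Tendsto (fun x => u x / v x / ((x ^ (-(2 * l + 1)) : ℝ) : ℂ)) (𝓝[>] 0) (𝓝 c) := by
    have := hc.div hvt one_ne_zero
    rw [div_one] at this
    refine this.congr' ?_
    filter_upwards [hI, hne] with x hx h1
    have e1 : x ^ (-(2 * l + 1)) = (x ^ l * x ^ (l + 1))⁻¹ := by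
      rw [← Real.rpow_add hx.1, ← Real.rpow_neg hx.1.le]
      congr 1
      ring
    have e2 : ((x ^ (l + 1) : ℝ) : ℂ) ≠ 0 := by exact_mod_cast (Real.rpow_pos_of_pos hx.1 _).ne'
    have e3 : ((x ^ l : ℝ) : ℂ) ≠ 0 := by exact_mod_cast (Real.rpow_pos_of_pos hx.1 _).ne'
    simp only [Pi.div_apply]
    rw [hvv x hx, e1]
    push_cast
    field_simp
  have := tendsto_nhds_unique main main2
  rw [← this]
  field_simp

/-! ### Pairs of solutions in factored form -/

/-- The factored form of an entire system of solutions, together with the identities for the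
Wronskians. -/
structure SolutionPair (l : ℝ) (φ θ φt θt : ℂ → ℝ → ℂ) : Prop where
  hl : -(1 / 2) < l
  phi_eq : ∀ z, ∀ x ∈ Ioo (0 : ℝ) 1, φ z x = ((x ^ (l + 1) : ℝ) : ℂ) * φt z x
  theta_eq : ∀ z, ∀ x ∈ Ioo (0 : ℝ) 1, θ z x = ((x ^ (-l) / (2 * l + 1) : ℝ) : ℂ) * θt z x
  phit_zero : ∀ z, φt z 0 = 1
  thetat_zero : ∀ z, θt z 0 = 1
  phit_mem : ∀ z, MemW11 (φt z)
  thetat_mem : ∀ z, MemW11 (θt z)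
  phit_fam : EntireFamily (Ico 0 1) φt
  thetat_fam : EntireFamily (Ico 0 1) θt
  phi_diff : ∀ z, ∀ x ∈ Ioo (0 : ℝ) 1, DifferentiableAt ℝ (φ z) x
  theta_diff : ∀ z, ∀ x ∈ Ioo (0 : ℝ) 1, DifferentiableAt ℝ (θ z) x
  wronskian_phi : ∀ w z, ∀ a ∈ Ioo (0 : ℝ) 1, ∀ b ∈ Ioo (0 : ℝ) 1,
    wronskian (θ w) (φ z) b - wronskian (θ w) (φ z) a = (w - z) * ∫ y in a..b, θ w y * φ z y
  wronskian_theta : ∀ w z, ∀ a ∈ Ioo (0 : ℝ) 1, ∀ b ∈ Ioo (0 : ℝ) 1,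
    wronskian (θ w) (θ z) b - wronskian (θ w) (θ z) a = (w - z) * ∫ y in a..b, θ w y * θ z y

/-- At x = 0 the factor is constant in z, hence entire. At x = 1 analyticity is not among the
hypotheses, which is why the interval is [0,1). -/
theorem EntireFamily.of_factor {u ut : ℂ → ℝ → ℂ} {r : ℝ → ℝ}
    (hr : ∀ x ∈ Ioo (0 : ℝ) 1, r x ≠ 0) (hu : ∀ x ∈ Ioo (0 : ℝ) 1, Differentiable ℂ fun z => u z x)
    (h : ∀ z, ∀ x ∈ Ioo (0 : ℝ) 1, u z x = (r x : ℂ) * ut z x) (h0 : ∀ z, ut z 0 = 1)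
    (hc : ContinuousOn (fun p : ℂ × ℝ => ut p.1 p.2) (univ ×ˢ Icc (0 : ℝ) 1)) :
    EntireFamily (Ico 0 1) ut := by
  refine ⟨hc.mono (prod_mono_right Ico_subset_Icc_self), fun x hx => ?_⟩
  rcases hx.1.eq_or_lt with rfl | hpos
  · simp only [h0]
    exact differentiable_const _
  · have hx' : x ∈ Ioo (0 : ℝ) 1 := ⟨hpos, hx.2⟩
    have e : (fun z => ut z x) = fun z => (r x : ℂ)⁻¹ * u z x := by
      ext z
      have : (r x : ℂ) ≠ 0 := by exact_mod_cast hr x hx'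
      rw [h z x hx']
      field_simp
    rw [e]
    exact (hu x hx').const_mul _

theorem IsEntireSystem.exists_solutionPair {l : ℝ} (hl : -(1 / 2) < l) {q : ℝ → ℝ}
    (hq : IntegrableOn (fun x => x * q x) (Ioo 0 1)) {φ θ : ℂ → ℝ → ℂ}
    (h : IsEntireSystem l q φ θ) : ∃ φt θt, SolutionPair l φ θ φt θt := by
  obtain ⟨φt, p1, p2, p3, p4⟩ := h.phi_form
  obtain ⟨θt, t1, t2, t3, t4⟩ := h.theta_form
  exact ⟨φt, θt, hl, p1, t1, p2, t2, p3, t3,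
    .of_factor (fun x hx => (Real.rpow_pos_of_pos hx.1 _).ne') h.phi_entire p1 p2 p4,
    .of_factor (fun x hx => (div_pos (Real.rpow_pos_of_pos hx.1 _) (by linarith)).ne')
      h.theta_entire t1 t2 t4,
    fun z => (h.phi_sol z).1, fun z => (h.theta_sol z).1,
    fun w z a ha b hb => (h.theta_sol w).wronskian_sub (h.phi_sol z) hq ha hb,
    fun w z a ha b hb => (h.theta_sol w).wronskian_sub (h.theta_sol z) hq ha hb⟩

namespace SolutionPair

variable {l : ℝ} {φ θ φt θt : ℂ → ℝ → ℂ} (P : SolutionPair l φ θ φt θt)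
include P

theorem two_l_pos : 0 < 2 * l + 1 := by linarith [P.hl]

theorem two_l_ne : (2 * l + 1 : ℂ) ≠ 0 := by exact_mod_cast P.two_l_pos.ne'

theorem phi_fam : EntireFamily (Ioo 0 1) φ := by
  have h := P.phit_fam.mono Ioo_subset_Ico_self
  refine ⟨?_, fun x hx => ?_⟩
  · refine ContinuousOn.congr (f := fun p : ℂ × ℝ => ((p.2 ^ (l + 1) : ℝ) : ℂ) * φt p.1 p.2)
      (((continuousOn_ofReal_rpow (l + 1)).comp continuousOn_snd fun p hp => hp.2.1).mul h.cont)
      fun p hp => P.phi_eq p.1 p.2 hp.2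
  · rw [show (fun z => φ z x) = fun z => ((x ^ (l + 1) : ℝ) : ℂ) * φt z x from
      funext fun z => P.phi_eq z x hx]
    exact (h.entire x hx).const_mul _

theorem theta_fam : EntireFamily (Ioo 0 1) θ := by
  have h := P.thetat_fam.mono Ioo_subset_Ico_self
  refine ⟨?_, fun x hx => ?_⟩
  · refine ContinuousOn.congr
      (f := fun p : ℂ × ℝ => ((p.2 ^ (-l) : ℝ) : ℂ) * (2 * l + 1 : ℂ)⁻¹ * θt p.1 p.2)
      ((((continuousOn_ofReal_rpow (-l)).comp continuousOn_snd fun p hp => hp.2.1).mul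
        continuousOn_const).mul h.cont) fun p hp => ?_
    rw [P.theta_eq p.1 p.2 hp.2]
    push_cast
    rw [div_eq_mul_inv]
  · rw [show (fun z => θ z x) = fun z => ((x ^ (-l) / (2 * l + 1) : ℝ) : ℂ) * θt z x from
      funext fun z => P.theta_eq z x hx]
    exact (h.entire x hx).const_mul _

theorem zDeriv_theta (k : ℕ) (z : ℂ) {x : ℝ} (hx : x ∈ Ioo (0 : ℝ) 1) :
    zDeriv k θ z x = ((x ^ (-l) / (2 * l + 1) : ℝ) : ℂ) * zDeriv k θt z x := by
  simp only [zDeriv]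
  rw [show (fun z => θ z x) = fun z => ((x ^ (-l) / (2 * l + 1) : ℝ) : ℂ) * θt z x from
      funext fun z => P.theta_eq z x hx, iteratedDeriv_const_mul_field]

theorem continuousOn_zDeriv_theta (k : ℕ) (z : ℂ) : ContinuousOn (zDeriv k θ z) (Ioo 0 1) :=
  (P.theta_fam.zDeriv k).continuousOn_right z

theorem continuousOn_phi (z : ℂ) : ContinuousOn (φ z) (Ioo 0 1) := P.phi_fam.continuousOn_right z

theorem continuousOn_theta (z : ℂ) : ContinuousOn (θ z) (Ioo 0 1) :=
  P.theta_fam.continuousOn_right z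

theorem tendsto_phit (z : ℂ) : Tendsto (φt z) (𝓝[>] 0) (𝓝 1) := by
  rw [← P.phit_zero z]
  exact tendsto_nhdsGT_of_continuousOn (P.phit_mem z).continuousOn

theorem tendsto_thetat (z : ℂ) : Tendsto (θt z) (𝓝[>] 0) (𝓝 1) := by
  rw [← P.thetat_zero z]
  exact tendsto_nhdsGT_of_continuousOn (P.thetat_mem z).continuousOn

/-- The weight against which `θt` is integrated in `∫ θ φ`. -/
theorem intervalIntegrable_weight (z : ℂ) {a b : ℝ} (ha : a ∈ Ico (0 : ℝ) 1)
    (hb : b ∈ Ico (0 : ℝ) 1) :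
    IntervalIntegrable (fun y => ((y ^ (-l) / (2 * l + 1) : ℝ) : ℂ) * φ z y) volume a b := by
  have hs : uIcc a b ⊆ Ico 0 1 := ordConnected_Ico.uIcc_subset ha hb
  have h1 : IntervalIntegrable (fun y : ℝ => ((y / (2 * l + 1) : ℝ) : ℂ) * φt z y) volume a b :=
    (ContinuousOn.mul (by fun_prop) ((P.phit_fam.continuousOn_right z).mono hs)).intervalIntegrable
  refine h1.congr_uIoo fun y hy => ?_
  have hy' : y ∈ Ioo (0 : ℝ) 1 := ⟨lt_of_le_of_lt (le_min ha.1 hb.1) hy.1,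
    hy.2.trans (max_lt ha.2 hb.2)⟩
  rw [P.phi_eq z y hy', ← mul_assoc, ← Complex.ofReal_mul, div_mul_eq_mul_div,
    ← Real.rpow_add hy'.1]
  simp

theorem zDeriv_mul_phi_eq (k : ℕ) (w z : ℂ) {a b : ℝ} (ha : a ∈ Ico (0 : ℝ) 1)
    (hb : b ∈ Ico (0 : ℝ) 1) :
    EqOn (fun y => zDeriv k θt w y * (((y ^ (-l) / (2 * l + 1) : ℝ) : ℂ) * φ z y))
      (fun y => zDeriv k θ w y * φ z y) (uIoo a b) := fun y hy => by
  have hy' : y ∈ Ioo (0 : ℝ) 1 := ⟨lt_of_le_of_lt (le_min ha.1 hb.1) hy.1,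
    hy.2.trans (max_lt ha.2 hb.2)⟩
  simp only
  rw [P.zDeriv_theta k w hy']
  ring

theorem intervalIntegrable_zDeriv_mul_phi (k : ℕ) (w z : ℂ) {a b : ℝ} (ha : a ∈ Ico (0 : ℝ) 1)
    (hb : b ∈ Ico (0 : ℝ) 1) :
    IntervalIntegrable (fun y => zDeriv k θ w y * φ z y) volume a b :=
  ((P.thetat_fam.zDeriv k).intervalIntegrable (ordConnected_Ico.uIcc_subset ha hb)
    (P.intervalIntegrable_weight z ha hb) w).congr_uIoo (P.zDeriv_mul_phi_eq k w z ha hb)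

theorem intervalIntegrable_zDeriv_mul_theta (k : ℕ) (w z : ℂ) {a b : ℝ} (ha : a ∈ Ioo (0 : ℝ) 1)
    (hb : b ∈ Ioo (0 : ℝ) 1) :
    IntervalIntegrable (fun y => zDeriv k θ w y * θ z y) volume a b :=
  (((P.continuousOn_zDeriv_theta k w).mul (P.continuousOn_theta z)).mono
    (ordConnected_Ioo.uIcc_subset ha hb)).intervalIntegrable

/-- θ need not be bounded at x = 0. Moving x^{-l} into the weight leaves θ̃, which is a family on
[0,1), so differentiation under the integral is possible down to the endpoint 0. -/
theorem integral_mul_phi_eq (z : ℂ) {a b : ℝ} (ha : a ∈ Ico (0 : ℝ) 1) (hb : b ∈ Ico (0 : ℝ) 1) :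
    (fun w => ∫ y in a..b, θ w y * φ z y) =
      fun w => ∫ y in a..b, θt w y * (((y ^ (-l) / (2 * l + 1) : ℝ) : ℂ) * φ z y) := by
  ext w
  have := P.zDeriv_mul_phi_eq 0 w z ha hb
  simp only [zDeriv_zero] at this
  exact (intervalIntegral.integral_congr_uIoo this).symm

theorem differentiable_integral_mul_phi (z : ℂ) {a b : ℝ} (ha : a ∈ Ico (0 : ℝ) 1)
    (hb : b ∈ Ico (0 : ℝ) 1) : Differentiable ℂ fun w => ∫ y in a..b, θ w y * φ z y := by
  rw [P.integral_mul_phi_eq z ha hb]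
  exact P.thetat_fam.differentiable_integral (ordConnected_Ico.uIcc_subset ha hb)
    (P.intervalIntegrable_weight z ha hb)

theorem iteratedDeriv_integral_mul_phi (k : ℕ) (z w : ℂ) {a b : ℝ} (ha : a ∈ Ico (0 : ℝ) 1)
    (hb : b ∈ Ico (0 : ℝ) 1) : iteratedDeriv k (fun w => ∫ y in a..b, θ w y * φ z y) w =
      ∫ y in a..b, zDeriv k θ w y * φ z y := by
  rw [P.integral_mul_phi_eq z ha hb, P.thetat_fam.iteratedDeriv_integral
    (ordConnected_Ico.uIcc_subset ha hb) (P.intervalIntegrable_weight z ha hb)]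
  exact intervalIntegral.integral_congr_uIoo (P.zDeriv_mul_phi_eq k w z ha hb)

theorem intervalIntegrable_theta (z : ℂ) {a b : ℝ} (ha : a ∈ Ioo (0 : ℝ) 1)
    (hb : b ∈ Ioo (0 : ℝ) 1) : IntervalIntegrable (θ z) volume a b :=
  ((P.continuousOn_theta z).mono (ordConnected_Ioo.uIcc_subset ha hb)).intervalIntegrable

theorem differentiable_integral_mul_theta (z : ℂ) {a b : ℝ} (ha : a ∈ Ioo (0 : ℝ) 1)
    (hb : b ∈ Ioo (0 : ℝ) 1) : Differentiable ℂ fun w => ∫ y in a..b, θ w y * θ z y :=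
  P.theta_fam.differentiable_integral (ordConnected_Ioo.uIcc_subset ha hb)
    (P.intervalIntegrable_theta z ha hb)

theorem iteratedDeriv_integral_mul_theta (k : ℕ) (z w : ℂ) {a b : ℝ} (ha : a ∈ Ioo (0 : ℝ) 1)
    (hb : b ∈ Ioo (0 : ℝ) 1) : iteratedDeriv k (fun w => ∫ y in a..b, θ w y * θ z y) w =
      ∫ y in a..b, zDeriv k θ w y * θ z y := by
  rw [P.theta_fam.iteratedDeriv_integral (ordConnected_Ioo.uIcc_subset ha hb)
    (P.intervalIntegrable_theta z ha hb)]

theorem continuousOn_primitive_mul_phi (k : ℕ) (w z : ℂ) {b : ℝ} (hb : b ∈ Ioo (0 : ℝ) 1) :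
    ContinuousOn (fun x => ∫ y in (0 : ℝ)..x, zDeriv k θ w y * φ z y) (Icc 0 b) := by
  have := intervalIntegral.continuousOn_primitive_interval' (a := 0)
    (P.intervalIntegrable_zDeriv_mul_phi k w z (a := 0) (by simp) ⟨hb.1.le, hb.2⟩) left_mem_uIcc
  rwa [uIcc_of_le hb.1.le] at this

theorem tendsto_primitive_mul_phi (k : ℕ) (w z : ℂ) :
    Tendsto (fun x => ∫ y in (0 : ℝ)..x, zDeriv k θ w y * φ z y) (𝓝[>] 0) (𝓝 0) := by
  have h := P.continuousOn_primitive_mul_phi k w z (b := 1 / 2) ⟨by norm_num, by norm_num⟩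
  have := (h 0 ⟨le_rfl, by norm_num⟩).tendsto.mono_left (nhdsWithin_le_of_mem
      (mem_of_superset (Ioc_mem_nhdsGT (show (0 : ℝ) < 1 / 2 by norm_num)) Ioc_subset_Icc_self))
  simpa using this

/-- θ(w)φ(z) is O(x), so the increment formula gives W a limit at 0. By `wronskian_limit_eq` this
limit is (2l+1) · 1/(2l+1) = 1. -/
theorem wronskian_theta_phi (w z : ℂ) {x : ℝ} (hx : x ∈ Ioo (0 : ℝ) 1) :
    wronskian (θ w) (φ z) x = 1 + (w - z) * ∫ y in (0 : ℝ)..x, θ w y * φ z y := by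
  have hx' : x ∈ Ico (0 : ℝ) 1 := ⟨hx.1.le, hx.2⟩
  have h0 : (0 : ℝ) ∈ Ico (0 : ℝ) 1 := by simp
  have e : ∀ a ∈ Ioo (0 : ℝ) 1, wronskian (θ w) (φ z) a =
      wronskian (θ w) (φ z) x - (w - z) * (∫ y in (0 : ℝ)..x, θ w y * φ z y) +
        (w - z) * ∫ y in (0 : ℝ)..a, θ w y * φ z y := by
    intro a ha
    have h1 := P.wronskian_phi w z a ha x hx
    have i : ∀ b ∈ Ico (0 : ℝ) 1, IntervalIntegrable (fun y => θ w y * φ z y) volume 0 b :=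
      fun b hb => by
        have := P.intervalIntegrable_zDeriv_mul_phi 0 w z h0 hb
        rwa [zDeriv_zero] at this
    rw [← intervalIntegral.integral_interval_sub_left (i x hx') (i a ⟨ha.1.le, ha.2⟩)] at h1
    linear_combination -h1
  have hI : Tendsto (fun x => ∫ y in (0 : ℝ)..x, θ w y * φ z y) (𝓝[>] 0) (𝓝 0) := by
    simpa only [zDeriv_zero] using P.tendsto_primitive_mul_phi 0 w z
  have hW : Tendsto (wronskian (θ w) (φ z)) (𝓝[>] 0)
      (𝓝 (wronskian (θ w) (φ z) x - (w - z) * (∫ y in (0 : ℝ)..x, θ w y * φ z y))) := by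
    have := (hI.const_mul (w - z)).const_add
      (wronskian (θ w) (φ z) x - (w - z) * (∫ y in (0 : ℝ)..x, θ w y * φ z y))
    rw [mul_zero, add_zero] at this
    refine this.congr' ?_
    filter_upwards [Ioo_mem_nhdsGT one_pos] with a ha using (e a ha).symm
  have hθ : Tendsto (fun x : ℝ => ((x ^ l : ℝ) : ℂ) * θ w x) (𝓝[>] 0) (𝓝 (1 / (2 * l + 1))) := by
    refine ((P.tendsto_thetat w).div_const (2 * l + 1 : ℂ)).congr' ?_
    filter_upwards [Ioo_mem_nhdsGT one_pos] with a ha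
    rw [P.theta_eq w a ha, Real.rpow_neg ha.1.le]
    have : ((a ^ l : ℝ) : ℂ) ≠ 0 := by exact_mod_cast (Real.rpow_pos_of_pos ha.1 _).ne'
    have := P.two_l_ne
    push_cast
    field_simp
  have := wronskian_limit_eq P.hl (P.theta_diff w) (P.phi_diff z) (P.tendsto_phit z) (P.phi_eq z)
    hW hθ
  rw [mul_one_div_cancel P.two_l_ne] at this
  linear_combination this

theorem wronskian_self (z : ℂ) {x : ℝ} (hx : x ∈ Ioo (0 : ℝ) 1) :
    wronskian (θ z) (φ z) x = 1 := by
  rw [P.wronskian_theta_phi z z hx]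
  simp

/-- θ(w) is written in the basis θ(z), φ(z); the coefficients are Wronskians because W(θ(z),φ(z)) =
1. -/
theorem theta_expansion (w z : ℂ) {x : ℝ} (hx : x ∈ Ioo (0 : ℝ) 1) :
    θ w x = θ z x * (1 + (w - z) * ∫ y in (0 : ℝ)..x, θ w y * φ z y) -
      φ z x * wronskian (θ w) (θ z) x := by
  rw [← P.wronskian_theta_phi w z hx]
  have := P.wronskian_self z hx
  simp only [wronskian] at this ⊢
  linear_combination -(θ w x) * this

theorem phi_ne_zero_eventually (z : ℂ) : ∀ᶠ x in 𝓝[>] (0 : ℝ), φ z x ≠ 0 := by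
  filter_upwards [(P.tendsto_phit z).eventually_ne one_ne_zero, Ioo_mem_nhdsGT one_pos]
    with x h1 hx
  rw [P.phi_eq z x hx]
  exact mul_ne_zero (by exact_mod_cast (Real.rpow_pos_of_pos hx.1 _).ne') h1

/-- No analyticity of the x-derivative of θ(w) is assumed. At a point x₁ with φ(z,x₁) ≠ 0
`theta_expansion` can be solved for the Wronskian, and from x₁ to x the Wronskian changes by an
integral that is entire in w. -/
theorem differentiable_wronskian (z : ℂ) {x : ℝ} (hx : x ∈ Ioo (0 : ℝ) 1) :
    Differentiable ℂ fun w => wronskian (θ w) (θ z) x := by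
  obtain ⟨x₁, h1, hx1⟩ := ((P.phi_ne_zero_eventually z).and (Ioo_mem_nhdsGT one_pos)).exists
  have e : (fun w => wronskian (θ w) (θ z) x) = fun w =>
      (θ z x₁ * (1 + (w - z) * ∫ y in (0 : ℝ)..x₁, θ w y * φ z y) - θ w x₁) / φ z x₁ +
        (w - z) * ∫ y in x₁..x, θ w y * θ z y := by
    ext w
    rw [← P.wronskian_theta w z x₁ hx1 x hx]
    have := P.theta_expansion w z hx1
    field_simp
    linear_combination this
  rw [e]
  have d1 : Differentiable ℂ fun w : ℂ => w - z := differentiable_id.sub_const z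
  exact (((((d1.mul (P.differentiable_integral_mul_phi z (by simp) ⟨hx1.1.le, hx1.2⟩)).const_add
    1).const_mul _).sub (P.theta_fam.entire x₁ hx1)).div_const _).add
    (d1.mul (P.differentiable_integral_mul_theta z hx1 hx))

omit P in
/-- The spectral derivatives of the Wronskian `W_x(θ(w), θ(z))` at `w = z`. -/
noncomputable def _root_.wronskianDeriv (θ : ℂ → ℝ → ℂ) (k : ℕ) (z : ℂ) (x : ℝ) : ℂ :=
  iteratedDeriv k (fun w => wronskian (θ w) (θ z) x) z

theorem wronskianDeriv_sub (k : ℕ) (z : ℂ) {a b : ℝ} (ha : a ∈ Ioo (0 : ℝ) 1)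
    (hb : b ∈ Ioo (0 : ℝ) 1) :
    wronskianDeriv θ k z b - wronskianDeriv θ k z a =
      k * ∫ y in a..b, zDeriv (k - 1) θ z y * θ z y := by
  have h1 := iteratedDeriv_sub (n := k) (x := z) (P.differentiable_wronskian z hb).contDiff.contDiffAt
    (P.differentiable_wronskian z ha).contDiff.contDiffAt
  rw [wronskianDeriv, wronskianDeriv, ← h1]
  have e : ((fun w => wronskian (θ w) (θ z) b) - fun w => wronskian (θ w) (θ z) a) =
      fun w => (w - z) * ∫ y in a..b, θ w y * θ z y := by
    ext w
    exact P.wronskian_theta w z a ha b hb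
  rw [e, iteratedDeriv_sub_mul (P.differentiable_integral_mul_theta z ha hb), sub_self, zero_mul,
    zero_add, P.iteratedDeriv_integral_mul_theta _ z z ha hb]

/-- This is `theta_expansion` differentiated k times at w = z. The factor w - z lowers the order
under the integral by one; the summand 1 drops out because k ≥ 1. -/
theorem zDeriv_expansion {k : ℕ} (hk : 1 ≤ k) (z : ℂ) {x : ℝ} (hx : x ∈ Ioo (0 : ℝ) 1) :
    zDeriv k θ z x = θ z x * (k * ∫ y in (0 : ℝ)..x, zDeriv (k - 1) θ z y * φ z y) -
      φ z x * wronskianDeriv θ k z x := by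
  have h0 : (0 : ℝ) ∈ Ico (0 : ℝ) 1 := by simp
  have hx' : x ∈ Ico (0 : ℝ) 1 := ⟨hx.1.le, hx.2⟩
  have dI := P.differentiable_integral_mul_phi z h0 hx'
  have d1 : Differentiable ℂ fun w : ℂ => (w - z) * ∫ y in (0 : ℝ)..x, θ w y * φ z y :=
    (differentiable_id.sub_const z).mul dI
  have dA : Differentiable ℂ fun w : ℂ => 1 + (w - z) * ∫ y in (0 : ℝ)..x, θ w y * φ z y :=
    d1.const_add 1
  rw [zDeriv, show (fun w => θ w x) =
    (fun w => θ z x * (1 + (w - z) * ∫ y in (0 : ℝ)..x, θ w y * φ z y)) -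
      fun w => φ z x * wronskian (θ w) (θ z) x from funext fun w => P.theta_expansion w z hx,
    iteratedDeriv_sub (dA.const_mul _).contDiff.contDiffAt
      ((P.differentiable_wronskian z hx).const_mul _).contDiff.contDiffAt,
    iteratedDeriv_const_mul_field, iteratedDeriv_const_mul_field,
    iteratedDeriv_const_add hk, iteratedDeriv_sub_mul dI, sub_self, zero_mul, zero_add,
    P.iteratedDeriv_integral_mul_phi _ z z h0 hx', wronskianDeriv]

end SolutionPair

/-! ### Power bounds for integrals -/

theorem norm_integral_le_rpow_of_gt {f : ℝ → ℂ} {C r x : ℝ} (hx : 0 < x) (hr : -1 < r)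
    (h : ∀ y ∈ Ioc 0 x, ‖f y‖ ≤ C * y ^ r) :
    ‖∫ y in (0 : ℝ)..x, f y‖ ≤ C / (r + 1) * x ^ (r + 1) := by
  refine (intervalIntegral.norm_integral_le_of_norm_le hx.le (Eventually.of_forall h)
    ((intervalIntegral.intervalIntegrable_rpow' hr).const_mul C)).trans_eq ?_
  rw [intervalIntegral.integral_const_mul, integral_rpow (Or.inl hr),
    Real.zero_rpow (by linarith)]
  ring

theorem norm_integral_le_rpow_of_lt {f : ℝ → ℂ} {C r x b : ℝ} (hx : 0 < x) (hxb : x ≤ b)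
    (hC : 0 ≤ C) (hr : r < -1) (h : ∀ y ∈ Ioc x b, ‖f y‖ ≤ C * y ^ r) :
    ‖∫ y in x..b, f y‖ ≤ C / (-(r + 1)) * x ^ (r + 1) := by
  have h0 : (0 : ℝ) ∉ uIcc x b := by
    rw [uIcc_of_le hxb]; exact fun h => absurd h.1 (not_le.2 hx)
  refine (intervalIntegral.norm_integral_le_of_norm_le hxb (Eventually.of_forall h)
    ((intervalIntegral.intervalIntegrable_rpow (Or.inr h0)).const_mul C)).trans ?_
  rw [intervalIntegral.integral_const_mul, integral_rpow (Or.inr ⟨by linarith, h0⟩),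
    div_mul_eq_mul_div, mul_div_assoc]
  refine mul_le_mul_of_nonneg_left ?_ hC
  rw [← neg_div_neg_eq]
  refine div_le_div_of_nonneg_right ?_ (by linarith)
  have := Real.rpow_nonneg (hx.le.trans hxb) (r + 1)
  linarith

theorem tendstoLocallyUniformlyOn_univ_of_closedBall {ι : Type*} {F : ι → ℂ → ℂ} {f : ℂ → ℂ}
    {p : Filter ι} (h : ∀ ρ, TendstoUniformlyOn F f p (Metric.closedBall 0 ρ)) :
    TendstoLocallyUniformlyOn F f p univ := by
  rw [tendstoLocallyUniformlyOn_iff_forall_isCompact isOpen_univ]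
  intro K _ hK
  obtain ⟨ρ, hρ⟩ := hK.isBounded.subset_closedBall 0
  exact (h ρ).mono hρ

theorem tendstoUniformlyOn_of_norm_sub_le {ι : Type*} {F : ι → ℂ → ℂ} {f : ℂ → ℂ}
    {p : Filter ι} {S : Set ℂ} {b : ι → ℝ} (hb : Tendsto b p (𝓝 0))
    (h : ∀ᶠ i in p, ∀ w ∈ S, ‖F i w - f w‖ ≤ b i) : TendstoUniformlyOn F f p S := by
  rw [Metric.tendstoUniformlyOn_iff]
  intro ε hε
  filter_upwards [h, hb.eventually_lt_const hε] with i hi hbi w hw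
  rw [dist_comm, dist_eq_norm]
  exact (hi w hw).trans_lt hbi

theorem nl_le {l : ℝ} (hl : -(1 / 2) < l) : (nl l : ℝ) ≤ l + 1 / 2 :=
  Nat.floor_le (by linarith)

theorem lt_nl_add_one (l : ℝ) : l + 1 / 2 < nl l + 1 := Nat.lt_floor_add_one _

/-! ### Taylor remainders in the spectral parameter -/

/-- The remainder of the Taylor polynomial at `0` with `m` terms, in the spectral parameter. -/
noncomputable def taylorRemainder (u : ℂ → ℝ → ℂ) (m : ℕ) (w : ℂ) (x : ℝ) : ℂ :=
  u w x - ∑ k ∈ Finset.range m, w ^ k / k.factorial * zDeriv k u 0 x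

theorem taylorRemainder_zero (u : ℂ → ℝ → ℂ) : taylorRemainder u 0 = u := by
  ext w x; simp [taylorRemainder]

theorem differentiable_taylorRemainder {u : ℂ → ℝ → ℂ} {x : ℝ}
    (hu : Differentiable ℂ fun w => u w x) (m : ℕ) :
    Differentiable ℂ fun w => taylorRemainder u m w x := by
  unfold taylorRemainder
  fun_prop

namespace SolutionPair

variable {l : ℝ} {φ θ φt θt : ℂ → ℝ → ℂ} (P : SolutionPair l φ θ φt θt)

/-- The Wronskians `W_x(θ(w), θ(0))`. -/
noncomputable def _root_.wronskianZero (θ : ℂ → ℝ → ℂ) (w : ℂ) (x : ℝ) : ℂ :=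
  wronskian (θ w) (θ 0) x

include P

theorem continuousOn_taylorRemainder (m : ℕ) (w : ℂ) :
    ContinuousOn (taylorRemainder θ m w) (Ioo 0 1) :=
  (P.continuousOn_theta w).sub (continuousOn_finsetSum _ fun k _ =>
    continuousOn_const.mul (P.continuousOn_zDeriv_theta k 0))

theorem integral_taylorRemainder_mul_phi (m : ℕ) (w : ℂ) {x : ℝ} (hx : x ∈ Ioo (0 : ℝ) 1) :
    ∫ y in (0 : ℝ)..x, taylorRemainder θ m w y * φ 0 y =
      (∫ y in (0 : ℝ)..x, θ w y * φ 0 y) - ∑ k ∈ Finset.range m,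
        w ^ k / k.factorial * ∫ y in (0 : ℝ)..x, zDeriv k θ 0 y * φ 0 y := by
  have i : ∀ k w, IntervalIntegrable (fun y => zDeriv k θ w y * φ 0 y) volume 0 x :=
    fun k w => P.intervalIntegrable_zDeriv_mul_phi k w 0 (by simp) ⟨hx.1.le, hx.2⟩
  have i0 := i 0 w
  simp only [zDeriv_zero] at i0
  have i1 : ∀ k, IntervalIntegrable
      (fun y => w ^ k / k.factorial * (zDeriv k θ 0 y * φ 0 y)) volume 0 x :=
    fun k => (i k 0).const_mul _
  simp_rw [← intervalIntegral.integral_const_mul]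
  rw [← intervalIntegral.integral_finsetSum fun k _ => i1 k,
    ← intervalIntegral.integral_sub i0 (by
      exact (IntervalIntegrable.sum (Finset.range m) (fun k _ => i1 k)).congr
        fun y _ => by simp)]
  refine intervalIntegral.integral_congr fun y _ => ?_
  simp only [taylorRemainder, sub_mul, Finset.sum_mul, mul_assoc]

theorem integral_taylorRemainder_mul_theta (m : ℕ) (w : ℂ) {a b : ℝ} (ha : a ∈ Ioo (0 : ℝ) 1)
    (hb : b ∈ Ioo (0 : ℝ) 1) :
    ∫ y in a..b, taylorRemainder θ m w y * θ 0 y =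
      (∫ y in a..b, θ w y * θ 0 y) - ∑ k ∈ Finset.range m,
        w ^ k / k.factorial * ∫ y in a..b, zDeriv k θ 0 y * θ 0 y := by
  have i : ∀ k w, IntervalIntegrable (fun y => zDeriv k θ w y * θ 0 y) volume a b :=
    fun k w => P.intervalIntegrable_zDeriv_mul_theta k w 0 ha hb
  have i0 := i 0 w
  simp only [zDeriv_zero] at i0
  have i1 : ∀ k, IntervalIntegrable
      (fun y => w ^ k / k.factorial * (zDeriv k θ 0 y * θ 0 y)) volume a b :=
    fun k => (i k 0).const_mul _
  simp_rw [← intervalIntegral.integral_const_mul]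
  rw [← intervalIntegral.integral_finsetSum fun k _ => i1 k,
    ← intervalIntegral.integral_sub i0 (by
      exact (IntervalIntegrable.sum (Finset.range m) (fun k _ => i1 k)).congr
        fun y _ => by simp)]
  refine intervalIntegral.integral_congr fun y _ => ?_
  simp only [taylorRemainder, sub_mul, Finset.sum_mul, mul_assoc]

/-- The factor w in `theta_expansion` shifts the order, so m terms removed under the integral are m
+ 1 terms removed outside. The term of order zero is θ(0,x) alone, since the Wronskian vanishes at w
= 0. -/
theorem taylorRemainder_succ (m : ℕ) (w : ℂ) {x : ℝ} (hx : x ∈ Ioo (0 : ℝ) 1) :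
    taylorRemainder θ (m + 1) w x =
      θ 0 x * (w * ∫ y in (0 : ℝ)..x, taylorRemainder θ m w y * φ 0 y) -
        φ 0 x * taylorRemainder (wronskianZero θ) (m + 1) w x := by
  have h1 := P.theta_expansion w 0 hx
  rw [P.integral_taylorRemainder_mul_phi m w hx]
  have h2 : ∀ k : ℕ, w ^ (k + 1) / (k + 1).factorial * zDeriv (k + 1) θ 0 x =
      θ 0 x * (w * (w ^ k / k.factorial * ∫ y in (0 : ℝ)..x, zDeriv k θ 0 y * φ 0 y)) -
        φ 0 x * (w ^ (k + 1) / (k + 1).factorial * zDeriv (k + 1) (wronskianZero θ) 0 x) := by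
    intro k
    rw [P.zDeriv_expansion (by omega) 0 hx, Nat.add_sub_cancel]
    have e : wronskianDeriv θ (k + 1) 0 x = zDeriv (k + 1) (wronskianZero θ) 0 x := rfl
    have : ((k.factorial : ℕ) : ℂ) ≠ 0 := by exact_mod_cast k.factorial_ne_zero
    have : ((k : ℂ) + 1) ≠ 0 := by exact_mod_cast k.succ_ne_zero
    rw [e, Nat.factorial_succ]
    push_cast
    field_simp
    ring
  have h3 : wronskianZero θ 0 x = 0 := by simp only [wronskianZero, wronskian]; ring
  simp only [taylorRemainder, Finset.sum_range_succ' _ m, h2, Finset.sum_sub_distrib,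
    ← Finset.mul_sum, zDeriv_zero, h3, pow_zero, Nat.factorial_zero]
  rw [sub_zero] at h1
  rw [h1]
  simp only [wronskianZero]
  push_cast
  ring

theorem taylorRemainder_wronskian_sub (m : ℕ) (w : ℂ) {a b : ℝ} (ha : a ∈ Ioo (0 : ℝ) 1)
    (hb : b ∈ Ioo (0 : ℝ) 1) :
    taylorRemainder (wronskianZero θ) (m + 1) w b - taylorRemainder (wronskianZero θ) (m + 1) w a =
      w * ∫ y in a..b, taylorRemainder θ m w y * θ 0 y := by
  have h1 := P.wronskian_theta w 0 a ha b hb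
  rw [sub_zero] at h1
  rw [P.integral_taylorRemainder_mul_theta m w ha hb]
  have h2 : ∀ k : ℕ, w ^ (k + 1) / (k + 1).factorial * zDeriv (k + 1) (wronskianZero θ) 0 b -
      w ^ (k + 1) / (k + 1).factorial * zDeriv (k + 1) (wronskianZero θ) 0 a =
      w * (w ^ k / k.factorial * ∫ y in a..b, zDeriv k θ 0 y * θ 0 y) := by
    intro k
    have e := P.wronskianDeriv_sub (k + 1) 0 ha hb
    have e1 : ∀ x, wronskianDeriv θ (k + 1) 0 x = zDeriv (k + 1) (wronskianZero θ) 0 x :=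
      fun _ => rfl
    rw [e1, e1, Nat.add_sub_cancel] at e
    have : ((k.factorial : ℕ) : ℂ) ≠ 0 := by exact_mod_cast k.factorial_ne_zero
    have : ((k : ℂ) + 1) ≠ 0 := by exact_mod_cast k.succ_ne_zero
    rw [← mul_sub, e, Nat.factorial_succ]
    push_cast
    field_simp
    ring
  have h3 : ∀ x, wronskian (θ 0) (θ 0) x = 0 := fun x => by
    simp only [wronskian]; ring
  have h4 := Finset.sum_congr (rfl : Finset.range m = _) fun k _ => h2 k
  rw [Finset.sum_sub_distrib, ← Finset.mul_sum] at h4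
  simp only [taylorRemainder, Finset.sum_range_succ' _ m, zDeriv_zero, h3, wronskianZero] at h4 ⊢
  linear_combination h1 - h4

theorem exists_bound_phi (z : ℂ) :
    ∃ M, 0 ≤ M ∧ ∀ x ∈ Ioc (0 : ℝ) (1 / 2), ‖φ z x‖ ≤ M * x ^ (l + 1) := by
  obtain ⟨M, hM⟩ := P.phit_fam.exists_bound (isCompact_singleton (x := z))
    (isCompact_Icc (a := (0 : ℝ)) (b := 1 / 2)) fun x hx => ⟨hx.1, by linarith [hx.2]⟩
  refine ⟨M, (norm_nonneg _).trans (hM z rfl 0 (by simp)), fun x hx => ?_⟩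
  rw [P.phi_eq z x ⟨hx.1, by linarith [hx.2]⟩, norm_mul, Complex.norm_real, Real.norm_eq_abs,
    abs_of_pos (Real.rpow_pos_of_pos hx.1 _), mul_comm]
  exact mul_le_mul_of_nonneg_right (hM z rfl x ⟨hx.1.le, hx.2⟩) (Real.rpow_nonneg hx.1.le _)

theorem exists_bound_theta {K : Set ℂ} (hK : IsCompact K) :
    ∃ M, 0 ≤ M ∧ ∀ z ∈ K, ∀ x ∈ Ioc (0 : ℝ) (1 / 2), ‖θ z x‖ ≤ M * x ^ (-l) := by
  obtain ⟨M, hM⟩ := P.thetat_fam.exists_bound hK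
    (isCompact_Icc (a := (0 : ℝ)) (b := 1 / 2)) fun x hx => ⟨hx.1, by linarith [hx.2]⟩
  have h2l := P.two_l_pos
  refine ⟨max M 0 / (2 * l + 1), by positivity, fun z hz x hx => ?_⟩
  rw [P.theta_eq z x ⟨hx.1, by linarith [hx.2]⟩, norm_mul, Complex.norm_real, Real.norm_eq_abs,
    abs_of_pos (div_pos (Real.rpow_pos_of_pos hx.1 _) h2l), div_mul_eq_mul_div,
    div_mul_eq_mul_div, mul_comm]
  refine div_le_div_of_nonneg_right (mul_le_mul_of_nonneg_right
    ((hM z hz x ⟨hx.1.le, hx.2⟩).trans (le_max_left _ _)) (Real.rpow_nonneg hx.1.le _)) h2l.le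

theorem exists_bound_taylorRemainder_wronskian (m : ℕ) {x : ℝ} (hx : x ∈ Ioo (0 : ℝ) 1) (ρ : ℝ) :
    ∃ M, ∀ w ∈ Metric.closedBall (0 : ℂ) ρ, ‖taylorRemainder (wronskianZero θ) m w x‖ ≤ M :=
  (isCompact_closedBall 0 ρ).exists_bound_of_continuousOn
    (differentiable_taylorRemainder (P.differentiable_wronskian 0 hx) m).continuous.continuousOn

variable {ρ δ C : ℝ} {m : ℕ}

/-- Multiplication by φ gains l + 1 powers, integration gains one, and multiplication by θ loses l:
a net gain of x². -/
theorem norm_integral_taylorRemainder_mul_phi_le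
    (hδ : δ ≤ 1) (hC : 0 ≤ C) (hR : ∀ w ∈ Metric.closedBall (0 : ℂ) ρ, ∀ x ∈ Ioc (0 : ℝ) (1 / 2),
      ‖taylorRemainder θ m w x‖ ≤ C * x ^ (-l + 2 * m - δ)) :
    ∃ C', 0 ≤ C' ∧ ∀ w ∈ Metric.closedBall (0 : ℂ) ρ, ∀ x ∈ Ioc (0 : ℝ) (1 / 2),
      ‖θ 0 x * (w * ∫ y in (0 : ℝ)..x, taylorRemainder θ m w y * φ 0 y)‖ ≤
        C' * x ^ (-l + 2 * (m + 1) - δ) := by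
  obtain ⟨A, hA0, hA⟩ := P.exists_bound_phi 0
  obtain ⟨B, hB0, hB⟩ := P.exists_bound_theta (isCompact_singleton (x := (0 : ℂ)))
  have hm : (0 : ℝ) ≤ m := Nat.cast_nonneg m
  have hpos : 0 < 2 * m + 1 - δ + 1 := by linarith
  refine ⟨B * (|ρ| * (C * A / (2 * m + 1 - δ + 1))), by positivity, fun w hw x hx => ?_⟩
  have h1 : ‖∫ y in (0 : ℝ)..x, taylorRemainder θ m w y * φ 0 y‖ ≤
      C * A / (2 * m + 1 - δ + 1) * x ^ (2 * m + 1 - δ + 1) := by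
    refine norm_integral_le_rpow_of_gt hx.1 (by linarith) fun y hy => ?_
    have hy' : y ∈ Ioc (0 : ℝ) (1 / 2) := ⟨hy.1, hy.2.trans hx.2⟩
    rw [norm_mul, show 2 * (m : ℝ) + 1 - δ = (-l + 2 * m - δ) + (l + 1) by ring,
      Real.rpow_add hy.1]
    refine (mul_le_mul (hR w hw y hy') (hA y hy') (norm_nonneg _)
      (mul_nonneg hC (Real.rpow_nonneg hy.1.le _))).trans_eq (by ring)
  have hw' : ‖w‖ ≤ |ρ| := (mem_closedBall_zero_iff.1 hw).trans (le_abs_self _)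
  rw [norm_mul, norm_mul, show -l + 2 * ((m : ℝ) + 1) - δ = -l + (2 * m + 1 - δ + 1) by ring,
    Real.rpow_add hx.1]
  refine (mul_le_mul (hB 0 rfl x hx) (mul_le_mul hw' h1 (norm_nonneg _) (abs_nonneg _))
    (by positivity) (mul_nonneg hB0 (Real.rpow_nonneg hx.1.le _))).trans_eq (by ring)

theorem norm_taylorRemainder_mul_theta_le
    (hC : 0 ≤ C) (hR : ∀ w ∈ Metric.closedBall (0 : ℂ) ρ, ∀ x ∈ Ioc (0 : ℝ) (1 / 2),
      ‖taylorRemainder θ m w x‖ ≤ C * x ^ (-l + 2 * m - δ)) :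
    ∃ C', 0 ≤ C' ∧ ∀ w ∈ Metric.closedBall (0 : ℂ) ρ, ∀ x ∈ Ioc (0 : ℝ) (1 / 2),
      ‖taylorRemainder θ m w x * θ 0 x‖ ≤ C' * x ^ (-(2 * l) + 2 * m - δ) := by
  obtain ⟨B, hB0, hB⟩ := P.exists_bound_theta (isCompact_singleton (x := (0 : ℂ)))
  refine ⟨C * B, by positivity, fun w hw x hx => ?_⟩
  rw [norm_mul, show -(2 * l) + 2 * (m : ℝ) - δ = (-l + 2 * m - δ) + -l by ring,
    Real.rpow_add hx.1]
  exact (mul_le_mul (hR w hw x hx) (hB 0 rfl x hx) (norm_nonneg _)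
      (mul_nonneg hC (Real.rpow_nonneg hx.1.le _))).trans_eq (by ring)

/-- Each order gains x². As long as m + 1 ≤ n_l, the bound for the product of the remainder with θ
has exponent below -1, so its integral from x to 1/2 is governed by the endpoint x and dominates the
constant of integration. The loss δ > 0 keeps the inequality strict when m + 1 = n_l = l + 1/2,
where a logarithm would intervene. -/
theorem exists_bound_taylorRemainder (ρ : ℝ) (hδ0 : 0 < δ) (hδ : δ ≤ 1) (m : ℕ)
    (hm : m ≤ nl l) :
    ∃ C, 0 ≤ C ∧ ∀ w ∈ Metric.closedBall (0 : ℂ) ρ, ∀ x ∈ Ioc (0 : ℝ) (1 / 2),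
      ‖taylorRemainder θ m w x‖ ≤ C * x ^ (-l + 2 * m - δ) := by
  induction m with
  | zero =>
    obtain ⟨B, hB0, hB⟩ := P.exists_bound_theta (isCompact_closedBall (0 : ℂ) ρ)
    refine ⟨B, hB0, fun w hw x hx => ?_⟩
    rw [taylorRemainder_zero]
    refine (hB w hw x hx).trans (mul_le_mul_of_nonneg_left ?_ hB0)
    refine Real.rpow_le_rpow_of_exponent_ge hx.1 (by linarith [hx.2]) ?_
    push_cast
    linarith
  | succ m ih =>
    obtain ⟨C, hC0, hC⟩ := ih (by omega)
    obtain ⟨C₁, hC₁0, hC₁⟩ := P.norm_integral_taylorRemainder_mul_phi_le hδ hC0 hC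
    obtain ⟨C₂, hC₂0, hC₂⟩ := P.norm_taylorRemainder_mul_theta_le hC0 hC
    obtain ⟨A, hA0, hA⟩ := P.exists_bound_phi 0
    have hhalf : (1 / 2 : ℝ) ∈ Ioo (0 : ℝ) 1 := ⟨by norm_num, by norm_num⟩
    obtain ⟨D, hD⟩ := P.exists_bound_taylorRemainder_wronskian (m + 1) hhalf ρ
    have hm' : (m : ℝ) + 1 ≤ l + 1 / 2 := (by exact_mod_cast hm : ((m : ℝ) + 1) ≤ nl l).trans
      (nl_le P.hl)
    set r : ℝ := -(2 * l) + 2 * m - δ with hr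
    have hr1 : r < -1 := by rw [hr]; linarith
    refine ⟨C₁ + A * (|D| + |ρ| * (C₂ / (-(r + 1)))),
      add_nonneg hC₁0 (mul_nonneg hA0 (add_nonneg (abs_nonneg _) (mul_nonneg (abs_nonneg _)
        (div_nonneg hC₂0 (by linarith))))), fun w hw x hx => ?_⟩
    have hx' : x ∈ Ioo (0 : ℝ) 1 := ⟨hx.1, by linarith [hx.2]⟩
    have hw' : ‖w‖ ≤ |ρ| := (mem_closedBall_zero_iff.1 hw).trans (le_abs_self _)
    have h1 := P.taylorRemainder_wronskian_sub m w hx' hhalf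
    have h2 : ‖∫ y in x..(1 / 2), taylorRemainder θ m w y * θ 0 y‖ ≤
        C₂ / (-(r + 1)) * x ^ (r + 1) :=
      norm_integral_le_rpow_of_lt hx.1 hx.2 hC₂0 hr1
        fun y hy => hC₂ w hw y ⟨hx.1.trans hy.1, hy.2⟩
    have hone : (1 : ℝ) ≤ x ^ (r + 1) :=
      Real.one_le_rpow_of_pos_of_le_one_of_nonpos hx.1 (by linarith [hx.2]) (by linarith)
    have h3 : ‖taylorRemainder (wronskianZero θ) (m + 1) w x‖ ≤
        (|D| + |ρ| * (C₂ / (-(r + 1)))) * x ^ (r + 1) := by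
      rw [show taylorRemainder (wronskianZero θ) (m + 1) w x =
        taylorRemainder (wronskianZero θ) (m + 1) w (1 / 2) -
          w * ∫ y in x..(1 / 2), taylorRemainder θ m w y * θ 0 y by rw [← h1]; ring]
      refine (norm_sub_le _ _).trans ?_
      rw [norm_mul, add_mul, mul_assoc |ρ|]
      refine add_le_add (((hD w hw).trans (le_abs_self D)).trans
        (le_mul_of_one_le_right (abs_nonneg _) hone))
        (mul_le_mul hw' h2 (norm_nonneg _) (abs_nonneg _))
    rw [P.taylorRemainder_succ m w hx', add_mul]
    refine (norm_sub_le _ _).trans (add_le_add ?_ ?_)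
    · push_cast
      exact hC₁ w hw x hx
    · rw [norm_mul]
      refine (mul_le_mul (hA x hx) h3 (norm_nonneg _)
        (mul_nonneg hA0 (Real.rpow_nonneg hx.1.le _))).trans_eq ?_
      rw [show -l + 2 * ((m + 1 : ℕ) : ℝ) - δ = (l + 1) + (r + 1) by rw [hr]; push_cast; ring,
        Real.rpow_add hx.1 (l + 1) (r + 1)]
      ring

/-- The remainder after `n_l + 1` terms, divided by `x^{l+1}`, converges locally uniformly. -/
theorem exists_limit_taylorRemainder : ∃ F : ℂ → ℂ, TendstoLocallyUniformlyOn
      (fun x w => ((x ^ (-(l + 1)) : ℝ) : ℂ) * taylorRemainder θ (nl l + 1) w x) F (𝓝[>] 0) univ := by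
  set n := nl l with hn
  have hn1 : (n : ℝ) ≤ l + 1 / 2 := nl_le P.hl
  have hn2 : l + 1 / 2 < n + 1 := lt_nl_add_one l
  -- The product of the remainder with θ has exponent 2n - 2l - δ, which has to exceed -1. Half of
  -- the admissible margin 2n + 1 - 2l lies in (0,1], because n ≤ l + 1/2 < n + 1.
  set δ : ℝ := (2 * n + 1 - 2 * l) / 2 with hδ
  have hδ0 : 0 < δ := by rw [hδ]; linarith
  have hδ1 : δ ≤ 1 := by rw [hδ]; linarith
  have hr : -(2 * l) + 2 * (n : ℝ) - δ = δ - 1 := by rw [hδ]; ring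
  have hhalf : (1 / 2 : ℝ) ∈ Ioo (0 : ℝ) 1 := ⟨by norm_num, by norm_num⟩
  have hhalf' : (1 / 2 : ℝ) ∈ Ioc (0 : ℝ) (1 / 2) := ⟨by norm_num, le_rfl⟩
  -- Minus the limit at x = 0 of the remainder of the Wronskian, computed from its value at 1/2; the
  -- integral now converges at 0.
  set F : ℂ → ℂ := fun w => w * (∫ y in (0 : ℝ)..(1 / 2), taylorRemainder θ n w y * θ 0 y) -
    taylorRemainder (wronskianZero θ) (n + 1) w (1 / 2) with hF
  have hbound : ∀ ρ, ∃ C, 0 ≤ C ∧ ∀ w ∈ Metric.closedBall (0 : ℂ) ρ, ∀ x ∈ Ioc (0 : ℝ) (1 / 2),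
      ‖taylorRemainder θ n w x * θ 0 x‖ ≤ C * x ^ (δ - 1) := by
    intro ρ
    obtain ⟨C, hC0, hC⟩ := P.exists_bound_taylorRemainder ρ hδ0 hδ1 n le_rfl
    obtain ⟨C₂, hC₂0, hC₂⟩ := P.norm_taylorRemainder_mul_theta_le hC0 hC
    exact ⟨C₂, hC₂0, fun w hw x hx => hr ▸ hC₂ w hw x hx⟩
  have hFb : ∀ ρ, ∃ A, ∀ w ∈ Metric.closedBall (0 : ℂ) ρ, ‖F w‖ ≤ A := by
    intro ρ
    obtain ⟨C, hC0, hC⟩ := hbound ρ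
    obtain ⟨D, hD⟩ := P.exists_bound_taylorRemainder_wronskian (n + 1) hhalf ρ
    refine ⟨|ρ| * (C / (δ - 1 + 1) * (1 / 2) ^ (δ - 1 + 1)) + D, fun w hw => ?_⟩
    have hw' : ‖w‖ ≤ |ρ| := (mem_closedBall_zero_iff.1 hw).trans (le_abs_self _)
    have h1 : ‖∫ y in (0 : ℝ)..(1 / 2), taylorRemainder θ n w y * θ 0 y‖ ≤
        C / (δ - 1 + 1) * (1 / 2) ^ (δ - 1 + 1) :=
      norm_integral_le_rpow_of_gt (by norm_num) (by linarith) fun y hy => hC w hw y hy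
    refine (norm_sub_le _ _).trans (add_le_add ?_ (hD w hw))
    rw [norm_mul]
    exact mul_le_mul hw' h1 (norm_nonneg _) (abs_nonneg _)
  refine ⟨F, tendstoLocallyUniformlyOn_univ_of_closedBall fun ρ => ?_⟩
  obtain ⟨A, hA⟩ := hFb ρ
  obtain ⟨C, hC0, hC⟩ := P.exists_bound_taylorRemainder ρ hδ0 hδ1 n le_rfl
  obtain ⟨C₁, hC₁0, hC₁⟩ := P.norm_integral_taylorRemainder_mul_phi_le hδ1 hC0 hC
  obtain ⟨C₂, hC₂0, hC₂⟩ := hbound ρ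
  obtain ⟨M, hM0, hM⟩ := P.exists_bound_phi 0
  refine tendstoUniformlyOn_of_norm_sub_le
    (b := fun x => C₁ * x ^ δ + M * (|ρ| * (C₂ / δ * x ^ δ)) + |A| * ‖φt 0 x - 1‖) ?_ ?_
  · have h1 := tendsto_rpow_nhdsGT hδ0
    have h2 : Tendsto (fun x => ‖φt 0 x - 1‖) (𝓝[>] 0) (𝓝 0) :=
      tendsto_iff_norm_sub_tendsto_zero.1 (P.tendsto_phit 0)
    simpa using ((h1.const_mul C₁).add (((h1.const_mul (C₂ / δ)).const_mul |ρ|).const_mul M)).add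
      (h2.const_mul |A|)
  · filter_upwards [Ioc_mem_nhdsGT (show (0 : ℝ) < 1 / 2 by norm_num)] with x hx w hw
    have hx' : x ∈ Ioo (0 : ℝ) 1 := ⟨hx.1, by linarith [hx.2]⟩
    have hw' : ‖w‖ ≤ |ρ| := (mem_closedBall_zero_iff.1 hw).trans (le_abs_self _)
    have hxpos : 0 < x ^ (-(l + 1)) := Real.rpow_pos_of_pos hx.1 _
    have hcont : ContinuousOn (fun y => taylorRemainder θ n w y * θ 0 y) (Ioo 0 1) :=
      (P.continuousOn_taylorRemainder n w).mul (P.continuousOn_theta 0)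
    have hint : IntervalIntegrable (fun y => taylorRemainder θ n w y * θ 0 y) volume 0 (1 / 2) := by
      rw [intervalIntegrable_iff_integrableOn_Ioc_of_le (by norm_num)]
      have i1 : IntegrableOn (fun y : ℝ => C₂ * y ^ (δ - 1)) (Ioc 0 (1 / 2)) := by
        rw [← intervalIntegrable_iff_integrableOn_Ioc_of_le (by norm_num)]
        exact (intervalIntegral.intervalIntegrable_rpow' (by linarith)).const_mul _
      refine Integrable.mono' i1 ((hcont.mono fun y hy =>
        ⟨hy.1, by linarith [hy.2]⟩).aestronglyMeasurable measurableSet_Ioc) ?_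
      filter_upwards [ae_restrict_mem measurableSet_Ioc] with y hy using hC₂ w hw y hy
    have hint2 : IntervalIntegrable (fun y => taylorRemainder θ n w y * θ 0 y) volume 0 x :=
      hint.mono_set (uIcc_subset_uIcc_left (by
        rw [uIcc_of_le (by norm_num)]; exact ⟨hx.1.le, hx.2⟩))
    have hsplit : taylorRemainder (wronskianZero θ) (n + 1) w x =
        w * (∫ y in (0 : ℝ)..x, taylorRemainder θ n w y * θ 0 y) - F w := by
      have h1 := P.taylorRemainder_wronskian_sub n w hx' hhalf
      rw [← intervalIntegral.integral_interval_sub_left hint hint2] at h1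
      simp only [hF]
      linear_combination -h1
    have h2 : ‖∫ y in (0 : ℝ)..x, taylorRemainder θ n w y * θ 0 y‖ ≤ C₂ / δ * x ^ δ := by
      have := norm_integral_le_rpow_of_gt hx.1 (show -1 < δ - 1 by linarith)
        fun y hy => hC₂ w hw y ⟨hy.1, hy.2.trans hx.2⟩
      rwa [sub_add_cancel] at this
    have h3 : ((x ^ (-(l + 1)) : ℝ) : ℂ) * φ 0 x = φt 0 x := by
      rw [P.phi_eq 0 x hx', ← mul_assoc, ← Complex.ofReal_mul, ← Real.rpow_add hx.1]
      simp
    have h4 : ‖φt 0 x‖ ≤ M := by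
      rw [← h3, norm_mul, Complex.norm_real, Real.norm_eq_abs, abs_of_pos hxpos]
      refine (mul_le_mul_of_nonneg_left (hM x hx) hxpos.le).trans_eq ?_
      rw [mul_left_comm, ← Real.rpow_add hx.1]
      simp
    -- The three terms on the right are O(x^δ), O(x^δ) and o(1), uniformly for w in the ball.
    have e : ((x ^ (-(l + 1)) : ℝ) : ℂ) * taylorRemainder θ (n + 1) w x - F w =
        ((x ^ (-(l + 1)) : ℝ) : ℂ) *
          (θ 0 x * (w * ∫ y in (0 : ℝ)..x, taylorRemainder θ n w y * φ 0 y)) -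
        φt 0 x * (w * ∫ y in (0 : ℝ)..x, taylorRemainder θ n w y * θ 0 y) +
          F w * (φt 0 x - 1) := by
      rw [P.taylorRemainder_succ n w hx', hsplit, ← h3]
      ring
    rw [e]
    refine (norm_add_le _ _).trans (add_le_add ((norm_sub_le _ _).trans (add_le_add ?_ ?_)) ?_)
    · rw [norm_mul, Complex.norm_real, Real.norm_eq_abs, abs_of_pos hxpos]
      refine (mul_le_mul_of_nonneg_left (hC₁ w hw x hx) hxpos.le).trans_eq ?_
      rw [mul_left_comm, ← Real.rpow_add hx.1]
      congr 2
      rw [hδ]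
      ring
    · rw [norm_mul, norm_mul]
      exact mul_le_mul h4 (mul_le_mul hw' h2 (norm_nonneg _) (abs_nonneg _)) (by positivity) hM0
    · rw [norm_mul]
      exact mul_le_mul_of_nonneg_right ((hA w hw).trans (le_abs_self A)) (norm_nonneg _)

theorem tendstoLocallyUniformlyOn_mul_phit {F : ℂ → ℂ} (hF : Differentiable ℂ F) :
    TendstoLocallyUniformlyOn (fun x w => F w * φt w x) F (𝓝[>] 0) univ := by
  have hfam : EntireFamily (Ico 0 1) fun w x => F w * φt w x :=
    ⟨(hF.continuous.comp continuous_fst).continuousOn.mul P.phit_fam.cont,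
      fun x hx => hF.mul (P.phit_fam.entire x hx)⟩
  have h := hfam.tendstoLocallyUniformlyOn (x₀ := 0) (by simp)
  simp only [P.phit_zero, mul_one] at h
  intro u hu z hz
  obtain ⟨t, ht, H⟩ := h u hu z hz
  exact ⟨t, ht, H.filter_mono
    (nhdsWithin_le_of_mem (mem_of_superset (Ioo_mem_nhdsGT one_pos) Ioo_subset_Ico_self))⟩

end SolutionPair

/-! ### The entire part F. -/

theorem iteratedDeriv_conj {f : ℂ → ℂ}
    (h : ∀ z, f (starRingEnd ℂ z) = starRingEnd ℂ (f z)) (k : ℕ) (z : ℂ) :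
    iteratedDeriv k f (starRingEnd ℂ z) = starRingEnd ℂ (iteratedDeriv k f z) := by
  induction k generalizing z with
  | zero => simpa using h z
  | succ k ih =>
    have e : (starRingEnd ℂ ∘ iteratedDeriv k f ∘ starRingEnd ℂ) = iteratedDeriv k f := by
      ext z
      simp [ih]
    have := congrFun (deriv_conj_conj (𝕜 := ℂ) (f := iteratedDeriv k f)) z
    rw [e] at this
    rw [iteratedDeriv_succ, this]
    simp

theorem IsPolynomialOfDegreeLE.iteratedDeriv_eq_zero {F : ℂ → ℂ} {n k : ℕ}
    (h : IsPolynomialOfDegreeLE n F) (hk : n < k) (z : ℂ) : iteratedDeriv k F z = 0 := by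
  obtain ⟨Q, hQ, hF⟩ := h
  obtain ⟨j, rfl⟩ : ∃ j, k = j + 1 := ⟨k - 1, by omega⟩
  have hd : Differentiable ℂ F := by
    rw [show F = fun z => Q.eval z from funext hF]
    exact Q.differentiable
  exact (isPolynomialOfDegreeLE_iff hd j).1 ⟨Q, hQ.trans (by omega), hF⟩ z

/-- Fφ equals x^{-l} · x^{2l+1} F φ̃ and 2l + 1 > 0, so subtracting it preserves the normalization
at 0. What is proved for θ therefore also applies to θ - Fφ. -/
theorem IsEntireSystem.sub_mul {l : ℝ} (hl : -(1 / 2) < l) {q : ℝ → ℝ}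
    (hq : IntegrableOn (fun x => x * q x) (Ioo 0 1)) {φ θ : ℂ → ℝ → ℂ}
    (h : IsEntireSystem l q φ θ) {F : ℂ → ℂ} (hF : Differentiable ℂ F) :
    IsEntireSystem l q φ fun z x => θ z x - F z * φ z x := by
  refine ⟨h.phi_sol, fun z => (h.theta_sol z).sub_const_mul (h.phi_sol z) hq _, h.phi_entire,
    fun x hx => (h.theta_entire x hx).sub (hF.mul (h.phi_entire x hx)), h.phi_form, ?_⟩
  obtain ⟨φt, p1, p2, p3, p4⟩ := h.phi_form
  obtain ⟨θt, t1, t2, t3, t4⟩ := h.theta_form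
  have h2l : 0 < 2 * l + 1 := by linarith
  refine ⟨fun z x => θt z x + (-((2 * l + 1) * F z)) * (((x ^ (2 * l + 1) : ℝ) : ℂ) * φt z x),
    fun z x hx => ?_, fun z => ?_, fun z => ?_, ?_⟩
  · rw [t1 z x hx, p1 z x hx, show l + 1 = -l + (2 * l + 1) by ring, Real.rpow_add hx.1]
    have : (2 * l + 1 : ℂ) ≠ 0 := by exact_mod_cast h2l.ne'
    push_cast
    field_simp
    ring
  · simp [t2, Real.zero_rpow h2l.ne']
  · exact (t3 z).add (((MemW11.rpow h2l).mul (p3 z)).const_mul _)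
  · have c1 : Continuous fun p : ℂ × ℝ => ((p.2 ^ (2 * l + 1) : ℝ) : ℂ) :=
      Complex.continuous_ofReal.comp ((Real.continuous_rpow_const h2l.le).comp continuous_snd)
    have c2 : Continuous fun p : ℂ × ℝ => F p.1 := hF.continuous.comp continuous_fst
    exact t4.add (((continuous_const.mul c2).neg.continuousOn).mul (c1.continuousOn.mul p4))

/-- The entire part of a solution `θ`. -/
theorem IsEntireSystem.exists_entirePart {l : ℝ} (hl : -(1 / 2) < l) {q : ℝ → ℝ}
    (hq : IntegrableOn (fun x => x * q x) (Ioo 0 1)) {φ θ : ℂ → ℝ → ℂ}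
    (h : IsEntireSystem l q φ θ) : ∃ F : ℂ → ℂ, Differentiable ℂ F ∧
      (∀ k, nl l < k → ∀ z, Tendsto (fun x : ℝ => ((x ^ (-(l + 1)) : ℝ) : ℂ) *
        zDeriv k (fun z x => θ z x - F z * φ z x) z x) (𝓝[>] 0) (𝓝 0)) ∧
      (IsRealSystem θ → ∀ z, F (starRingEnd ℂ z) = starRingEnd ℂ (F z)) := by
  obtain ⟨φt, θt, P⟩ := h.exists_solutionPair hl hq
  obtain ⟨F, hlim⟩ := P.exists_limit_taylorRemainder
  have hent : ∀ x ∈ Ioo (0 : ℝ) 1, Differentiable ℂ fun w =>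
      ((x ^ (-(l + 1)) : ℝ) : ℂ) * taylorRemainder θ (nl l + 1) w x := fun x hx =>
    (differentiable_taylorRemainder (h.theta_entire x hx) _).const_mul _
  have hI : ∀ᶠ x in 𝓝[>] (0 : ℝ), x ∈ Ioo (0 : ℝ) 1 := Ioo_mem_nhdsGT one_pos
  have hF : Differentiable ℂ F := differentiableOn_univ.1 (hlim.differentiableOn
    (hI.mono fun x hx => (hent x hx).differentiableOn) isOpen_univ)
  refine ⟨F, hF, fun k hk z => ?_, fun hreal z => ?_⟩
  · have hlim2 := P.tendstoLocallyUniformlyOn_mul_phit hF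
    -- After division by x^{l+1}, Fφ also tends to F. The difference tends to 0 locally uniformly,
    -- hence so do its derivatives in w; those of order k > n_l annihilate the Taylor polynomial.
    have hlim3 : TendstoLocallyUniformlyOn (fun x w =>
        ((x ^ (-(l + 1)) : ℝ) : ℂ) * taylorRemainder θ (nl l + 1) w x - F w * φt w x)
        (fun _ => 0) (𝓝[>] 0) univ := by
      refine tendstoLocallyUniformlyOn_univ_of_closedBall fun ρ => ?_
      have h1 := (tendstoLocallyUniformlyOn_iff_forall_isCompact isOpen_univ).1 hlim
        _ (subset_univ _) (isCompact_closedBall (0 : ℂ) ρ)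
      have h2 := (tendstoLocallyUniformlyOn_iff_forall_isCompact isOpen_univ).1 hlim2
        _ (subset_univ _) (isCompact_closedBall (0 : ℂ) ρ)
      simpa using! h1.sub h2
    have hdiff : ∀ x ∈ Ioo (0 : ℝ) 1, Differentiable ℂ fun w =>
        ((x ^ (-(l + 1)) : ℝ) : ℂ) * taylorRemainder θ (nl l + 1) w x - F w * φt w x :=
      fun x hx => (hent x hx).sub (hF.mul (P.phit_fam.entire x ⟨hx.1.le, hx.2⟩))
    have h4 := (hlim3.iteratedDeriv (hI.mono hdiff) k).tendsto_at (mem_univ z)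
    rw [show iteratedDeriv k (fun _ : ℂ => (0 : ℂ)) z = 0 by simp] at h4
    refine h4.congr' ?_
    filter_upwards [hI] with x hx
    set T : ℂ → ℂ := fun w => ((x ^ (-(l + 1)) : ℝ) : ℂ) *
      ∑ j ∈ Finset.range (nl l + 1), w ^ j / j.factorial * zDeriv j θ 0 x with hT
    have hTpoly : IsPolynomialOfDegreeLE (nl l) T := by
      refine ⟨Polynomial.C ((x ^ (-(l + 1)) : ℝ) : ℂ) * ∑ j ∈ Finset.range (nl l + 1),
        Polynomial.C (zDeriv j θ 0 x / j.factorial) * Polynomial.X ^ j, ?_, fun w => ?_⟩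
      · refine (Polynomial.natDegree_C_mul_le _ _).trans
          (Polynomial.natDegree_sum_le_of_forall_le _ _ fun j hj => ?_)
        exact (Polynomial.natDegree_C_mul_X_pow_le _ _).trans
          (Nat.lt_succ_iff.1 (Finset.mem_range.1 hj))
      · simp only [hT, Polynomial.eval_mul, Polynomial.eval_C, Polynomial.eval_finsetSum,
          Polynomial.eval_pow, Polynomial.eval_X]
        congr 1
        refine Finset.sum_congr rfl fun j _ => ?_
        ring
    have e : (fun w => ((x ^ (-(l + 1)) : ℝ) : ℂ) * taylorRemainder θ (nl l + 1) w x -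
        F w * φt w x) =
        (fun w => ((x ^ (-(l + 1)) : ℝ) : ℂ) * (θ w x - F w * φ w x)) - T := by
      ext w
      have h3 : φt w x = ((x ^ (-(l + 1)) : ℝ) : ℂ) * φ w x := by
        rw [P.phi_eq w x hx, ← mul_assoc, ← Complex.ofReal_mul, ← Real.rpow_add hx.1]
        simp
      simp only [taylorRemainder, hT, Pi.sub_apply, h3]
      ring
    have hTd : Differentiable ℂ T := by
      simp only [hT]
      fun_prop
    have hgd : Differentiable ℂ fun w => ((x ^ (-(l + 1)) : ℝ) : ℂ) * (θ w x - F w * φ w x) :=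
      ((h.theta_entire x hx).sub (hF.mul (h.phi_entire x hx))).const_mul _
    rw [e, iteratedDeriv_sub hgd.contDiff.contDiffAt hTd.contDiff.contDiffAt,
      hTpoly.iteratedDeriv_eq_zero hk, sub_zero, iteratedDeriv_const_mul_field]
    rfl
  -- The Taylor polynomial is centred at the real point 0, so its coefficients are real and
  -- conjugation passes to the limit.
  · have h1 := hlim.tendsto_at (mem_univ (starRingEnd ℂ z))
    have h2 := (Complex.continuous_conj.tendsto _).comp (hlim.tendsto_at (mem_univ z))
    refine tendsto_nhds_unique h1 (h2.congr' ?_)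
    filter_upwards [hI] with x hx
    have hz : ∀ k, starRingEnd ℂ (zDeriv k θ 0 x) = zDeriv k θ 0 x := fun k => by
      have := iteratedDeriv_conj (f := fun w => θ w x) (fun w => hreal w x hx) k 0
      rw [map_zero] at this
      exact this.symm
    simp [taylorRemainder, hreal z x hx, hz]

/-! ### The Frobenius coefficients -/

/-- The recursion that the values at 0 obey in `frobeniusCoeff_succ_of_lt` and
`frobeniusCoeff_succ_of_gt`. With division by zero equal to zero it needs no restriction on l. -/
theorem coeffTheta_succ (l : ℝ) (k : ℕ) :
    coeffTheta l (k + 1) = coeffTheta l k / (2 * (2 * l + 1 - 2 * (k + 1))) := by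
  rw [coeffTheta, coeffTheta, ascPochhammer_succ_eval, pow_succ, pow_succ,
    show 2 * (2 * l + 1 - 2 * ((k : ℝ) + 1)) = -(4 * (-l + 1 / 2 + k)) by ring]
  simp only [div_eq_mul_inv, mul_inv, inv_neg]
  ring

theorem coeffPhi_succ (l : ℝ) (k : ℕ) :
    coeffPhi l (k + 1) = -coeffPhi l k / (4 * (l + 3 / 2 + k)) := by
  rw [coeffPhi, coeffPhi, ascPochhammer_succ_eval, pow_succ, pow_succ]
  simp only [div_eq_mul_inv, mul_inv]
  ring

theorem coeffTheta_eq_of_int {l : ℝ} {m : ℕ} (h : l + 1 / 2 = m + 1) :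
    coeffTheta l m = 1 / (4 ^ m * m.factorial) := by
  rw [coeffTheta, show -l + 1 / 2 = -(m : ℝ) by linarith, ascPochhammer_eval_neg_eq_descPochhammer,
    descPochhammer_eval_eq_descFactorial, Nat.descFactorial_self]
  have : ((-1 : ℝ)) ^ m ≠ 0 := pow_ne_zero _ (by norm_num)
  field_simp

/-- Here l = m + 1/2, so 4^l = 2 · 4^m and Γ(l + 1/2) = m!. The right-hand side is the coefficient
of the first logarithm in `frobeniusCoeff_succ_of_eq`. -/
theorem coeffLog_self {l : ℝ} {m : ℕ} (h : l + 1 / 2 = m + 1) (hn : nl l = m + 1) :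
    coeffLog l (m + 1) = -coeffTheta l m / 2 := by
  have e : (4 : ℝ) ^ l = 4 ^ m * 2 := by
    rw [show l = (m : ℝ) + 1 / 2 by linarith, Real.rpow_add (by norm_num), Real.rpow_natCast,
      ← Real.sqrt_eq_rpow, show (4 : ℝ) = 2 ^ 2 by norm_num, Real.sqrt_sq (by norm_num)]
  rw [coeffLog, coeffTheta_eq_of_int h, hn, h, Real.Gamma_nat_eq_factorial, e]
  simp only [Nat.choose_self, Nat.sub_self, coeffPhi]
  simp
  ring

/-- For 2l + 1 = 2n_l and k = n_l + i the factor 1/(2(2l + 1 - 2(k + 1))) of `coeffTheta_succ` is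
-1/(4(i + 1)). -/
theorem coeffLog_succ {l : ℝ} {i : ℕ} (h : l + 1 / 2 = nl l) :
    coeffLog l (nl l + i + 1) = -coeffLog l (nl l + i) / (4 * (i + 1)) := by
  set n := nl l with hn
  have h1 := Nat.choose_mul_succ_eq (n + i) n
  rw [show n + i + 1 - n = i + 1 by omega] at h1
  have h2 : ((n + i + 1).choose n : ℝ) = (n + i).choose n * (n + i + 1) / (i + 1) := by
    have : ((n + i).choose n : ℝ) * (n + i + 1) = (n + i + 1).choose n * (i + 1) := by
      exact_mod_cast h1
    have h3 : (i : ℝ) + 1 ≠ 0 := by positivity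
    field_simp
    linarith
  rw [coeffLog, coeffLog, ← hn, show n + i + 1 - n = i + 1 by omega, show n + i - n = i by omega,
    h2, coeffPhi_succ, show l + 3 / 2 + i = (n : ℝ) + i + 1 by linarith]
  have h3 : (i : ℝ) + 1 ≠ 0 := by positivity
  have h4 : (n : ℝ) + i + 1 ≠ 0 := by positivity
  field_simp

/-- The Frobenius coefficients `(2l+1) x^{l-2k} θ^{(k)}(z,x)`. -/
noncomputable def frobeniusCoeff (l : ℝ) (θ : ℂ → ℝ → ℂ) (k : ℕ) (z : ℂ) (x : ℝ) : ℂ :=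
  (((2 * l + 1) * x ^ (l - 2 * k) : ℝ) : ℂ) * zDeriv k θ z x

/-- Negligible with respect to every negative power at `0`. -/
def IsSubpower (c : ℝ → ℂ) : Prop :=
  ∀ ε : ℝ, 0 < ε → Tendsto (fun x : ℝ => ((x ^ ε : ℝ) : ℂ) * c x) (𝓝[>] 0) (𝓝 0)

theorem IsSubpower.of_tendsto {c : ℝ → ℂ} {a : ℂ} (h : Tendsto c (𝓝[>] 0) (𝓝 a)) :
    IsSubpower c := fun ε hε => by
  have := ((Complex.continuous_ofReal.tendsto 0).comp (tendsto_rpow_nhdsGT hε)).mul h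
  simpa using! this

theorem IsSubpower.of_tendsto_div_log {c : ℝ → ℂ} {a : ℂ}
    (h : Tendsto (fun x => c x / (Real.log x : ℂ)) (𝓝[>] 0) (𝓝 a)) : IsSubpower c := fun ε hε => by
  have h1 : Tendsto (fun x : ℝ => ((Real.log x * x ^ ε : ℝ) : ℂ)) (𝓝[>] 0) (𝓝 0) := by
    have := (Complex.continuous_ofReal.tendsto 0).comp (tendsto_log_mul_rpow_nhdsGT_zero hε)
    rwa [Complex.ofReal_zero] at this
  have h2 := h1.mul h
  rw [zero_mul] at h2
  refine h2.congr' ?_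
  filter_upwards [Ioo_mem_nhdsGT one_pos] with x hx
  have : (Real.log x : ℂ) ≠ 0 := by exact_mod_cast (Real.log_neg hx.1 hx.2).ne
  push_cast
  field_simp

/-- Half of the margin r + 1 is spent on c, which leaves the integrable power (r - 1)/2. -/
theorem intervalIntegrable_zero_of_isSubpower {f c : ℝ → ℂ} (hf : ContinuousOn f (Ioo 0 1)) {r : ℝ}
    (hr : -1 < r) (hc : IsSubpower c) (h : ∀ x ∈ Ioo (0 : ℝ) 1, f x = ((x ^ r : ℝ) : ℂ) * c x)
    {b : ℝ} (hb : b ∈ Ioo (0 : ℝ) 1) : IntervalIntegrable f volume 0 b := by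
  set ε := (r + 1) / 2 with hε
  have h1 : ∀ᶠ x in 𝓝[>] (0 : ℝ), ‖((x ^ ε : ℝ) : ℂ) * c x‖ ≤ 1 := by
    have := (hc ε (by rw [hε]; linarith)).norm
    rw [norm_zero] at this
    exact this.eventually_le_const one_pos
  obtain ⟨d, hd, H⟩ := eventually_nhdsGT_zero_iff.1 (h1.and (Ioo_mem_nhdsGT hb.1))
  have hdI : d ∈ Ioo (0 : ℝ) 1 := ⟨hd, (H d hd le_rfl).2.2.trans hb.2⟩
  have i1 : IntervalIntegrable f volume 0 d := by
    rw [intervalIntegrable_iff_integrableOn_Ioc_of_le hd.le]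
    have i0 : IntegrableOn (fun y : ℝ => y ^ (r - ε)) (Ioc 0 d) := by
      rw [← intervalIntegrable_iff_integrableOn_Ioc_of_le hd.le]
      exact intervalIntegral.intervalIntegrable_rpow' (by rw [hε]; linarith)
    refine Integrable.mono' i0 ((hf.mono fun y hy =>
        ⟨hy.1, hy.2.trans_lt hdI.2⟩).aestronglyMeasurable measurableSet_Ioc) ?_
    filter_upwards [ae_restrict_mem measurableSet_Ioc] with y hy
    rw [h y ⟨hy.1, hy.2.trans_lt hdI.2⟩, show r = (r - ε) + ε by ring, Real.rpow_add hy.1,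
      Complex.ofReal_mul, mul_assoc, norm_mul, Complex.norm_real, Real.norm_eq_abs,
      abs_of_nonneg (Real.rpow_nonneg hy.1.le _)]
    rw [show r - ε + ε - ε = r - ε by ring]
    exact mul_le_of_le_one_right (Real.rpow_nonneg hy.1.le _) (H y hy.1 hy.2).1
  exact i1.trans (hf.mono (ordConnected_Ioo.uIcc_subset hdI hb)).intervalIntegrable

namespace SolutionPair

variable {l : ℝ} {φ θ φt θt : ℂ → ℝ → ℂ} (P : SolutionPair l φ θ φt θt)
include P

theorem zDeriv_eq_frobeniusCoeff (k : ℕ) (z : ℂ) {x : ℝ} (hx : 0 < x) :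
    zDeriv k θ z x = ((x ^ (2 * k - l) / (2 * l + 1) : ℝ) : ℂ) * frobeniusCoeff l θ k z x := by
  rw [frobeniusCoeff, ← mul_assoc, ← Complex.ofReal_mul]
  have : x ^ (2 * k - l) / (2 * l + 1) * ((2 * l + 1) * x ^ (l - 2 * k)) = 1 := by
    rw [show 2 * (k : ℝ) - l = -(l - 2 * k) by ring, Real.rpow_neg hx.le]
    have key : ∀ A B : ℝ, A ≠ 0 → B ≠ 0 → A⁻¹ / B * (B * A) = 1 := fun A B hA hB => by field_simp
    exact key _ _ (Real.rpow_pos_of_pos hx (l - 2 * k)).ne' P.two_l_pos.ne'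
  rw [this]
  simp

theorem zDeriv_mul_phi_eq_frobeniusCoeff (k : ℕ) (z : ℂ) {x : ℝ} (hx : x ∈ Ioo (0 : ℝ) 1) :
    zDeriv k θ z x * φ z x = (2 * l + 1 : ℂ)⁻¹ *
      (((x ^ (2 * ((k + 1 : ℕ) : ℝ) - 1) : ℝ) : ℂ) * (frobeniusCoeff l θ k z x * φt z x)) := by
  rw [P.zDeriv_eq_frobeniusCoeff k z hx.1, P.phi_eq z x hx,
    show 2 * ((k + 1 : ℕ) : ℝ) - 1 = (2 * k - l) + (l + 1) by push_cast; ring,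
    Real.rpow_add hx.1 (2 * k - l) (l + 1)]
  push_cast
  ring

theorem zDeriv_mul_theta_eq_frobeniusCoeff (k : ℕ) (z : ℂ) {x : ℝ} (hx : x ∈ Ioo (0 : ℝ) 1) :
    zDeriv k θ z x * θ z x = ((2 * l + 1 : ℂ) ^ 2)⁻¹ *
      (((x ^ (2 * ((k + 1 : ℕ) : ℝ) - (2 * l + 1) - 1) : ℝ) : ℂ) *
        (frobeniusCoeff l θ k z x * θt z x)) := by
  rw [P.zDeriv_eq_frobeniusCoeff k z hx.1, P.theta_eq z x hx,
    show 2 * ((k + 1 : ℕ) : ℝ) - (2 * l + 1) - 1 = (2 * k - l) + (-l) by push_cast; ring,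
    Real.rpow_add hx.1]
  push_cast
  rw [← inv_pow]
  ring

theorem frobeniusCoeff_zero (z : ℂ) {x : ℝ} (hx : x ∈ Ioo (0 : ℝ) 1) :
    frobeniusCoeff l θ 0 z x = θt z x := by
  rw [frobeniusCoeff, zDeriv_zero, P.theta_eq z x hx, ← mul_assoc, ← Complex.ofReal_mul]
  have : (2 * l + 1) * x ^ (l - 2 * (0 : ℕ)) * (x ^ (-l) / (2 * l + 1)) = 1 := by
    rw [Real.rpow_neg hx.1.le]
    have := P.two_l_pos
    have := Real.rpow_pos_of_pos hx.1 l
    simp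
    field_simp
  rw [this]
  simp

/-- `zDeriv_expansion` in scaled form. The integral becomes a Hardy mean of exponent 2(k+1), while
the Wronskian carries the power 2l + 1 - 2(k+1), whose sign separates the three cases of the
recursion. -/
theorem frobeniusCoeff_succ (k : ℕ) (z : ℂ) {x : ℝ} (hx : x ∈ Ioo (0 : ℝ) 1) :
    frobeniusCoeff l θ (k + 1) z x =
      ((k : ℂ) + 1) / (2 * l + 1) * (θt z x * (((x ^ (-(2 * ((k + 1 : ℕ) : ℝ))) : ℝ) : ℂ) *
        ∫ y in (0 : ℝ)..x, ((y ^ (2 * ((k + 1 : ℕ) : ℝ) - 1) : ℝ) : ℂ) *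
          (frobeniusCoeff l θ k z y * φt z y))) -
      (2 * l + 1) * (φt z x * (((x ^ (2 * l + 1 - 2 * ((k + 1 : ℕ) : ℝ)) : ℝ) : ℂ) *
        wronskianDeriv θ (k + 1) z x)) := by
  have e : ∫ y in (0 : ℝ)..x, zDeriv k θ z y * φ z y = (2 * l + 1 : ℂ)⁻¹ *
      ∫ y in (0 : ℝ)..x, ((y ^ (2 * ((k + 1 : ℕ) : ℝ) - 1) : ℝ) : ℂ) *
          (frobeniusCoeff l θ k z y * φt z y) := by
    rw [← intervalIntegral.integral_const_mul]
    refine intervalIntegral.integral_congr_uIoo fun y hy => ?_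
    rw [uIoo_of_le hx.1.le] at hy
    exact P.zDeriv_mul_phi_eq_frobeniusCoeff k z ⟨hy.1, hy.2.trans hx.2⟩
  rw [frobeniusCoeff, P.zDeriv_expansion (by omega) z hx, Nat.add_sub_cancel, e, P.theta_eq z x hx,
    P.phi_eq z x hx]
  have h0 := P.two_l_ne
  have h1 := (Real.rpow_pos_of_pos hx.1 l).ne'
  rw [show l - 2 * ((k + 1 : ℕ) : ℝ) = l + -(2 * ((k + 1 : ℕ) : ℝ)) by ring,
    show 2 * l + 1 - 2 * ((k + 1 : ℕ) : ℝ) = l + ((l + 1) + -(2 * ((k + 1 : ℕ) : ℝ))) by ring,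
    Real.rpow_add hx.1 l (-(2 * ((k + 1 : ℕ) : ℝ))),
    Real.rpow_add hx.1 l (l + 1 + -(2 * ((k + 1 : ℕ) : ℝ))),
    Real.rpow_add hx.1 (l + 1) (-(2 * ((k + 1 : ℕ) : ℝ))), Real.rpow_neg hx.1.le l]
  have h2 : ((x ^ l : ℝ) : ℂ) ≠ 0 := by exact_mod_cast h1
  push_cast
  field_simp

theorem wronskianDeriv_succ_sub (k : ℕ) (z : ℂ) {a b : ℝ} (ha : a ∈ Ioo (0 : ℝ) 1)
    (hb : b ∈ Ioo (0 : ℝ) 1) :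
    wronskianDeriv θ (k + 1) z b - wronskianDeriv θ (k + 1) z a =
      ((k : ℂ) + 1) / (2 * l + 1) ^ 2 *
        ∫ y in a..b, ((y ^ (2 * ((k + 1 : ℕ) : ℝ) - (2 * l + 1) - 1) : ℝ) : ℂ) *
          (frobeniusCoeff l θ k z y * θt z y) := by
  have e : ∫ y in a..b, zDeriv k θ z y * θ z y = ((2 * l + 1 : ℂ) ^ 2)⁻¹ *
      ∫ y in a..b, ((y ^ (2 * ((k + 1 : ℕ) : ℝ) - (2 * l + 1) - 1) : ℝ) : ℂ) *
          (frobeniusCoeff l θ k z y * θt z y) := by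
    rw [← intervalIntegral.integral_const_mul]
    refine intervalIntegral.integral_congr fun y hy => ?_
    exact P.zDeriv_mul_theta_eq_frobeniusCoeff k z (ordConnected_Ioo.uIcc_subset ha hb hy)
  rw [P.wronskianDeriv_sub _ z ha hb, Nat.add_sub_cancel, e]
  push_cast
  ring

theorem continuousOn_frobeniusCoeff (k : ℕ) (z : ℂ) :
    ContinuousOn (frobeniusCoeff l θ k z) (Ioo 0 1) := by
  refine ContinuousOn.mul ?_ (P.continuousOn_zDeriv_theta k z)
  simp only [Complex.ofReal_mul]
  exact continuousOn_const.mul ((continuousOn_ofReal_rpow _).mono fun x hx => hx.1)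

theorem tendsto_rpow_mul_zDeriv {k : ℕ} {r : ℝ} (hr : 0 < r + (2 * k - l)) {z : ℂ}
    (hc : IsSubpower (frobeniusCoeff l θ k z)) :
    Tendsto (fun x : ℝ => ((x ^ r : ℝ) : ℂ) * zDeriv k θ z x) (𝓝[>] 0) (𝓝 0) := by
  have := (hc _ hr).const_mul ((2 * l + 1 : ℂ)⁻¹)
  rw [mul_zero] at this
  refine this.congr' ?_
  filter_upwards [Ioo_mem_nhdsGT one_pos] with x hx
  rw [P.zDeriv_eq_frobeniusCoeff k z hx.1, Real.rpow_add hx.1]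
  push_cast
  ring

/-- The integrand is o(x^{l-1}) · O(x^{l+1}) = o(x^{2l}). -/
theorem tendsto_rpow_mul_integral_zDeriv {k : ℕ} {z : ℂ}
    (h : Tendsto (fun x : ℝ => ((x ^ (1 - l) : ℝ) : ℂ) * zDeriv k θ z x) (𝓝[>] 0) (𝓝 0)) :
    Tendsto (fun x : ℝ => ((x ^ (-(2 * l + 1)) : ℝ) : ℂ) *
      ∫ y in (0 : ℝ)..x, zDeriv k θ z y * φ z y) (𝓝[>] 0) (𝓝 0) := by
  have := tendsto_rpow_mul_integral P.two_l_pos (b := 1 / 2) ⟨by norm_num, by norm_num⟩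
    (P.intervalIntegrable_zDeriv_mul_phi k z z (by simp) ⟨by norm_num, by norm_num⟩)
    ((P.continuousOn_zDeriv_theta k z).mul (P.continuousOn_phi z)) (L := 0) ?_
  · simpa using this
  · have h1 := h.mul (P.tendsto_phit z)
    rw [zero_mul] at h1
    refine h1.congr' ?_
    filter_upwards [Ioo_mem_nhdsGT one_pos] with x hx
    rw [P.phi_eq z x hx, show 1 - l = (1 - (2 * l + 1)) + (l + 1) by ring, Real.rpow_add hx.1]
    push_cast
    ring

/-- `zDeriv_expansion` is solved for the Wronskian. The quotient θ/φ is of order x^{-(2l+1)}, so by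
`tendsto_rpow_mul_integral_zDeriv` the term with θ disappears. -/
theorem tendsto_wronskianDeriv {k : ℕ} {z a : ℂ}
    (h : Tendsto (fun x : ℝ => ((x ^ (1 - l) : ℝ) : ℂ) * zDeriv k θ z x) (𝓝[>] 0) (𝓝 0))
    (hlim : Tendsto (fun x : ℝ => ((x ^ (-(l + 1)) : ℝ) : ℂ) * zDeriv (k + 1) θ z x) (𝓝[>] 0)
      (𝓝 a)) :
    Tendsto (wronskianDeriv θ (k + 1) z) (𝓝[>] 0) (𝓝 (-a)) := by
  have h1 := (((((P.tendsto_rpow_mul_integral_zDeriv h).mul (P.tendsto_thetat z)).const_mul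
    (((k : ℂ) + 1) / (2 * l + 1))).sub hlim).div (P.tendsto_phit z) one_ne_zero)
  rw [zero_mul, mul_zero, zero_sub, div_one] at h1
  refine h1.congr' ?_
  filter_upwards [Ioo_mem_nhdsGT one_pos, (P.tendsto_phit z).eventually_ne one_ne_zero] with x hx hφ
  simp only [Pi.div_apply]
  rw [P.zDeriv_expansion (by omega) z hx, Nat.add_sub_cancel, P.theta_eq z x hx, P.phi_eq z x hx,
    show -(2 * l + 1) = -(l + 1) + -l by ring, Real.rpow_add hx.1, Real.rpow_neg hx.1.le (l + 1)]
  have h2 : ((x ^ (l + 1) : ℝ) : ℂ) ≠ 0 := by exact_mod_cast (Real.rpow_pos_of_pos hx.1 _).ne'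
  have h0 := P.two_l_ne
  push_cast
  field_simp
  ring

/-- The hypothesis `hlim` makes the Wronskian vanish at 0, and `hk` makes its x-derivative
integrable there. -/
theorem wronskianDeriv_eq_integral {k : ℕ} (hk : 2 * l + 1 < 2 * (k + 1 : ℕ)) {z : ℂ}
    (hc : IsSubpower (frobeniusCoeff l θ k z))
    (hlim : Tendsto (fun x : ℝ => ((x ^ (-(l + 1)) : ℝ) : ℂ) * zDeriv (k + 1) θ z x) (𝓝[>] 0)
      (𝓝 0)) {x : ℝ} (hx : x ∈ Ioo (0 : ℝ) 1) :
    IntervalIntegrable (fun y => ((y ^ (2 * ((k + 1 : ℕ) : ℝ) - (2 * l + 1) - 1) : ℝ) : ℂ) *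
          (frobeniusCoeff l θ k z y * θt z y)) volume 0 x ∧
    wronskianDeriv θ (k + 1) z x = ((k : ℂ) + 1) / (2 * l + 1) ^ 2 *
        ∫ y in (0 : ℝ)..x, ((y ^ (2 * ((k + 1 : ℕ) : ℝ) - (2 * l + 1) - 1) : ℝ) : ℂ) *
          (frobeniusCoeff l θ k z y * θt z y) := by
  have hJ := P.tendsto_wronskianDeriv (P.tendsto_rpow_mul_zDeriv (by push_cast at hk; linarith) hc) hlim
  rw [neg_zero] at hJ
  set G : ℝ → ℂ := fun y => ((y ^ (2 * ((k + 1 : ℕ) : ℝ) - (2 * l + 1) - 1) : ℝ) : ℂ) *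
          (frobeniusCoeff l θ k z y * θt z y) with hG
  have hGc : ContinuousOn G (Ioo 0 1) :=
    continuousOn_rpow_mul _ (fun x hx => hx.1) ((P.continuousOn_frobeniusCoeff k z).mul
      ((P.thetat_fam.mono Ioo_subset_Ico_self).continuousOn_right z))
  have hcθ : IsSubpower fun y => frobeniusCoeff l θ k z y * θt z y := fun ε hε => by
    have := (hc ε hε).mul (P.tendsto_thetat z)
    rw [zero_mul] at this
    simpa only [mul_assoc] using this
  have hi : ∀ x ∈ Ioo (0 : ℝ) 1, IntervalIntegrable G volume 0 x := fun x hx =>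
    intervalIntegrable_zero_of_isSubpower hGc (by linarith) hcθ (fun _ _ => rfl) hx
  refine ⟨hi x hx, ?_⟩
  have hc0 : Tendsto (fun y => ∫ t in (0 : ℝ)..y, G t) (𝓝[>] 0) (𝓝 0) := by
    have h1 := intervalIntegral.continuousOn_primitive_interval' (hi x hx) left_mem_uIcc
    rw [uIcc_of_le hx.1.le] at h1
    have h2 := (h1 0 ⟨le_rfl, hx.1.le⟩).tendsto.mono_left (nhdsWithin_le_of_mem
      (mem_of_superset (Ioc_mem_nhdsGT hx.1) Ioc_subset_Icc_self))
    simpa using h2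
  have h3 : Tendsto (fun y => wronskianDeriv θ (k + 1) z y -
      ((k : ℂ) + 1) / (2 * l + 1) ^ 2 * ∫ t in (0 : ℝ)..y, G t) (𝓝[>] 0) (𝓝 0) := by
    simpa using hJ.sub (hc0.const_mul (((k : ℂ) + 1) / (2 * l + 1) ^ 2))
  have h4 : Tendsto (fun y => wronskianDeriv θ (k + 1) z y -
      ((k : ℂ) + 1) / (2 * l + 1) ^ 2 * ∫ t in (0 : ℝ)..y, G t) (𝓝[>] 0)
      (𝓝 (wronskianDeriv θ (k + 1) z x -
        ((k : ℂ) + 1) / (2 * l + 1) ^ 2 * ∫ t in (0 : ℝ)..x, G t)) := by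
    refine tendsto_const_nhds.congr' ?_
    filter_upwards [Ioo_mem_nhdsGT one_pos] with y hy
    have h5 := P.wronskianDeriv_succ_sub k z hy hx
    rw [← hG, ← intervalIntegral.integral_interval_sub_left (hi x hx) (hi y hy)] at h5
    linear_combination h5
  linear_combination tendsto_nhds_unique h4 h3

end SolutionPair

/-- A mean of a function with logarithmic growth. -/
theorem tendsto_lowerMean_div_log {p : ℝ} (hp : 0 < p) {h : ℝ → ℂ} {C : ℂ}
    (hc : ContinuousOn h (Ioo 0 1)) {b : ℝ} (hb : b ∈ Ioo (0 : ℝ) 1)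
    (hi : IntervalIntegrable (fun y => ((y ^ (p - 1) : ℝ) : ℂ) * h y) volume 0 b)
    (hC : Tendsto (fun x => h x / (Real.log x : ℂ)) (𝓝[>] 0) (𝓝 C)) :
    Tendsto (fun x => ((x ^ (-p) : ℝ) : ℂ) * (∫ y in (0 : ℝ)..x, ((y ^ (p - 1) : ℝ) : ℂ) * h y) /
      (Real.log x : ℂ)) (𝓝[>] 0) (𝓝 (C / p)) := by
  have hkc : ContinuousOn (fun y => ((y ^ (p - 1) : ℝ) : ℂ) * h y) (Ioo 0 1) :=
    continuousOn_rpow_mul _ (fun x hx => hx.1) hc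
  have hc0 : Tendsto (fun x => ∫ y in (0 : ℝ)..x, ((y ^ (p - 1) : ℝ) : ℂ) * h y) (𝓝[>] 0)
      (𝓝 0) := by
    have h1 := intervalIntegral.continuousOn_primitive_interval' hi left_mem_uIcc
    rw [uIcc_of_le hb.1.le] at h1
    have h2 := (h1 0 ⟨le_rfl, hb.1.le⟩).tendsto.mono_left (nhdsWithin_le_of_mem
      (mem_of_superset (Ioc_mem_nhdsGT hb.1) Ioc_subset_Icc_self))
    simpa using h2
  have hI : ∀ᶠ x in 𝓝[>] (0 : ℝ), x ∈ Ioo (0 : ℝ) 1 := Ioo_mem_nhdsGT one_pos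
  have hlog : ∀ᶠ x in 𝓝[>] (0 : ℝ), Real.log x < -(1 / p) :=
    Real.tendsto_log_nhdsGT_zero.eventually_lt_atBot _
  have hinv : Tendsto (fun x => (((p + 1 / Real.log x : ℝ)) : ℂ)) (𝓝[>] 0) (𝓝 (p : ℂ)) := by
    have h1 : Tendsto (fun x => p + 1 / Real.log x) (𝓝[>] 0) (𝓝 p) := by
      have := (Real.tendsto_log_nhdsGT_zero.inv_tendsto_atBot).const_add p
      simpa [one_div] using! this
    exact (Complex.continuous_ofReal.tendsto p).comp h1
  -- The comparison function -x^p log x is positive near 0, and increasing once log x < -1/p; its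
  -- sign accounts for the sign of the limit.
  have main := tendsto_div_of_deriv_zero (L := -(C / p))
    (f := fun x => ∫ y in (0 : ℝ)..x, ((y ^ (p - 1) : ℝ) : ℂ) * h y)
    (f' := fun y => ((y ^ (p - 1) : ℝ) : ℂ) * h y)
    (g := fun x => -(x ^ p * Real.log x))
    (g' := fun x => -(p * x ^ (p - 1) * Real.log x + x ^ p * x⁻¹))
    (by
      filter_upwards [Ioo_mem_nhdsGT hb.1] with x hx
      refine hasDerivAt_integral_of_continuousOn hkc ⟨hx.1, hx.2.trans hb.2⟩
        (hi.mono_set (uIcc_subset_uIcc_left ?_))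
      rw [uIcc_of_le hb.1.le]; exact ⟨hx.1.le, hx.2.le⟩)
    (by
      filter_upwards [hI] with x hx
      exact ((Real.hasDerivAt_rpow_const (Or.inl hx.1.ne')).mul (Real.hasDerivAt_log hx.1.ne')).neg)
    (by
      filter_upwards [hI, hlog] with x hx h1
      rw [← Real.rpow_neg_one x, ← Real.rpow_add hx.1, ← sub_eq_add_neg]
      have h2 := Real.rpow_pos_of_pos hx.1 (p - 1)
      have h3 : p * Real.log x + 1 < 0 := by
        have := mul_lt_mul_of_pos_left h1 hp
        rw [mul_neg, mul_one_div_cancel hp.ne'] at this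
        linarith
      nlinarith)
    hc0
    (by
      have := (tendsto_log_mul_rpow_nhdsGT_zero hp).neg
      rw [neg_zero] at this
      exact this.congr fun x => by ring)
    (by
      filter_upwards [hI] with x hx
      have := mul_neg_of_pos_of_neg (Real.rpow_pos_of_pos hx.1 p) (Real.log_neg hx.1 hx.2)
      linarith)
    (by
      refine ((hC.div hinv (by exact_mod_cast hp.ne')).neg).congr' ?_
      filter_upwards [hI, hlog] with x hx h1
      have h2 : ((x ^ (p - 1) : ℝ) : ℂ) ≠ 0 := by exact_mod_cast (Real.rpow_pos_of_pos hx.1 _).ne'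
      have h3 : (Real.log x : ℂ) ≠ 0 := by exact_mod_cast (Real.log_neg hx.1 hx.2).ne
      have h4 : (p : ℂ) * (Real.log x : ℂ) + 1 ≠ 0 := by
        have : p * Real.log x + 1 < 0 := by
          have := mul_lt_mul_of_pos_left h1 hp
          rw [mul_neg, mul_one_div_cancel hp.ne'] at this
          linarith
        exact_mod_cast this.ne
      rw [← Real.rpow_neg_one x, ← Real.rpow_add hx.1, ← sub_eq_add_neg]
      simp only [Pi.div_apply]
      push_cast
      rw [show -((p : ℂ) * ((x ^ (p - 1) : ℝ) : ℂ) * (Real.log x : ℂ) + ((x ^ (p - 1) : ℝ) : ℂ)) =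
        -((x ^ (p - 1) : ℝ) : ℂ) * (p * (Real.log x : ℂ) + 1) by ring,
        show (p : ℂ) + 1 / (Real.log x : ℂ) = (p * (Real.log x : ℂ) + 1) / (Real.log x : ℂ) by
          field_simp]
      field_simp)
  have main2 := main.neg
  rw [neg_neg] at main2
  refine main2.congr' ?_
  filter_upwards [hI] with x hx
  have h3 : (Real.log x : ℂ) ≠ 0 := by exact_mod_cast (Real.log_neg hx.1 hx.2).ne
  have h2 : ((x ^ p : ℝ) : ℂ) ≠ 0 := by exact_mod_cast (Real.rpow_pos_of_pos hx.1 _).ne'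
  rw [Real.rpow_neg hx.1.le]
  push_cast
  field_simp

/-- For A = 2l + 1 and B = k + 1: the two Hardy means contribute C/(2B) and C/(A - 2B) at 0, and
together they give the factor of `coeffTheta_succ`. -/
theorem div_mul_div_two_mul_add {A B : ℂ} (hA : A ≠ 0) (hB : B ≠ 0) (h : A - 2 * B ≠ 0) (C : ℂ) :
    B / A * (C / (2 * B)) + B / A * (C / (A - 2 * B)) = C / (2 * (A - 2 * B)) := by
  rw [div_mul_div_comm, div_mul_div_comm, div_add_div _ _ (by simp [hA, hB]) (mul_ne_zero hA h),
    div_eq_div_iff (by simp [hA, hB, h]) (by simp [h])]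
  ring

theorem div_mul_div_two_mul_sub {A B : ℂ} (hA : A ≠ 0) (hB : B ≠ 0) (h : 2 * B - A ≠ 0) (C : ℂ) :
    B / A * (C / (2 * B)) - B / A * (C / (2 * B - A)) = C / (2 * (A - 2 * B)) := by
  have h' : A - 2 * B ≠ 0 := fun e => h (by linear_combination -e)
  rw [← div_mul_div_two_mul_add hA hB h', ← neg_sub A (2 * B), div_neg]
  ring

theorem tendsto_integral_inv_div_log {h : ℝ → ℂ} (hh : ContinuousOn h (Icc 0 1)) :
    Tendsto (fun x => (∫ y in x..1, ((y ^ (-1 : ℝ) : ℝ) : ℂ) * h y) / (Real.log x : ℂ)) (𝓝[>] 0)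
      (𝓝 (-h 0)) := by
  have := tendsto_div_of_deriv_atTop (L := h 0)
      (f := fun x => ∫ y in x..1, ((y ^ (-1 : ℝ) : ℝ) : ℂ) * h y)
      (f' := fun x => -(((x ^ (-1 : ℝ) : ℝ) : ℂ) * h x))
      (g := fun x => -Real.log x) (g' := fun x => -x⁻¹)
      (by filter_upwards [Ioo_mem_nhdsGT one_pos] with x hx using
        hasDerivAt_integral_rpow_mul _ hh hx)
      (by filter_upwards [self_mem_nhdsWithin] with x hx using
        (Real.hasDerivAt_log (ne_of_gt hx)).neg)
      (by
        filter_upwards [self_mem_nhdsWithin] with x hx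
        exact neg_neg_of_pos (inv_pos.2 hx))
      (tendsto_neg_atBot_atTop.comp Real.tendsto_log_nhdsGT_zero)
      (by
        refine (tendsto_nhdsGT_of_continuousOn hh).congr' ?_
        filter_upwards [self_mem_nhdsWithin] with x hx
        have : (x : ℂ) ≠ 0 := by exact_mod_cast (ne_of_gt hx)
        rw [Real.rpow_neg_one]
        push_cast
        field_simp)
  refine this.neg.congr fun x => ?_
  push_cast
  rw [div_neg, neg_neg]

/-! ### Recursion for the Frobenius coefficients. -/

namespace SolutionPair

variable {l : ℝ} {φ θ φt θt : ℂ → ℝ → ℂ} (P : SolutionPair l φ θ φt θt)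
include P

omit P in
theorem integral_congr_coeff {c f : ℝ → ℂ} (h : ∀ x ∈ Ioo (0 : ℝ) 1, c x = f x) {g : ℝ → ℂ} (r : ℝ)
    {a b : ℝ} (ha : 0 ≤ a) (hb : b ≤ 1) (hab : a ≤ b) :
    ∫ y in a..b, ((y ^ r : ℝ) : ℂ) * (f y * g y) = ∫ y in a..b, ((y ^ r : ℝ) : ℂ) * (c y * g y) := by
  refine intervalIntegral.integral_congr_uIoo fun y hy => ?_
  rw [uIoo_of_le hab] at hy
  rw [h y ⟨ha.trans_lt hy.1, hy.2.trans_le hb⟩]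

/-- For `2k ≤ 2l+1` the spectral derivative of the Wronskian is an integral up to `1`. -/
theorem exists_wronskianDeriv_eq (k : ℕ) (z : ℂ) {c : ℝ → ℂ} (hc : MemW11 c)
    (hcf : ∀ x ∈ Ioo (0 : ℝ) 1, c x = frobeniusCoeff l θ k z x) :
    ∃ κ : ℂ, ∀ x ∈ Ioo (0 : ℝ) 1, wronskianDeriv θ (k + 1) z x = κ -
      ((k : ℂ) + 1) / (2 * l + 1) ^ 2 *
        ∫ y in x..1, ((y ^ (-(2 * l + 1 - 2 * ((k + 1 : ℕ) : ℝ)) - 1) : ℝ) : ℂ) *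
          (c y * θt z y) := by
  have hr : -(2 * l + 1 - 2 * ((k + 1 : ℕ) : ℝ)) - 1 = 2 * ((k + 1 : ℕ) : ℝ) - (2 * l + 1) - 1 := by
    ring
  rw [hr]
  set r := 2 * ((k + 1 : ℕ) : ℝ) - (2 * l + 1) - 1
  set U : ℝ → ℂ := fun x => ∫ y in x..1, ((y ^ r : ℝ) : ℂ) * (c y * θt z y) with hU
  have hhalf : (1 / 2 : ℝ) ∈ Ioo (0 : ℝ) 1 := ⟨by norm_num, by norm_num⟩
  refine ⟨wronskianDeriv θ (k + 1) z (1 / 2) + ((k : ℂ) + 1) / (2 * l + 1) ^ 2 * U (1 / 2),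
    fun x hx => ?_⟩
  have h1 := P.wronskianDeriv_succ_sub k z hx hhalf
  have h2 : ∫ y in x..(1 / 2), ((y ^ r : ℝ) : ℂ) * (frobeniusCoeff l θ k z y * θt z y) =
      U x - U (1 / 2) := by
    have hcθ := (hc.mul (P.thetat_mem z)).continuousOn
    have hadd := intervalIntegral.integral_add_adjacent_intervals (a := x) (b := 1 / 2) (c := 1)
      (intervalIntegrable_rpow_mul_of_pos r hcθ ⟨hx.1, hx.2.le⟩ ⟨hhalf.1, hhalf.2.le⟩)
      (intervalIntegrable_rpow_mul_of_pos r hcθ ⟨hhalf.1, hhalf.2.le⟩ (by simp))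
    rw [show U x - U (1 / 2) = ∫ y in x..(1 / 2), ((y ^ r : ℝ) : ℂ) * (c y * θt z y) from
      sub_eq_of_eq_add hadd.symm]
    refine intervalIntegral.integral_congr fun y hy => ?_
    rw [hcf y (ordConnected_Ioo.uIcc_subset hx hhalf hy)]
  rw [h2] at h1
  linear_combination -h1

/-- Below the critical order the Wronskian is a constant κ minus an integral which yields an upper
mean. The constant only contributes a multiple of x^s φ̃ with s > 0, which is in W^{1,1} and
vanishes at 0, so no condition on the entire part is needed. -/
theorem frobeniusCoeff_succ_of_lt {k : ℕ} (z : ℂ) (hk : 2 * ((k + 1 : ℕ) : ℝ) < 2 * l + 1)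
    {c : ℝ → ℂ} (hc : MemW11 c) (hcf : ∀ x ∈ Ioo (0 : ℝ) 1, c x = frobeniusCoeff l θ k z x) :
    ∃ c', MemW11 c' ∧ c' 0 = c 0 / (2 * (2 * l + 1 - 2 * ((k : ℂ) + 1))) ∧
      ∀ x ∈ Ioo (0 : ℝ) 1, c' x = frobeniusCoeff l θ (k + 1) z x := by
  obtain ⟨κ, hκ⟩ := P.exists_wronskianDeriv_eq k z hc hcf
  set s := 2 * l + 1 - 2 * ((k + 1 : ℕ) : ℝ) with hs
  have hs0 : 0 < s := by linarith
  have hp0 : (0 : ℝ) < 2 * ((k + 1 : ℕ) : ℝ) := by positivity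
  have hcφ := hc.mul (P.phit_mem z)
  have hcθ := hc.mul (P.thetat_mem z)
  refine ⟨fun x => (((k : ℂ) + 1) / (2 * l + 1) * (θt z x * lowerMean (2 * ((k + 1 : ℕ) : ℝ))
      (fun y => c y * φt z y) x) + ((k : ℂ) + 1) / (2 * l + 1) * (φt z x * upperMean s
      (fun y => c y * θt z y) x)) + (-((2 * l + 1) * κ)) * (((x ^ s : ℝ) : ℂ) * φt z x), ?_, ?_, ?_⟩
  · exact ((((P.thetat_mem z).mul (memW11_lowerMean hp0 hcφ)).const_mul _).add
      (((P.phit_mem z).mul (memW11_upperMean hs0 hcθ)).const_mul _)).add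
      (((MemW11.rpow hs0).mul (P.phit_mem z)).const_mul _)
  · have h1 : (2 * l + 1 - 2 * ((k : ℂ) + 1)) ≠ 0 := by
      have := hs0.ne'
      rw [hs] at this
      push_cast at this
      exact_mod_cast this
    have h2 : (k : ℂ) + 1 ≠ 0 := by exact_mod_cast k.succ_ne_zero
    have h0 := P.two_l_ne
    simp only [lowerMean, upperMean, if_true, P.phit_zero, P.thetat_zero, Real.zero_rpow hs0.ne']
    rw [hs]
    push_cast
    linear_combination div_mul_div_two_mul_add h0 h2 h1 (c 0)
  · intro x hx
    have hxs : ((x ^ s : ℝ) : ℂ) ≠ 0 := by exact_mod_cast (Real.rpow_pos_of_pos hx.1 _).ne'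
    have h0 := P.two_l_ne
    rw [P.frobeniusCoeff_succ k z hx, hκ x hx, integral_congr_coeff hcf _ le_rfl hx.2.le hx.1.le,
      ← hs]
    simp only [lowerMean, upperMean, if_neg hx.1.ne']
    field_simp
    ring

omit P in
theorem isSubpower_of_memW11 {c f : ℝ → ℂ} (hc : MemW11 c) (hcf : ∀ x ∈ Ioo (0 : ℝ) 1, c x = f x) :
    IsSubpower f := by
  refine IsSubpower.of_tendsto (a := c 0) ((tendsto_nhdsGT_of_continuousOn hc.continuousOn).congr' ?_)
  filter_upwards [Ioo_mem_nhdsGT one_pos] with x hx using hcf x hx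

/-- Above the critical order a constant in the Wronskian would contribute an unbounded negative
power of x. The hypothesis `hlim` excludes it, and the Wronskian yields a lower mean. -/
theorem frobeniusCoeff_succ_of_gt {k : ℕ} (z : ℂ) (hk : 2 * l + 1 < 2 * ((k + 1 : ℕ) : ℝ))
    {c : ℝ → ℂ} (hc : MemW11 c) (hcf : ∀ x ∈ Ioo (0 : ℝ) 1, c x = frobeniusCoeff l θ k z x)
    (hlim : Tendsto (fun x : ℝ => ((x ^ (-(l + 1)) : ℝ) : ℂ) * zDeriv (k + 1) θ z x) (𝓝[>] 0)
      (𝓝 0)) :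
    ∃ c', MemW11 c' ∧ c' 0 = c 0 / (2 * (2 * l + 1 - 2 * ((k : ℂ) + 1))) ∧
      ∀ x ∈ Ioo (0 : ℝ) 1, c' x = frobeniusCoeff l θ (k + 1) z x := by
  have hsub := isSubpower_of_memW11 hc hcf
  set p := 2 * ((k + 1 : ℕ) : ℝ) - (2 * l + 1) with hp
  have hp0 : 0 < p := by linarith
  have hp1 : (0 : ℝ) < 2 * ((k + 1 : ℕ) : ℝ) := by positivity
  have hcφ := hc.mul (P.phit_mem z)
  have hcθ := hc.mul (P.thetat_mem z)
  refine ⟨fun x => (((k : ℂ) + 1) / (2 * l + 1) * (θt z x * lowerMean (2 * ((k + 1 : ℕ) : ℝ))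
      (fun y => c y * φt z y) x) + (-(((k : ℂ) + 1) / (2 * l + 1))) * (φt z x * lowerMean p
      (fun y => c y * θt z y) x)), ?_, ?_, ?_⟩
  · exact ((((P.thetat_mem z).mul (memW11_lowerMean hp1 hcφ)).const_mul _).add
      (((P.phit_mem z).mul (memW11_lowerMean hp0 hcθ)).const_mul _))
  · have h1 : 2 * ((k : ℂ) + 1) - (2 * l + 1) ≠ 0 := by
      have := hp0.ne'
      rw [hp] at this
      push_cast at this
      exact_mod_cast this
    have h2 : (k : ℂ) + 1 ≠ 0 := by exact_mod_cast k.succ_ne_zero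
    have h0 := P.two_l_ne
    simp only [lowerMean, if_true, P.phit_zero, P.thetat_zero, hp]
    push_cast
    linear_combination div_mul_div_two_mul_sub h0 h2 h1 (c 0)
  · intro x hx
    have h0 := P.two_l_ne
    rw [P.frobeniusCoeff_succ k z hx, (P.wronskianDeriv_eq_integral hk hsub hlim hx).2,
      integral_congr_coeff hcf _ le_rfl hx.2.le hx.1.le,
      integral_congr_coeff hcf _ le_rfl hx.2.le hx.1.le, ← hp,
      show 2 * l + 1 - 2 * ((k + 1 : ℕ) : ℝ) = -p by rw [hp]; ring]
    simp only [lowerMean, if_neg hx.1.ne']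
    field_simp
    ring

/-- At the critical order the kernel is 1/y. Its integral up to 1 behaves like -c(0) log x, while κ
and the lower mean contribute bounded terms; the prefactor (k+1)/(2l+1) is 1/2. -/
theorem frobeniusCoeff_succ_of_eq {k : ℕ} (z : ℂ) (hk : 2 * l + 1 = 2 * ((k + 1 : ℕ) : ℝ))
    {c : ℝ → ℂ} (hc : MemW11 c) (hcf : ∀ x ∈ Ioo (0 : ℝ) 1, c x = frobeniusCoeff l θ k z x) :
    Tendsto (fun x => frobeniusCoeff l θ (k + 1) z x / (Real.log x : ℂ)) (𝓝[>] 0)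
      (𝓝 (-c 0 / 2)) := by
  obtain ⟨κ, hκ⟩ := P.exists_wronskianDeriv_eq k z hc hcf
  have hs : 2 * l + 1 - 2 * ((k + 1 : ℕ) : ℝ) = 0 := by linarith
  rw [hs] at hκ
  have hp1 : (0 : ℝ) < 2 * ((k + 1 : ℕ) : ℝ) := by positivity
  have hcφ := hc.mul (P.phit_mem z)
  have hcθ := hc.mul (P.thetat_mem z)
  have hinv : Tendsto (fun x : ℝ => (Real.log x : ℂ)⁻¹) (𝓝[>] 0) (𝓝 0) := by
    have := (Complex.continuous_ofReal.tendsto 0).comp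
      (Real.tendsto_log_nhdsGT_zero.inv_tendsto_atBot)
    rw [Complex.ofReal_zero] at this
    refine this.congr fun x => ?_
    simp
  have t1 := ((P.tendsto_thetat z).mul
    (tendsto_nhdsGT_of_continuousOn (continuousOn_lowerMean hp1 hcφ.continuousOn))).mul hinv
  have t2 := (P.tendsto_phit z).mul (tendsto_integral_inv_div_log hcθ.continuousOn)
  have t3 := (P.tendsto_phit z).mul hinv
  have t := ((t1.const_mul (((k : ℂ) + 1) / (2 * l + 1))).sub (t3.const_mul ((2 * l + 1) * κ))).add
    (t2.const_mul (((k : ℂ) + 1) / (2 * l + 1)))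
  have h0 := P.two_l_ne
  have hk' : ((k : ℂ) + 1) / (2 * l + 1) = 1 / 2 := by
    have : (2 * l + 1 : ℂ) = 2 * ((k : ℂ) + 1) := by
      have := congrArg (fun r : ℝ => (r : ℂ)) hk
      push_cast at this
      exact this
    have h2 : (k : ℂ) + 1 ≠ 0 := by exact_mod_cast k.succ_ne_zero
    rw [this]
    field_simp
  have e : ((k : ℂ) + 1) / (2 * l + 1) * (1 * lowerMean (2 * ((k + 1 : ℕ) : ℝ))
      (fun x => c x * φt z x) 0 * 0) - (2 * l + 1) * κ * (1 * 0) +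
      ((k : ℂ) + 1) / (2 * l + 1) * (1 * -(c 0 * θt z 0)) = -c 0 / 2 := by
    rw [hk', P.thetat_zero]
    ring
  rw [e] at t
  refine t.congr' ?_
  filter_upwards [Ioo_mem_nhdsGT one_pos] with x hx
  have h3 : (Real.log x : ℂ) ≠ 0 := by exact_mod_cast (Real.log_neg hx.1 hx.2).ne
  rw [P.frobeniusCoeff_succ k z hx, hκ x hx, integral_congr_coeff hcf _ le_rfl hx.2.le hx.1.le, hs]
  simp only [lowerMean, if_neg hx.1.ne', Real.rpow_zero, neg_zero, zero_sub]
  push_cast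
  field_simp
  ring

/-- A lower mean of exponent p turns C log x into (C/p) log x to leading order, exactly as it turns
a value C at 0 into C/p. So the coefficient of the logarithm obeys the recursion of
`frobeniusCoeff_succ_of_gt`. -/
theorem frobeniusCoeff_succ_log {k : ℕ} (z : ℂ) (hk : 2 * l + 1 < 2 * ((k + 1 : ℕ) : ℝ))
    {C : ℂ} (hC : Tendsto (fun x => frobeniusCoeff l θ k z x / (Real.log x : ℂ)) (𝓝[>] 0) (𝓝 C))
    (hlim : Tendsto (fun x : ℝ => ((x ^ (-(l + 1)) : ℝ) : ℂ) * zDeriv (k + 1) θ z x) (𝓝[>] 0)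
      (𝓝 0)) :
    Tendsto (fun x => frobeniusCoeff l θ (k + 1) z x / (Real.log x : ℂ)) (𝓝[>] 0)
      (𝓝 (C / (2 * (2 * l + 1 - 2 * ((k : ℂ) + 1))))) := by
  have hsub := IsSubpower.of_tendsto_div_log hC
  set p := 2 * ((k + 1 : ℕ) : ℝ) - (2 * l + 1) with hp
  have hp0 : 0 < p := by linarith
  have hp1 : (0 : ℝ) < 2 * ((k + 1 : ℕ) : ℝ) := by positivity
  have hhalf : (1 / 2 : ℝ) ∈ Ioo (0 : ℝ) 1 := ⟨by norm_num, by norm_num⟩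
  have cφ := (P.continuousOn_frobeniusCoeff k z).mul
    ((P.phit_fam.mono Ioo_subset_Ico_self).continuousOn_right z)
  have cθ := (P.continuousOn_frobeniusCoeff k z).mul
    ((P.thetat_fam.mono Ioo_subset_Ico_self).continuousOn_right z)
  have lφ : Tendsto (fun x => frobeniusCoeff l θ k z x * φt z x / (Real.log x : ℂ)) (𝓝[>] 0)
      (𝓝 C) := by
    have := hC.mul (P.tendsto_phit z)
    rw [mul_one] at this
    exact this.congr fun x => by ring
  have lθ : Tendsto (fun x => frobeniusCoeff l θ k z x * θt z x / (Real.log x : ℂ)) (𝓝[>] 0)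
      (𝓝 C) := by
    have := hC.mul (P.tendsto_thetat z)
    rw [mul_one] at this
    exact this.congr fun x => by ring
  have iφ : IntervalIntegrable (fun y => ((y ^ (2 * ((k + 1 : ℕ) : ℝ) - 1) : ℝ) : ℂ) *
      (frobeniusCoeff l θ k z y * φt z y)) volume 0 (1 / 2) := by
    refine intervalIntegrable_zero_of_isSubpower (r := 2 * ((k + 1 : ℕ) : ℝ) - 1)
      (continuousOn_rpow_mul _ (fun x hx => hx.1) cφ)
      (by linarith) (IsSubpower.of_tendsto_div_log lφ) (fun _ _ => rfl) hhalf
  have t1 := (P.tendsto_thetat z).mul (tendsto_lowerMean_div_log hp1 cφ hhalf iφ lφ)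
  have t2 := (P.tendsto_phit z).mul (tendsto_lowerMean_div_log hp0 cθ hhalf
    (P.wronskianDeriv_eq_integral hk hsub hlim hhalf).1 lθ)
  have t := (t1.const_mul (((k : ℂ) + 1) / (2 * l + 1))).sub
    (t2.const_mul (((k : ℂ) + 1) / (2 * l + 1)))
  have h0 := P.two_l_ne
  have e : ((k : ℂ) + 1) / (2 * l + 1) * (1 * (C / ((2 * ((k + 1 : ℕ) : ℝ) : ℝ) : ℂ))) -
      ((k : ℂ) + 1) / (2 * l + 1) * (1 * (C / (p : ℂ))) =
      C / (2 * (2 * l + 1 - 2 * ((k : ℂ) + 1))) := by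
    have h1 : 2 * ((k : ℂ) + 1) - (2 * l + 1) ≠ 0 := by
      have := hp0.ne'
      rw [hp] at this
      push_cast at this
      exact_mod_cast this
    have h2 : (k : ℂ) + 1 ≠ 0 := by exact_mod_cast k.succ_ne_zero
    rw [hp]
    push_cast
    linear_combination div_mul_div_two_mul_sub h0 h2 h1 C
  rw [e] at t
  refine t.congr' ?_
  filter_upwards [Ioo_mem_nhdsGT one_pos] with x hx
  have h3 : (Real.log x : ℂ) ≠ 0 := by exact_mod_cast (Real.log_neg hx.1 hx.2).ne
  rw [P.frobeniusCoeff_succ k z hx, (P.wronskianDeriv_eq_integral hk hsub hlim hx).2, ← hp,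
      show 2 * l + 1 - 2 * ((k + 1 : ℕ) : ℝ) = -p by rw [hp]; ring]
  simp only [Pi.mul_apply]
  field_simp

/-- The Frobenius coefficients of a solution without entire part. -/
theorem exists_frobeniusCoeff
    (hlim : ∀ k, nl l < k → ∀ z, Tendsto (fun x : ℝ => ((x ^ (-(l + 1)) : ℝ) : ℂ) *
      zDeriv k θ z x) (𝓝[>] 0) (𝓝 0)) (z : ℂ) (k : ℕ)
    (hk : (∀ n : ℕ, l + 1 / 2 ≠ n) ∨ k < nl l) :
    ∃ c, MemW11 c ∧ c 0 = (coeffTheta l k : ℂ) ∧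
      ∀ x ∈ Ioo (0 : ℝ) 1, c x = frobeniusCoeff l θ k z x := by
  induction k with
  | zero =>
    refine ⟨θt z, P.thetat_mem z, ?_, fun x hx => (P.frobeniusCoeff_zero z hx).symm⟩
    simp [P.thetat_zero, coeffTheta]
  | succ k ih =>
    obtain ⟨c, h1, h2, h3⟩ := ih (hk.imp_right fun h => by omega)
    have hval : c 0 / (2 * (2 * l + 1 - 2 * ((k : ℂ) + 1))) = (coeffTheta l (k + 1) : ℂ) := by
      rw [h2, coeffTheta_succ]
      push_cast
      rfl
    have hn1 := nl_le P.hl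
    have hn2 := lt_nl_add_one l
    -- Equality would mean l + 1/2 = k + 1, which both alternatives in `hk` exclude.
    have hcases : 2 * ((k + 1 : ℕ) : ℝ) < 2 * l + 1 ∨ 2 * l + 1 < 2 * ((k + 1 : ℕ) : ℝ) := by
      rcases hk with hk | hk
      · refine lt_or_gt_of_ne fun h => hk (k + 1) ?_
        linarith
      · left
        have : ((k + 1 : ℕ) : ℝ) + 1 ≤ nl l := by exact_mod_cast hk
        linarith
    rw [← hval]
    rcases hcases with h | h
    · exact P.frobeniusCoeff_succ_of_lt z h h1 h3
    · have hlt : nl l < k + 1 := by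
        have : (nl l : ℝ) < ((k + 1 : ℕ) : ℝ) := by linarith
        exact_mod_cast this
      exact P.frobeniusCoeff_succ_of_gt z h h1 h3 (hlim _ hlt z)

/-- The logarithm arises in the critical step from n_l - 1 to n_l, where n_l ≥ 1 because l + 1/2 >
0. All later steps lie above the critical order. -/
theorem tendsto_frobeniusCoeff_div_log
    (hlim : ∀ k, nl l < k → ∀ z, Tendsto (fun x : ℝ => ((x ^ (-(l + 1)) : ℝ) : ℂ) *
      zDeriv k θ z x) (𝓝[>] 0) (𝓝 0)) (z : ℂ) (hint : l + 1 / 2 = (nl l : ℝ)) (i : ℕ) :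
    Tendsto (fun x => frobeniusCoeff l θ (nl l + i) z x / (Real.log x : ℂ)) (𝓝[>] 0)
      (𝓝 (coeffLog l (nl l + i) : ℂ)) := by
  have hl := P.hl
  induction i with
  | zero =>
    obtain ⟨m, hm⟩ : ∃ m, nl l = m + 1 := by
      refine Nat.exists_eq_succ_of_ne_zero fun h => ?_
      rw [h] at hint
      push_cast at hint
      linarith
    have hint' : l + 1 / 2 = m + 1 := by rw [hint, hm]; push_cast; rfl
    obtain ⟨c, h1, h2, h3⟩ := P.exists_frobeniusCoeff hlim z m (Or.inr (by omega))
    have := P.frobeniusCoeff_succ_of_eq z (k := m) (by push_cast; linarith) h1 h3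
    rw [add_zero, hm, coeffLog_self hint' hm]
    rw [h2] at this
    push_cast
    exact this
  | succ i ih =>
    have := P.frobeniusCoeff_succ_log z (k := nl l + i) (by push_cast; nlinarith [Nat.cast_nonneg (α := ℝ) i])
      ih (hlim _ (by omega) z)
    rw [← add_assoc, coeffLog_succ hint]
    convert this using 2
    have h1 : (2 * l + 1 : ℂ) = 2 * (nl l : ℂ) := by
      have h := congrArg (fun r : ℝ => (r : ℂ)) hint
      push_cast at h
      linear_combination 2 * h
    have h2 : (i : ℂ) + 1 ≠ 0 := by exact_mod_cast i.succ_ne_zero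
    rw [h1]
    push_cast
    rw [show 2 * (nl l : ℂ) - 2 * (nl l + i + 1) = -(2 * ((i : ℂ) + 1)) by ring]
    field_simp
    ring

end SolutionPair

/-- Needed to pass from the limit of the quotient by log x to asymptotic equivalence. -/
theorem coeffLog_ne_zero {l : ℝ} (hl : -(1 / 2) < l) {k : ℕ} (hk : nl l ≤ k) :
    coeffLog l k ≠ 0 := by
  have h1 : ((k.choose (nl l) : ℕ) : ℝ) ≠ 0 := by exact_mod_cast (Nat.choose_pos hk).ne'
  have h2 := (ascPochhammer_pos (k - nl l) (l + 3 / 2) (by linarith)).ne'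
  have h3 := (Real.Gamma_pos_of_pos (show 0 < l + 1 / 2 by linarith)).ne'
  have h4 := (Real.rpow_pos_of_pos (show (0 : ℝ) < 4 by norm_num) l).ne'
  have h5 : coeffPhi l (k - nl l) ≠ 0 :=
    div_ne_zero (pow_ne_zero _ (by norm_num)) (mul_ne_zero (pow_ne_zero _ (by norm_num)) h2)
  exact div_ne_zero (neg_ne_zero.2 (mul_ne_zero h1 h5)) (mul_ne_zero h4 h3)

/-! ### Limits of spectral derivatives and of their Wronskians. -/

namespace SolutionPair

variable {l : ℝ} {φ θ φt θt : ℂ → ℝ → ℂ} (P : SolutionPair l φ θ φt θt) {F : ℂ → ℂ}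
include P

theorem tendsto_iteratedDeriv_mul_phit (hF : Differentiable ℂ F) (k : ℕ) (z : ℂ) :
    Tendsto (fun x => iteratedDeriv k (fun w => F w * φt w x) z) (𝓝[>] 0)
      (𝓝 (iteratedDeriv k F z)) :=
  ((P.tendstoLocallyUniformlyOn_mul_phit hF).iteratedDeriv (by
    filter_upwards [Ioo_mem_nhdsGT one_pos] with x hx
    exact hF.mul (P.phit_fam.entire x ⟨hx.1.le, hx.2⟩)) k).tendsto_at (mem_univ z)

theorem zDeriv_eq_add (hF : Differentiable ℂ F) (k : ℕ) (z : ℂ) {x : ℝ} (hx : x ∈ Ioo (0 : ℝ) 1) :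
    zDeriv k θ z x = zDeriv k (fun w y => θ w y - F w * φ w y) z x +
      ((x ^ (l + 1) : ℝ) : ℂ) * iteratedDeriv k (fun w => F w * φt w x) z := by
  have d1 := P.theta_fam.entire x hx
  have d2 : Differentiable ℂ fun w => F w * φ w x := hF.mul (P.phi_fam.entire x hx)
  have e : (fun w => θ w x - F w * φ w x) = (fun w => θ w x) - fun w => F w * φ w x := rfl
  rw [zDeriv, zDeriv, e, iteratedDeriv_sub d1.contDiff.contDiffAt d2.contDiff.contDiffAt,
    ← iteratedDeriv_const_mul_field]
  have e2 : (fun w => ((x ^ (l + 1) : ℝ) : ℂ) * (F w * φt w x)) = fun w => F w * φ w x := by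
    ext w
    rw [P.phi_eq w x hx]
    ring
  rw [e2]
  ring

theorem hasDerivAt_wronskianDeriv (k : ℕ) (z : ℂ) {x : ℝ} (hx : x ∈ Ioo (0 : ℝ) 1) :
    HasDerivAt (wronskianDeriv θ k z) (k * (zDeriv (k - 1) θ z x * θ z x)) x := by
  have h1 := hasDerivAt_integral_of_continuousOn
    ((P.continuousOn_zDeriv_theta (k - 1) z).mul (P.continuousOn_theta z)) hx
    (IntervalIntegrable.refl (a := x))
  refine ((h1.const_mul (k : ℂ)).const_add (wronskianDeriv θ k z x)).congr_of_eventuallyEq ?_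
  filter_upwards [Ioo_mem_nhds hx.1 hx.2] with y hy
  have := P.wronskianDeriv_sub k z hx hy
  simp only [Pi.mul_apply]
  rw [← this]
  ring

/-- As in variation of constants, the contributions of the differentiated coefficients cancel: both
are k θ^{(k-1)} θ φ. -/
theorem hasDerivAt_zDeriv {k : ℕ} (hk : 1 ≤ k) (z : ℂ) {x : ℝ} (hx : x ∈ Ioo (0 : ℝ) 1) :
    HasDerivAt (zDeriv k θ z)
      (deriv (θ z) x * (k * ∫ y in (0 : ℝ)..x, zDeriv (k - 1) θ z y * φ z y) -
        deriv (φ z) x * wronskianDeriv θ k z x) x := by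
  have h1 := hasDerivAt_integral_of_continuousOn
    ((P.continuousOn_zDeriv_theta (k - 1) z).mul (P.continuousOn_phi z)) hx
    (P.intervalIntegrable_zDeriv_mul_phi (k - 1) z z (a := 0) (by simp) ⟨hx.1.le, hx.2⟩)
  have h2 := ((P.theta_diff z x hx).hasDerivAt.mul (h1.const_mul (k : ℂ))).sub
    ((P.phi_diff z x hx).hasDerivAt.mul (P.hasDerivAt_wronskianDeriv k z hx))
  refine (h2.congr_deriv ?_).congr_of_eventuallyEq ?_
  · simp only [Pi.mul_apply]
    ring
  · filter_upwards [Ioo_mem_nhds hx.1 hx.2] with y hy using P.zDeriv_expansion hk z hy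

/-- θ^{(k)} and its x-derivative are the same combination of θ, φ and of θ', φ', so the Wronskian
acts linearly. -/
theorem wronskian_zDeriv {k : ℕ} (hk : 1 ≤ k) (z ζ : ℂ) {x : ℝ} (hx : x ∈ Ioo (0 : ℝ) 1) :
    wronskian (zDeriv k θ z) (θ ζ) x =
      (k * ∫ y in (0 : ℝ)..x, zDeriv (k - 1) θ z y * φ z y) * wronskian (θ z) (θ ζ) x +
        wronskianDeriv θ k z x * wronskian (θ ζ) (φ z) x := by
  simp only [wronskian]
  rw [(P.hasDerivAt_zDeriv hk z hx).deriv, P.zDeriv_expansion hk z hx]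
  ring

theorem exists_bound_wronskian (z ζ : ℂ) : ∃ M, 0 ≤ M ∧ ∀ x ∈ Ioc (0 : ℝ) (1 / 2),
    ‖wronskian (θ z) (θ ζ) x‖ ≤ M * x ^ (-(2 * l + 1)) := by
  have h2l := P.two_l_pos
  obtain ⟨A, hA0, hA⟩ := P.exists_bound_theta (isCompact_singleton (x := z))
  obtain ⟨B, hB0, hB⟩ := P.exists_bound_theta (isCompact_singleton (x := ζ))
  have hhalf : (1 / 2 : ℝ) ∈ Ioo (0 : ℝ) 1 := ⟨by norm_num, by norm_num⟩
  -- The product of the two solutions is O(y^{-2l}). The weaker exponent -2l - 2 is below -1 for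
  -- every l > -1/2, which avoids a case distinction, and it integrates to the power needed in
  -- `tendsto_wronskian_zDeriv`.
  set r : ℝ := -(2 * l) - 2 with hr
  have hr1 : r + 1 = -(2 * l + 1) := by rw [hr]; ring
  refine ⟨‖wronskian (θ z) (θ ζ) (1 / 2)‖ + ‖z - ζ‖ * (A * B / (2 * l + 1)), by positivity,
    fun x hx => ?_⟩
  have h1 := P.wronskian_theta z ζ x ⟨hx.1, by linarith [hx.2]⟩ (1 / 2) hhalf
  have h2 : ‖∫ y in x..(1 / 2), θ z y * θ ζ y‖ ≤ A * B / (-(r + 1)) * x ^ (r + 1) := by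
    refine norm_integral_le_rpow_of_lt hx.1 hx.2 (by positivity) (by linarith) fun y hy => ?_
    have hy' : y ∈ Ioc (0 : ℝ) (1 / 2) := ⟨hx.1.trans hy.1, hy.2⟩
    rw [norm_mul]
    refine (mul_le_mul (hA z rfl y hy') (hB ζ rfl y hy') (norm_nonneg _)
      (mul_nonneg hA0 (Real.rpow_nonneg hy'.1.le _))).trans ?_
    rw [show A * y ^ (-l) * (B * y ^ (-l)) = A * B * (y ^ (-l) * y ^ (-l)) by ring,
      ← Real.rpow_add hy'.1]
    exact mul_le_mul_of_nonneg_left (Real.rpow_le_rpow_of_exponent_ge hy'.1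
      (by linarith [hy'.2]) (by linarith)) (by positivity)
  rw [hr1, neg_neg] at h2
  have hone : (1 : ℝ) ≤ x ^ (-(2 * l + 1)) :=
    Real.one_le_rpow_of_pos_of_le_one_of_nonpos hx.1 (by linarith [hx.2]) (by linarith)
  rw [show wronskian (θ z) (θ ζ) x = wronskian (θ z) (θ ζ) (1 / 2) -
    (z - ζ) * ∫ y in x..(1 / 2), θ z y * θ ζ y by rw [← h1]; ring, add_mul]
  refine (norm_sub_le _ _).trans (add_le_add (le_mul_of_one_le_right (norm_nonneg _) hone) ?_)
  rw [norm_mul, mul_assoc]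
  exact mul_le_mul_of_nonneg_left h2 (norm_nonneg _)

/-- In `wronskian_zDeriv` the first term is o(x^{2l+1}) · O(x^{-(2l+1)}). In the second,
W(θ(ζ),φ(z)) → 1, so the limit does not depend on ζ. -/
theorem tendsto_wronskian_zDeriv {k : ℕ} {z a : ℂ}
    (h : Tendsto (fun x : ℝ => ((x ^ (1 - l) : ℝ) : ℂ) * zDeriv k θ z x) (𝓝[>] 0) (𝓝 0))
    (hlim : Tendsto (fun x : ℝ => ((x ^ (-(l + 1)) : ℝ) : ℂ) * zDeriv (k + 1) θ z x) (𝓝[>] 0)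
      (𝓝 a)) (ζ : ℂ) :
    Tendsto (fun x => wronskian (zDeriv (k + 1) θ z) (θ ζ) x) (𝓝[>] 0) (𝓝 (-a)) := by
  obtain ⟨M, -, hM⟩ := P.exists_bound_wronskian z ζ
  have h1 : Tendsto (fun x => (((k + 1 : ℕ) : ℂ) * ∫ y in (0 : ℝ)..x, zDeriv k θ z y * φ z y) *
      wronskian (θ z) (θ ζ) x) (𝓝[>] 0) (𝓝 0) := by
    have h2 := ((P.tendsto_rpow_mul_integral_zDeriv h).const_mul ((k + 1 : ℕ) : ℂ)).norm.mul_const M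
    rw [mul_zero, norm_zero, zero_mul] at h2
    refine squeeze_zero_norm' ?_ h2
    filter_upwards [Ioc_mem_nhdsGT (show (0 : ℝ) < 1 / 2 by norm_num)] with x hx
    have hx0 := Real.rpow_pos_of_pos hx.1 (-(2 * l + 1))
    rw [norm_mul, norm_mul, norm_mul, norm_mul, Complex.norm_real, Real.norm_eq_abs,
      abs_of_pos hx0]
    refine (mul_le_mul_of_nonneg_left (hM x hx) (by positivity)).trans_eq (by ring)
  have h3 : Tendsto (fun x => wronskian (θ ζ) (φ z) x) (𝓝[>] 0) (𝓝 1) := by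
    have h4 := ((P.tendsto_primitive_mul_phi 0 ζ z).const_mul (ζ - z)).const_add 1
    rw [mul_zero, add_zero] at h4
    refine h4.congr' ?_
    filter_upwards [Ioo_mem_nhdsGT one_pos] with x hx
    rw [P.wronskian_theta_phi ζ z hx, zDeriv_zero]
  have h5 := h1.add ((P.tendsto_wronskianDeriv h hlim).mul h3)
  rw [zero_add, mul_one] at h5
  refine h5.congr' ?_
  filter_upwards [Ioo_mem_nhdsGT one_pos] with x hx
  rw [P.wronskian_zDeriv (by omega) z ζ hx, Nat.add_sub_cancel]

theorem hasSum_frobeniusCoeff (z₀ z : ℂ) {x : ℝ} (hx : x ∈ Ioo (0 : ℝ) 1) :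
    HasSum (fun k : ℕ => ((x ^ (-l) / (2 * l + 1) : ℝ) : ℂ) *
      ((x : ℂ) ^ (2 * k) * frobeniusCoeff l θ k z₀ x / (k.factorial : ℂ) * (z - z₀) ^ k))
      (θ z x) := by
  have h := Complex.hasSum_taylorSeries_of_entire (P.theta_fam.entire x hx) z₀ z
  refine (congrArg (fun f => HasSum f (θ z x)) (funext fun k => ?_)).mp h
  have e : iteratedDeriv k (fun w => θ w x) z₀ = zDeriv k θ z₀ x := rfl
  rw [e, P.zDeriv_eq_frobeniusCoeff k z₀ hx.1, sub_eq_add_neg (2 * (k : ℝ)) l, Real.rpow_add hx.1,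
    show (2 * k : ℝ) = ((2 * k : ℕ) : ℝ) by push_cast; rfl, Real.rpow_natCast, smul_eq_mul,
    smul_eq_mul]
  push_cast
  ring

theorem isFrobeniusRepresentation_zero
    (hlim : ∀ k, nl l < k → ∀ z, Tendsto (fun x : ℝ => ((x ^ (-(l + 1)) : ℝ) : ℂ) *
      zDeriv k θ z x) (𝓝[>] 0) (𝓝 0)) : IsFrobeniusRepresentation l φ θ 0 := by
  refine ⟨differentiable_const 0, fun z₀ => ?_⟩
  have hex : ∀ k : ℕ, ∃ c : ℝ → ℂ, (((∀ n : ℕ, l + 1 / 2 ≠ n) ∨ k < nl l) →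
      MemW11 c ∧ c 0 = (coeffTheta l k : ℂ)) ∧
      ∀ x ∈ Ioo (0 : ℝ) 1, c x = frobeniusCoeff l θ k z₀ x := fun k => by
    by_cases hk : (∀ n : ℕ, l + 1 / 2 ≠ n) ∨ k < nl l
    · obtain ⟨c, h1, h2, h3⟩ := P.exists_frobeniusCoeff hlim z₀ k hk
      exact ⟨c, fun _ => ⟨h1, h2⟩, h3⟩
    · exact ⟨_, fun h => absurd h hk, fun _ _ => rfl⟩
  choose c hc hcf using hex
  refine ⟨c, fun z x hx => ?_, hc, fun k hint hk => ?_⟩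
  · simp only [hcf _ x hx, Pi.zero_apply, zero_mul, sub_zero]
    exact P.hasSum_frobeniusCoeff z₀ z hx
  · obtain ⟨i, rfl⟩ := Nat.exists_eq_add_of_le hk
    have h1 := P.tendsto_frobeniusCoeff_div_log hlim z₀ hint i
    have hne : (coeffLog l (nl l + i) : ℂ) ≠ 0 := by exact_mod_cast coeffLog_ne_zero P.hl hk
    have hlog : ∀ᶠ x in 𝓝[>] (0 : ℝ), (Real.log x : ℂ) ≠ 0 := by
      filter_upwards [Ioo_mem_nhdsGT one_pos] with x hx
      exact_mod_cast (Real.log_neg hx.1 hx.2).ne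
    rw [Asymptotics.isEquivalent_iff_tendsto_one (by
      filter_upwards [hlog] with x hx
      push_cast
      exact mul_ne_zero hne hx)]
    have h2 := h1.div_const (coeffLog l (nl l + i) : ℂ)
    rw [div_self hne] at h2
    refine h2.congr' ?_
    filter_upwards [Ioo_mem_nhdsGT one_pos] with x hx
    simp only [Pi.div_apply]
    rw [hcf _ x hx]
    push_cast
    rw [div_div, mul_comm (Real.log x : ℂ)]

end SolutionPair

/-! ### Recovering the entire part from a given representation. -/

theorem IsSubpower.congr' {c d : ℝ → ℂ} (h : IsSubpower c) (hcd : c =ᶠ[𝓝[>] 0] d) :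
    IsSubpower d := fun ε hε => (h ε hε).congr' (hcd.mono fun x hx => by rw [hx])

theorem IsSubpower.of_isEquivalent_log {c : ℝ → ℂ} {C : ℝ}
    (h : Asymptotics.IsEquivalent (𝓝[>] (0 : ℝ)) c fun x => ((C * Real.log x : ℝ) : ℂ)) :
    IsSubpower c := fun ε hε => by
  have h1 : IsSubpower fun x => ((C * Real.log x : ℝ) : ℂ) := by
    refine IsSubpower.of_tendsto_div_log (a := C) (tendsto_const_nhds.congr' ?_)
    filter_upwards [Ioo_mem_nhdsGT one_pos] with x hx
    have : (Real.log x : ℂ) ≠ 0 := by exact_mod_cast (Real.log_neg hx.1 hx.2).ne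
    push_cast
    field_simp
  exact ((Asymptotics.IsEquivalent.refl (u := fun x : ℝ => ((x ^ ε : ℝ) : ℂ))).mul
    h.symm).tendsto_nhds (h1 ε hε)

/-- By uniqueness of Taylor coefficients the given functions are the Frobenius coefficients of θ -
Fφ. Bounded or logarithmic, they are negligible against every negative power, which is all that the
limits require. -/
theorem IsFrobeniusRepresentation.isSubpower {l : ℝ} (hl : -(1 / 2) < l) {φ θ : ℂ → ℝ → ℂ}
    {F : ℂ → ℂ} (h : IsFrobeniusRepresentation l φ θ F) (k : ℕ) (z : ℂ) :
    IsSubpower (frobeniusCoeff l (fun w x => θ w x - F w * φ w x) k z) := by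
  obtain ⟨c, h1, h2, h3⟩ := h.series z
  have hc : IsSubpower (c k) := by
    by_cases hk : (∀ n : ℕ, l + 1 / 2 ≠ n) ∨ k < nl l
    · exact IsSubpower.of_tendsto (tendsto_nhdsGT_of_continuousOn (h2 k hk).1.continuousOn)
    · push Not at hk
      obtain ⟨⟨n, hn⟩, hk⟩ := hk
      refine IsSubpower.of_isEquivalent_log (h3 k ?_ hk)
      rw [nl, hn, Nat.floor_natCast]
  refine hc.congr' ?_
  filter_upwards [Ioo_mem_nhdsGT one_pos] with x hx
  have e := iteratedDeriv_eq_of_hasSum (f := fun w => θ w x - F w * φ w x) (z₀ := z)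
    (a := fun k => ((x ^ (-l) / (2 * l + 1) : ℝ) : ℂ) *
      ((x : ℂ) ^ (2 * k) * c k x / (k.factorial : ℂ)))
    (fun w => by simpa only [mul_assoc] using h1 w x hx) k
  have hx1 := Real.rpow_pos_of_pos hx.1 l
  have e1 : x ^ (l - 2 * k) = x ^ l * (x ^ (2 * k))⁻¹ := by
    rw [sub_eq_add_neg, Real.rpow_add hx.1, Real.rpow_neg hx.1.le]
    norm_cast
  have h2l : (2 * l + 1 : ℂ) ≠ 0 := by
    have : 2 * l + 1 ≠ 0 := by linarith
    exact_mod_cast this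
  have hxl : ((x ^ l : ℝ) : ℂ) ≠ 0 := by exact_mod_cast hx1.ne'
  have hx0 : (x : ℂ) ≠ 0 := by exact_mod_cast hx.1.ne'
  have hf : (k.factorial : ℂ) ≠ 0 := by exact_mod_cast k.factorial_ne_zero
  rw [frobeniusCoeff, zDeriv, e, e1, Real.rpow_neg hx.1.le]
  push_cast
  field_simp

/-- The limits of the spectral derivatives of `θ` detect the entire part. -/
theorem IsFrobeniusRepresentation.tendsto {l : ℝ} (hl : -(1 / 2) < l) {q : ℝ → ℝ}
    (hq : IntegrableOn (fun x => x * q x) (Ioo 0 1)) {φ θ : ℂ → ℝ → ℂ}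
    (h : IsEntireSystem l q φ θ) {F : ℂ → ℂ} (hF : IsFrobeniusRepresentation l φ θ F) (z : ℂ) :
    Tendsto (fun x : ℝ => ((x ^ (-(l + 1)) : ℝ) : ℂ) * zDeriv (nl l + 1) θ z x)
        (𝓝[>] 0) (𝓝 (iteratedDeriv (nl l + 1) F z)) ∧
      ∀ ζ, Tendsto (fun x => wronskian (zDeriv (nl l + 1) θ z) (θ ζ) x) (𝓝[>] 0)
        (𝓝 (-iteratedDeriv (nl l + 1) F z)) := by
  obtain ⟨φt, θt, P⟩ := h.exists_solutionPair hl hq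
  obtain ⟨φt', θt', Q⟩ := (h.sub_mul hl hq hF.entire).exists_solutionPair hl hq
  have hn := lt_nl_add_one l
  -- For θ - Fφ the total exponent, here and in `h1`, is 2n_l + 1 - 2l > 0. The part Fφ contributes
  -- x^{1-l} x^{l+1} = x².
  have h0 : Tendsto (fun x : ℝ => ((x ^ (1 - l) : ℝ) : ℂ) * zDeriv (nl l) θ z x) (𝓝[>] 0)
      (𝓝 0) := by
    have h1 := Q.tendsto_rpow_mul_zDeriv (r := 1 - l) (by linarith) (hF.isSubpower hl (nl l) z)
    have h3 : Tendsto (fun x : ℝ => ((x ^ (2 : ℝ) : ℝ) : ℂ) *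
        iteratedDeriv (nl l) (fun w => F w * φt w x) z) (𝓝[>] 0) (𝓝 0) := by
      have := ((Complex.continuous_ofReal.tendsto 0).comp
        (tendsto_rpow_nhdsGT (show (0 : ℝ) < 2 by norm_num))).mul
        (P.tendsto_iteratedDeriv_mul_phit hF.entire (nl l) z)
      rwa [Complex.ofReal_zero, zero_mul] at this
    have h4 := h1.add h3
    rw [add_zero] at h4
    refine h4.congr' ?_
    filter_upwards [Ioo_mem_nhdsGT one_pos] with x hx
    rw [P.zDeriv_eq_add hF.entire _ z hx, show (2 : ℝ) = (1 - l) + (l + 1) by ring,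
      Real.rpow_add hx.1]
    push_cast
    ring
  have h1 : Tendsto (fun x : ℝ => ((x ^ (-(l + 1)) : ℝ) : ℂ) * zDeriv (nl l + 1) θ z x)
        (𝓝[>] 0) (𝓝 (iteratedDeriv (nl l + 1) F z)) := by
    have h2 := (Q.tendsto_rpow_mul_zDeriv (r := -(l + 1)) (by push_cast; linarith)
      (hF.isSubpower hl (nl l + 1) z)).add
      (P.tendsto_iteratedDeriv_mul_phit hF.entire (nl l + 1) z)
    rw [zero_add] at h2
    refine h2.congr' ?_
    filter_upwards [Ioo_mem_nhdsGT one_pos] with x hx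
    have hx1 : ((x ^ (l + 1) : ℝ) : ℂ) ≠ 0 := by
      exact_mod_cast (Real.rpow_pos_of_pos hx.1 _).ne'
    rw [P.zDeriv_eq_add hF.entire _ z hx, Real.rpow_neg hx.1.le]
    push_cast
    field_simp
  exact ⟨h1, P.tendsto_wronskian_zDeriv h0 h1⟩

/-- A representation of θ - Fφ with entire part 0 is a representation of θ with entire part F. -/
theorem IsEntireSystem.exists_isFrobeniusRepresentation {l : ℝ} (hl : -(1 / 2) < l) {q : ℝ → ℝ}
    (hq : IntegrableOn (fun x => x * q x) (Ioo 0 1)) {φ θ : ℂ → ℝ → ℂ}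
    (h : IsEntireSystem l q φ θ) : ∃ F : ℂ → ℂ, IsFrobeniusRepresentation l φ θ F ∧
      (IsRealSystem θ → ∀ z, F (starRingEnd ℂ z) = starRingEnd ℂ (F z)) := by
  obtain ⟨F, hF, hlim, hreal⟩ := h.exists_entirePart hl hq
  obtain ⟨φt, θt, P⟩ := (h.sub_mul hl hq hF).exists_solutionPair hl hq
  have hrep := P.isFrobeniusRepresentation_zero hlim
  exact ⟨F, ⟨hF, by simpa using hrep.series⟩, hreal⟩

/-- For any system as in `IsEntireSystem`: the Frobenius type representation of `θ` exists (with a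
real entire `F` if `θ` is real); whether `F` is a polynomial of degree at most `n_l` does not depend
on the choice of the representation; and the Frobenius type property is equivalent to the
vanishing of `F^{(n_l+1)}(z) = lim x^{-(l+1)} θ^{(n_l+1)}(z,x)` and to the vanishing of
`lim W_x(θ^{(n_l+1)}(z), θ(ζ))` for all `z` and `ζ`. -/
theorem corollary3p10 (l : ℝ) (hl : -(1 / 2) < l) (q : ℝ → ℝ)
    (hq : IntegrableOn (fun x => x * q x) (Ioo 0 1))
    (φ θ : ℂ → ℝ → ℂ) (h : IsEntireSystem l q φ θ) :
    (∃ F : ℂ → ℂ, IsFrobeniusRepresentation l φ θ F ∧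
      (IsRealSystem θ → ∀ z, F (starRingEnd ℂ z) = starRingEnd ℂ (F z))) ∧
    (∀ F : ℂ → ℂ, IsFrobeniusRepresentation l φ θ F →
      (∀ z, Tendsto (fun x : ℝ => ((x ^ (-(l + 1)) : ℝ) : ℂ) * zDeriv (nl l + 1) θ z x)
        (𝓝[>] 0) (𝓝 (iteratedDeriv (nl l + 1) F z))) ∧
      (IsFrobeniusType l φ θ ↔ IsPolynomialOfDegreeLE (nl l) F)) ∧
    (IsFrobeniusType l φ θ ↔
      ∀ z, Tendsto (fun x : ℝ => ((x ^ (-(l + 1)) : ℝ) : ℂ) * zDeriv (nl l + 1) θ z x)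
        (𝓝[>] 0) (𝓝 0)) ∧
    (IsFrobeniusType l φ θ ↔
      ∀ z ζ, Tendsto (fun x => wronskian (zDeriv (nl l + 1) θ z) (θ ζ) x) (𝓝[>] 0) (𝓝 0)) := by
  obtain ⟨F₀, hF₀, hreal⟩ := h.exists_isFrobeniusRepresentation hl hq
  -- The limit of x^{-(l+1)}θ^{(n_l+1)} depends on θ alone, so any two entire parts share their
  -- derivative of order n_l + 1.
  have key : ∀ F, IsFrobeniusRepresentation l φ θ F →
      (IsFrobeniusType l φ θ ↔ ∀ z, iteratedDeriv (nl l + 1) F z = 0) := fun F hF => by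
    constructor
    · rintro ⟨G, hG, hpoly⟩ z
      rw [tendsto_nhds_unique (hF.tendsto hl hq h z).1 (hG.tendsto hl hq h z).1]
      exact hpoly.iteratedDeriv_eq_zero (Nat.lt_succ_self _) z
    · exact fun hz => ⟨F, hF, (isPolynomialOfDegreeLE_iff hF.entire _).2 hz⟩
  refine ⟨⟨F₀, hF₀, hreal⟩, fun F hF => ⟨fun z => (hF.tendsto hl hq h z).1,
    (key F hF).trans (isPolynomialOfDegreeLE_iff hF.entire _).symm⟩, ?_, ?_⟩
  · refine (key F₀ hF₀).trans (forall_congr' fun z => ?_)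
    have hlim := (hF₀.tendsto hl hq h z).1
    exact ⟨fun hz => hz ▸ hlim, fun hz => tendsto_nhds_unique hlim hz⟩
  · refine (key F₀ hF₀).trans (forall_congr' fun z => ?_)
    have hlim := (hF₀.tendsto hl hq h z).2
    -- The limit is the same for all ζ, so the single value ζ = 0 suffices for the converse.
    refine ⟨fun hz ζ => ?_, fun hz => neg_eq_zero.1 (tendsto_nhds_unique (hlim 0) (hz 0))⟩
    have := hlim ζ
    rwa [hz, neg_zero] at this
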